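/- Let $m,n$ be positive integers and $g$ a non-negative integer, and put $b=2g-2+m+n$. Let $W=\{(\mu,\nu)\in\mathbb{Z}_{>0}^m\times\mathbb{Z}_{>0}^n \mid \sum_{i=1}^m\mu_i=\sum_{j=1}^n\nu_j\}$. For $(\mu,\nu)\in W$ with $d=\sum_i\mu_i$, a Hurwitz galaxy of type $(g,\mu,\nu)$ is a graph $G$ on a connected closed oriented surface $S$ of genus $g$ such that: (i) $S\setminus G$ is a disjoint union of open disks (the faces); (ii) there are $m$ white faces, labelled $1,\dots,m$, and $n$ black faces, labelled $1,\dots,n$, and each edge has a white face on one side and a black face on the other; (iii) the boundary of the white face labelled $i$ (respectively of the black face labelled $j$) passes through $\mu_i b$ (respectively $\nu_j b$) vertices, counted with multiplicity; (iv) the vertices are labelled by $1,\dots,b$, cyclically counterclockwise along the boundary of each white face; (v) for each $k\in\{1,\dots,b\}$ there are exactly $d-2$ vertices labelled $k$ that are 2-valent and exactly one vertex labelled $k$ that is 4-valent, and there are no other vertices. (If $b=0$, i.e. $g=0$, $m=n=1$, the graph is a circle without vertices on the sphere; both of its faces are loop faces in the sense below.) Isomorphisms of Hurwitz galaxies are orientation-preserving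 homeomorphisms of the surfaces that restrict to graph isomorphisms respecting all labels (taken up to isotopy when automorphisms are counted). A face is a loop face if it is adjacent to at most one 4-valent vertex, and $G$ is bi-pruned if it has no loop faces. The bi-pruned double Hurwitz number is $$Ph_g(\mu,\nu)=\sum_{[G]}\frac{1}{|\mathrm{Aut}(G)|}\in\mathbb{Q},$$ the sum being over all isomorphism classes of bi-pruned Hurwitz galaxies of type $(g,\mu,\nu)$. In the real hyperplane $\{(x,y)\in\mathbb{R}^m\times\mathbb{R}^n\mid\sum_i x_i=\sum_j y_j\}$ consider the arrangement of the walls $\sum_{i\in I}x_i=\sum_{j\in J}y_j$ for all $I\subseteq\{1,\dots,m\}$, $J\subseteq\{1,\dots,n\}$ with $(I,J)$ different from $(\emptyset,\emptyset)$ and $(\{1,\dots,m\},\{1,\dots,n\})$. Let the chamber $C$ be a connected component of its complement. Then there is a polynomial $P^C_{g;m,n}$ in $m+n$ variables with rational coefficients, of degree at most $4g-3+m+n$ (the zero polynomial having degree $-\infty$), such that $$Ph_g(\mu,\nu)=P^C_{g;m,n}(\mu,\nu)\qquad\text{for all }(\mu,\nu)\in W\cap C.$$ -/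

import Mathlib

namespace Hurwitz

/-! ### Graphs cellularly embedded in connected oriented surfaces

A graph on a connected oriented closed surface whose complement is a disjoint union of open disks is
encoded, as usual, by its set `D` of darts (oriented edges) together with the reversal `opp` of
darts and the counterclockwise rotation `rot` of the darts leaving a common vertex. Isomorphism of
such data is orientation preserving homeomorphism of the surfaces carrying graph to graph,
up to isotopy. -/

/-- A connected cellularly embedded graph with set of darts `D`. -/
@[ext]
structure CombMap (D : Type*) where
  /-- `rot x` is the next dart after `x` in counterclockwise order around the tail of `x`. -/
  rot : Equiv.Perm D
  /-- `opp x` is the dart `x` traversed in the opposite direction. -/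
  opp : Equiv.Perm D
  opp_opp : ∀ x, opp (opp x) = x
  opp_ne : ∀ x, opp x ≠ x
  connected : ∀ x y : D, ∃ p ∈ Subgroup.closure ({rot, opp} : Set (Equiv.Perm D)), p x = y

namespace CombMap

variable {D : Type*}

/-- The dart following `x` when one walks along `x` keeping the face on the left of `x` on the left:
arriving at the head of `x`, one leaves along the dart which precedes `opp x` in the counterclockwise
order. Thus the boundary of each face is traversed counterclockwise as seen from the face. -/
def next (M : CombMap D) : Equiv.Perm D := M.rot⁻¹ * M.opp

/-- Vertices: orbits of the rotation. -/
def Vertex (M : CombMap D) : Type _ := Quotient (Equiv.Perm.SameCycle.setoid M.rot)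

/-- Edges: orbits of the reversal. -/
def Edge (M : CombMap D) : Type _ := Quotient (Equiv.Perm.SameCycle.setoid M.opp)

/-- Faces: orbits of the walk with the face on the left. -/
def Face (M : CombMap D) : Type _ := Quotient (Equiv.Perm.SameCycle.setoid M.next)

/-- The vertex from which the dart `x` leaves. -/
def tail (M : CombMap D) (x : D) : M.Vertex := Quotient.mk _ x

/-- The face on the left of the dart `x`. -/
def left (M : CombMap D) (x : D) : M.Face := Quotient.mk _ x

/-- The valence of a vertex: the number of darts leaving it (a graph loop counts twice). -/
noncomputable def valence (M : CombMap D) (v : M.Vertex) : ℕ := Nat.card {x : D // M.tail x = v}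

/-- The boundary length of a face: the number of vertices met by its boundary walk, counted with
multiplicity. -/
noncomputable def boundaryLength (M : CombMap D) (f : M.Face) : ℕ :=
  Nat.card {x : D // M.left x = f}

end CombMap

/-! ### Hurwitz galaxies -/

/-- The number `b = 2g - 2 + m + n` of simple branch points. (For `m, n ≥ 1` the subtraction does not
truncate.) -/
def branchCount (g m n : ℕ) : ℕ := 2 * g + m + n - 2

/-- A Hurwitz galaxy of type `(g, μ, ν)` with set of darts `D`. The white face labelled `i` is
`Sum.inl i` and the black face labelled `j` is `Sum.inr j`.

(If `b = 0`, that is `g = 0` and `m = n = 1`, the galaxy is a circle without vertices, which is not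
encoded by darts; its two faces are loop faces, so that it is not bi-pruned.) -/
structure HurwitzGalaxy (D : Type*) (g : ℕ) {m n : ℕ} (μ : Fin m → ℕ) (ν : Fin n → ℕ)
    extends CombMap D where
  /-- The surface has genus `g`: its Euler characteristic is `2 - 2g`. -/
  euler : (Nat.card toCombMap.Vertex : ℤ) - Nat.card toCombMap.Edge + Nat.card toCombMap.Face
    = 2 - 2 * g
  /-- There are `m` white and `n` black faces, labelled by `1, …, m` and `1, …, n`. -/
  faceLabel : toCombMap.Face ≃ Fin m ⊕ Fin n
  /-- Each edge has a white face on one side and a black face on the other side. -/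
  bicoloured : ∀ x, (faceLabel (toCombMap.left (opp x))).isLeft
    = !(faceLabel (toCombMap.left x)).isLeft
  white_length : ∀ i, toCombMap.boundaryLength (faceLabel.symm (Sum.inl i))
    = μ i * branchCount g m n
  black_length : ∀ j, toCombMap.boundaryLength (faceLabel.symm (Sum.inr j))
    = ν j * branchCount g m n
  /-- The labels `1, …, b` of the vertices. -/
  vertexLabel : toCombMap.Vertex → Fin (branchCount g m n)
  /-- The vertices along the boundary of a white face are labelled cyclically counterclockwise.
  (Since every edge has a white side, those along black faces are then labelled clockwise.) -/
  cyclic : ∀ x, (faceLabel (toCombMap.left x)).isLeft →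
    vertexLabel (toCombMap.tail (toCombMap.next x))
      = finRotate _ (vertexLabel (toCombMap.tail x))
  /-- Every vertex is 2-valent or 4-valent. -/
  valence_eq : ∀ v, toCombMap.valence v = 2 ∨ toCombMap.valence v = 4
  /-- For each label there are `d - 2` vertices of valence 2, where `d = ∑ i, μ i`. -/
  card_two : ∀ k, Nat.card {v // vertexLabel v = k ∧ toCombMap.valence v = 2} + 2 = ∑ i, μ i
  /-- For each label there is one vertex of valence 4. -/
  card_four : ∀ k, Nat.card {v // vertexLabel v = k ∧ toCombMap.valence v = 4} = 1

namespace HurwitzGalaxy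

variable {D D' D'' : Type*} {g m n : ℕ} {μ : Fin m → ℕ} {ν : Fin n → ℕ}

/-- Isomorphisms of Hurwitz galaxies: isomorphisms of embedded graphs respecting all labels. -/
@[ext]
structure Iso (G : HurwitzGalaxy D g μ ν) (H : HurwitzGalaxy D' g μ ν) where
  toEquiv : D ≃ D'
  map_rot : ∀ x, toEquiv (G.rot x) = H.rot (toEquiv x)
  map_opp : ∀ x, toEquiv (G.opp x) = H.opp (toEquiv x)
  map_vertexLabel : ∀ x, H.vertexLabel (H.tail (toEquiv x)) = G.vertexLabel (G.tail x)
  map_faceLabel : ∀ x, H.faceLabel (H.left (toEquiv x)) = G.faceLabel (G.left x)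

namespace Iso

/-- The identity. -/
def refl (G : HurwitzGalaxy D g μ ν) : Iso G G :=
  ⟨Equiv.refl D, fun _ => rfl, fun _ => rfl, fun _ => rfl, fun _ => rfl⟩

/-- Composition. -/
def trans {G : HurwitzGalaxy D g μ ν} {H : HurwitzGalaxy D' g μ ν} {K : HurwitzGalaxy D'' g μ ν}
    (e : Iso G H) (f : Iso H K) : Iso G K where
  toEquiv := e.toEquiv.trans f.toEquiv
  map_rot x := by simp [e.map_rot, f.map_rot]
  map_opp x := by simp [e.map_opp, f.map_opp]
  map_vertexLabel x := by simp [e.map_vertexLabel, f.map_vertexLabel]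
  map_faceLabel x := by simp [e.map_faceLabel, f.map_faceLabel]

/-- Inverse. -/
def symm {G : HurwitzGalaxy D g μ ν} {H : HurwitzGalaxy D' g μ ν} (e : Iso G H) : Iso H G where
  toEquiv := e.toEquiv.symm
  map_rot x := by rw [Equiv.symm_apply_eq, e.map_rot, Equiv.apply_symm_apply]
  map_opp x := by rw [Equiv.symm_apply_eq, e.map_opp, Equiv.apply_symm_apply]
  map_vertexLabel x := by rw [← e.map_vertexLabel, Equiv.apply_symm_apply]
  map_faceLabel x := by rw [← e.map_faceLabel, Equiv.apply_symm_apply]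

end Iso

/-- The automorphisms of a Hurwitz galaxy. -/
abbrev Aut (G : HurwitzGalaxy D g μ ν) : Type _ := Iso G G

/-- Isomorphic galaxies have equally many automorphisms. -/
theorem card_aut_eq {G : HurwitzGalaxy D g μ ν} {H : HurwitzGalaxy D' g μ ν} (e : Iso G H) :
    Nat.card G.Aut = Nat.card H.Aut :=
  Nat.card_congr
    { toFun := fun a => (e.symm.trans a).trans e
      invFun := fun a => (e.trans a).trans e.symm
      left_inv := fun a => by ext x; simp [Iso.trans, Iso.symm]
      right_inv := fun a => by ext x; simp [Iso.trans, Iso.symm] }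

/-- A loop face is a face adjacent to at most one 4-valent vertex. -/
def IsLoopFace (G : HurwitzGalaxy D g μ ν) (f : G.Face) : Prop :=
  Nat.card {v : G.Vertex // G.valence v = 4 ∧ ∃ x, G.tail x = v ∧ G.left x = f} ≤ 1

/-- A bi-pruned galaxy is a galaxy without loop faces. -/
def IsBiPruned (G : HurwitzGalaxy D g μ ν) : Prop := ∀ f : G.Face, ¬ G.IsLoopFace f

/-- A Hurwitz galaxy of type `(g, μ, ν)` has exactly `2bd` darts, where `d = ∑ i, μ i`. -/
theorem card_darts [Finite D] (G : HurwitzGalaxy D g μ ν) :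
    Nat.card D = 2 * (branchCount g m n * ∑ i, μ i) := by
  classical
  have e1 : {x : D // (G.faceLabel (G.left x)).isLeft = true} ≃
      {x : D // ¬ (G.faceLabel (G.left x)).isLeft = true} :=
    G.opp.subtypeEquiv (fun x => by rw [G.bicoloured]; simp)
  have e2 : (Σ i : Fin m, {x : D // G.left x = G.faceLabel.symm (Sum.inl i)}) ≃
      {x : D // (G.faceLabel (G.left x)).isLeft = true} :=
    { toFun := fun p => ⟨p.2.1, by rw [p.2.2]; simp⟩
      invFun := fun x => ⟨(G.faceLabel (G.left x.1)).getLeft x.2, x.1, by simp⟩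
      left_inv := by
        rintro ⟨i, x, hx⟩
        have h : (G.faceLabel (G.left x)) = Sum.inl i := by rw [hx]; simp
        refine Sigma.subtype_ext ?_ rfl
        simp [h]
      right_inv := fun x => rfl }
  have h1 : Nat.card {x : D // (G.faceLabel (G.left x)).isLeft = true}
      = branchCount g m n * ∑ i, μ i := by
    rw [← Nat.card_congr e2, Nat.card_sigma, Finset.mul_sum]
    exact Finset.sum_congr rfl fun i _ => (G.white_length i).trans (mul_comm _ _)
  rw [← Nat.card_congr (Equiv.sumCompl fun x : D => (G.faceLabel (G.left x)).isLeft = true),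
    Nat.card_sum, ← Nat.card_congr e1, h1, two_mul]

/-- There are finitely many galaxies on a finite set of darts. -/
instance [Finite D] : Finite (HurwitzGalaxy D g μ ν) := by
  have h1 : Finite (CombMap D) :=
    Finite.of_injective (fun M : CombMap D => (M.rot, M.opp)) fun M N h => by
      rw [Prod.mk.injEq] at h
      exact CombMap.ext h.1 h.2
  have h2 (M : CombMap D) : Finite M.Vertex := Quotient.finite _
  have h3 (M : CombMap D) : Finite M.Face := Quotient.finite _
  refine Finite.of_injective
    (β := Σ M : CombMap D, (M.Vertex → Fin (branchCount g m n)) × (M.Face → Fin m ⊕ Fin n))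
    (fun G => ⟨G.toCombMap, G.vertexLabel, G.faceLabel⟩) ?_
  rintro ⟨M, _, f, _, _, _, l, _, _, _, _⟩ ⟨M', _, f', _, _, _, l', _, _, _, _⟩ h
  obtain ⟨rfl, h⟩ := Sigma.mk.inj_iff.1 h
  obtain ⟨rfl, h⟩ := Prod.mk.inj (eq_of_heq h)
  obtain rfl := DFunLike.coe_injective h
  rfl

end HurwitzGalaxy

/-- Bi-pruned galaxies of type `(g, μ, ν)` on a standard set of darts of the right cardinality, up to
isomorphism. -/
def biPrunedSetoid (g : ℕ) {m n : ℕ} (μ : Fin m → ℕ) (ν : Fin n → ℕ) :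
    Setoid {G : HurwitzGalaxy (Fin (2 * (branchCount g m n * ∑ i, μ i))) g μ ν // G.IsBiPruned} where
  r G H := Nonempty (G.1.Iso H.1)
  iseqv := ⟨fun G => ⟨.refl G.1⟩, fun ⟨e⟩ => ⟨e.symm⟩, fun ⟨e⟩ ⟨f⟩ => ⟨e.trans f⟩⟩

/-- The bi-pruned double Hurwitz number `Ph_g(μ, ν)`: the sum of `1 / |Aut G|` over all isomorphism
classes of bi-pruned Hurwitz galaxies `G` of type `(g, μ, ν)`. -/
noncomputable def biPrunedHurwitz (g : ℕ) {m n : ℕ} (μ : Fin m → ℕ) (ν : Fin n → ℕ) : ℚ :=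
  ∑ᶠ c : Quotient (biPrunedSetoid g μ ν),
    Quotient.lift (s := biPrunedSetoid g μ ν) (fun G => 1 / (Nat.card G.1.Aut : ℚ))
      (fun _ _ h => h.elim fun e => by simp only [HurwitzGalaxy.card_aut_eq e]) c

/-! ### The resonance arrangement -/

/-- The lattice `W` of pairs of ordered partitions of a common integer, with `m` and `n` parts. -/
def partitionPairs (m n : ℕ) : Set ((Fin m → ℕ) × (Fin n → ℕ)) :=
  {p | (∀ i, 0 < p.1 i) ∧ (∀ j, 0 < p.2 j) ∧ ∑ i, p.1 i = ∑ j, p.2 j}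

/-- The complement, in the real hyperplane `∑ x_i = ∑ y_j` spanned by `W`, of all the walls
`∑_{i ∈ I} x_i = ∑_{j ∈ J} y_j`. The two pairs `(∅, ∅)` and `([m], [n])`, whose equation holds on the
whole hyperplane, do not define a wall. (The pairs with one of `I`, `J` empty give, among others,
the coordinate hyperplanes.) -/
def resonanceComplement (m n : ℕ) : Set ((Fin m → ℝ) × (Fin n → ℝ)) :=
  {p | ∑ i, p.1 i = ∑ j, p.2 j ∧
    ∀ (I : Finset (Fin m)) (J : Finset (Fin n)),
      ¬ (I = ∅ ∧ J = ∅) → ¬ (I = Finset.univ ∧ J = Finset.univ) →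
        ∑ i ∈ I, p.1 i ≠ ∑ j ∈ J, p.2 j}

/-- Chambers: the connected components of the complement of the resonance arrangement. -/
def IsChamber {m n : ℕ} (C : Set ((Fin m → ℝ) × (Fin n → ℝ))) : Prop :=
  ∃ p ∈ resonanceComplement m n, C = connectedComponentIn (resonanceComplement m n) p

end Hurwitz

namespace Hurwitz

set_option linter.unusedSectionVars false

open Filter

/-! Put d = ∑ μ_i. Number the two white corners at each 4-valent vertex of a bi-pruned galaxy; there
are 2^b such framings. Suppressing the 2-valent vertices leaves a skeleton, namely a permutation π
of the 2b white corners (from each corner to the next one along its white face) with face labels,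
together with a length for each of the 2b resulting edges. No face is a loop face, so every face
meets a 4-valent vertex and the galaxy can be rebuilt: its white faces are the cycles of the
suspension of π with these lengths, and its black faces are those of the suspension of π followed by
the exchange of the two corners at a vertex. Whether loop faces occur depends on the skeleton alone.
Thus the skeletons form a finite set independent of μ and ν. Counting galaxies on a fixed set of 2bd
darts, where an isomorphism class has (2bd)!/|Aut| members, absorbs the automorphisms, and 2^b · Ph
is the number of pairs of a skeleton and admissible lengths (`biPrunedHurwitz_mul`).

For a fixed skeleton, the length of an edge is determined modulo b by the labels of its ends. Write
ℓ a + a.1 = b * c a + (π a).1. The labels cancel when summed around a face, so the perimeter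
conditions say that c is a nonnegative integral flow with supplies μ and demands ν on the bipartite
graph whose vertices are the m + n faces and whose edges are the 2b edges of the skeleton.
Positivity of ℓ says that c is positive on the edges in `crossing π` (`card_lengths`).

It remains to see that such flow counts are polynomial in each chamber. Deleting an edge e with
vector χ e gives N_F(x + χ e) = N_{F \ e}(x + χ e) + N_F(x) (`flowCount_add`). If F is disconnected,
some cut has no edge of F across it and N_F vanishes on the chamber. Otherwise the edge vectors
generate the lattice of balanced vectors, so by induction every difference of N_F along a ray deep
into the chamber is eventually polynomial. Extrapolating back gives `flowPoly`, which obeys the same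
recursion everywhere and hence is a polynomial of degree at most |F| - (m + n) + 1
(`isPolyFun_flowPoly`). That it equals the count on the whole chamber is shown on a larger set,
`Region`, which is wide enough to be traversed by single steps χ e (`eq_of_region`,
`flowCount_eq_flowPoly`). Positivity on prescribed edges is handled by inclusion-exclusion. With |F|
= 2b the degree bound is 4g - 3 + m + n. -/

/-! ### Sequences which are eventually polynomial -/

/-- The sequence `a` agrees with a polynomial at all large integers. -/
def EventuallyPoly (a : ℕ → ℚ) : Prop :=
  ∃ p : Polynomial ℚ, ∀ᶠ k : ℕ in atTop, a k = p.eval (k : ℚ)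

open Classical in
/-- The value at `0` of the polynomial which agrees with `a` at all large integers. -/
noncomputable def extrapolate (a : ℕ → ℚ) : ℚ :=
  if h : EventuallyPoly a then h.choose.eval 0 else 0

/-- Two polynomials which agree at infinitely many integers are equal, so the choice in
`extrapolate` does not matter. -/
theorem extrapolate_eq {a : ℕ → ℚ} {p : Polynomial ℚ}
    (h : ∀ᶠ k : ℕ in atTop, a k = p.eval (k : ℚ)) : extrapolate a = p.eval 0 := by
  have ha : EventuallyPoly a := ⟨p, h⟩
  rw [extrapolate, dif_pos ha]
  congr 1
  refine Polynomial.eq_of_infinite_eval_eq _ _ ?_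
  obtain ⟨K, hK⟩ := eventually_atTop.1 (h.and ha.choose_spec)
  refine (Set.infinite_range_of_injective (f := fun k : ℕ => ((k + K : ℕ) : ℚ))
    fun i j hij => ?_).mono ?_
  · simpa using hij
  · rintro _ ⟨k, rfl⟩
    have := hK (k + K) (Nat.le_add_left _ _)
    exact this.2.symm.trans this.1

theorem EventuallyPoly.add {a b : ℕ → ℚ} (ha : EventuallyPoly a) (hb : EventuallyPoly b) :
    EventuallyPoly (fun k => a k + b k) := by
  obtain ⟨p, hp⟩ := ha
  obtain ⟨q, hq⟩ := hb
  exact ⟨p + q, by filter_upwards [hp, hq] with k h1 h2; simp [h1, h2]⟩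

theorem EventuallyPoly.neg {a : ℕ → ℚ} (ha : EventuallyPoly a) :
    EventuallyPoly (fun k => - a k) := by
  obtain ⟨p, hp⟩ := ha
  exact ⟨-p, by filter_upwards [hp] with k h1; simp [h1]⟩

theorem EventuallyPoly.congr {a b : ℕ → ℚ} (ha : EventuallyPoly a) (h : ∀ᶠ k in atTop, a k = b k) :
    EventuallyPoly b := by
  obtain ⟨p, hp⟩ := ha
  exact ⟨p, by filter_upwards [hp, h] with k h1 h2; rw [← h2, h1]⟩

theorem extrapolate_add {a b : ℕ → ℚ} (ha : EventuallyPoly a) (hb : EventuallyPoly b) :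
    extrapolate (fun k => a k + b k) = extrapolate a + extrapolate b := by
  obtain ⟨p, hp⟩ := ha
  obtain ⟨q, hq⟩ := hb
  rw [extrapolate_eq hp, extrapolate_eq hq, ← Polynomial.eval_add]
  exact extrapolate_eq (by filter_upwards [hp, hq] with k h1 h2; simp [h1, h2])

/-- Faulhaber's formula: the monomial `x ^ n` has a polynomial antidifference. -/
theorem exists_antidifference_pow (n : ℕ) : ∃ q : Polynomial ℚ, q.natDegree ≤ n + 1 ∧
    ∀ x : ℚ, q.eval (x + 1) - q.eval x = x ^ n := by
  refine ⟨Polynomial.C ((n + 1 : ℚ)⁻¹) * Polynomial.bernoulli (n + 1), ?_, fun x => ?_⟩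
  · refine (Polynomial.natDegree_C_mul_le _ _).trans ?_
    rw [Polynomial.bernoulli]
    refine Polynomial.natDegree_sum_le_of_forall_le _ _ fun i hi => ?_
    refine (Polynomial.natDegree_monomial_le _).trans ?_
    omega
  · have : (n + 1 : ℚ) ≠ 0 := by positivity
    simp only [Polynomial.eval_mul, Polynomial.eval_C]
    rw [add_comm x 1, Polynomial.bernoulli_eval_one_add]
    push_cast [Nat.add_sub_cancel]
    field_simp
    ring

theorem exists_antidifference (p : Polynomial ℚ) : ∃ q : Polynomial ℚ,
    ∀ x : ℚ, q.eval (x + 1) - q.eval x = p.eval x := by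
  induction p using Polynomial.induction_on' with
  | add p q hp hq =>
    obtain ⟨p', hp⟩ := hp
    obtain ⟨q', hq⟩ := hq
    refine ⟨p' + q', fun x => ?_⟩
    simp only [Polynomial.eval_add, ← hp, ← hq]
    ring
  | monomial n a =>
    obtain ⟨q, -, hq⟩ := exists_antidifference_pow n
    refine ⟨Polynomial.C a * q, fun x => ?_⟩
    simp [← hq, mul_sub]

/-- From the point where the differences become polynomial, the sequence is an antidifference of
that polynomial up to a constant. -/
theorem EventuallyPoly.of_sub {a : ℕ → ℚ} (h : EventuallyPoly fun k => a (k + 1) - a k) :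
    EventuallyPoly a := by
  obtain ⟨p, hp⟩ := h
  obtain ⟨q, hq⟩ := exists_antidifference p
  obtain ⟨K, hK⟩ := eventually_atTop.1 hp
  refine ⟨q + Polynomial.C (a K - q.eval (K : ℚ)), eventually_atTop.2 ⟨K, fun k hk => ?_⟩⟩
  induction k, hk using Nat.le_induction with
  | base => simp
  | succ k hk ih =>
    have h1 := hK k hk
    have h2 := hq k
    simp only [Polynomial.eval_add, Polynomial.eval_C] at ih ⊢
    push_cast
    linarith

/-! ### Counting nonnegative integer flows -/

section Flow

variable {A M ι : Type*} [Fintype A] [DecidableEq A] [AddCommGroup M]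

/-- The number of ways to write `x` as a sum of the vectors `χ e` with nonnegative integral
coefficients supported in `F`. -/
noncomputable def flowCount (χ : A → M) (F : Finset A) (x : M) : ℕ :=
  {c : A → ℕ | (∀ e ∉ F, c e = 0) ∧ ∑ e, c e • χ e = x}.ncard

variable {χ : A → M} {deg : M →+ ℤ}

/-- The degree of x is the sum of the coefficients, hence bounds each of them. -/
theorem finite_flows (hdeg : ∀ e, deg (χ e) = 1) (x : M) :
    {c : A → ℕ | ∑ e, c e • χ e = x}.Finite := by
  refine (Set.Finite.pi' (t := fun _ : A => Set.Iic (deg x).toNat)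
    fun _ => Set.finite_Iic _).subset ?_
  rintro c rfl e
  have h : deg (∑ e, c e • χ e) = ((∑ e, c e : ℕ) : ℤ) := by simp [hdeg]
  rw [h, Int.toNat_natCast]
  exact Finset.single_le_sum (f := c) (fun _ _ => Nat.zero_le _) (Finset.mem_univ e)

/-- A flow either vanishes on e or remains a flow after one unit is removed from e. All later
inductions on the edge set rest on this recursion. -/
theorem flowCount_add (hdeg : ∀ e, deg (χ e) = 1) {F : Finset A} {e : A} (he : e ∈ F) (x : M) :
    flowCount χ F (x + χ e) = flowCount χ (F.erase e) (x + χ e) + flowCount χ F x := by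
  have hinj : Function.Injective fun c : A → ℕ => c + Pi.single e 1 := add_left_injective _
  have hu : {c : A → ℕ | (∀ e ∉ F, c e = 0) ∧ ∑ e, c e • χ e = x + χ e}
      = {c : A → ℕ | (∀ e' ∉ F.erase e, c e' = 0) ∧ ∑ e, c e • χ e = x + χ e} ∪
        (fun c : A → ℕ => c + Pi.single e 1) ''
          {c : A → ℕ | (∀ e ∉ F, c e = 0) ∧ ∑ e, c e • χ e = x} := by
    ext c
    simp only [Set.mem_union, Set.mem_ofPred_eq, Set.mem_image]
    constructor
    · rintro ⟨h1, h2⟩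
      rcases Nat.eq_zero_or_pos (c e) with h0 | h0
      · refine Or.inl ⟨fun e' he' => ?_, h2⟩
        by_cases h : e' = e
        · rw [h, h0]
        · exact h1 _ fun h' => he' (Finset.mem_erase.2 ⟨h, h'⟩)
      · have hc : c - Pi.single e 1 + Pi.single e 1 = c := by
          ext e'
          by_cases h : e' = e
          · subst h
            simp [Nat.sub_add_cancel h0]
          · simp [h]
        refine Or.inr ⟨c - Pi.single e 1, ⟨fun e' he' => ?_, ?_⟩, hc⟩
        · simp [h1 e' he']
        · rw [← hc] at h2
          simpa [add_smul, Finset.sum_add_distrib, Pi.single_apply, ite_smul] using h2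
    · rintro (⟨h1, h2⟩ | ⟨c, ⟨h1, h2⟩, rfl⟩)
      · exact ⟨fun e' he' => h1 _ fun h => he' (Finset.mem_of_mem_erase h), h2⟩
      · refine ⟨fun e' he' => ?_, ?_⟩
        · have : e' ≠ e := fun h => he' (h ▸ he)
          simp [h1 _ he', this]
        · simp [add_smul, Finset.sum_add_distrib, Pi.single_apply, ite_smul, h2]
  rw [flowCount, hu, Set.ncard_union_eq ?_ ?_ ?_, Set.ncard_image_of_injective _ hinj]
  · rfl
  · rw [Set.disjoint_left]
    rintro _ ⟨h1, -⟩ ⟨c, -, rfl⟩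
    simpa using h1 e (by simp)
  · exact (finite_flows hdeg _).subset fun c hc => hc.2
  · exact ((finite_flows hdeg _).subset fun c hc => hc.2).image _

/-! ### The region on which a count of flows is polynomial -/

variable (χ) in
/-- The points which can be moved into the open cone `0 < s i * L i x` by adding
a combination, with coefficients between `0` and `1`, of the vectors `χ e` with `e ∈ F`. -/
def Region (L : ι → M →+ ℤ) (s : ι → ℝ) (F : Finset A) (x : M) : Prop :=
  ∃ t : A → ℝ, (∀ e, 0 ≤ t e ∧ t e ≤ 1) ∧ (∀ e ∉ F, t e = 0) ∧
    ∀ i, 0 < s i * ((L i x : ℝ) + ∑ e, t e * (L i (χ e) : ℝ))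

variable {L : ι → M →+ ℤ} {s : ι → ℝ}

theorem region_of_pos {x : M} (F : Finset A) (h : ∀ i, 0 < s i * (L i x : ℝ)) :
    Region χ L s F x :=
  ⟨0, by simp, by simp, by simpa using h⟩

/-- A coordinate moves linearly from t to a + u. As a is a nonzero integer, a + u is at least 1 or
at most 0, so the coordinate reaches the end of [0, 1] in the direction of a by time 1; τ is when it
does. -/
theorem exists_exit_time {t u : ℝ} {a : ℤ} (ht : 0 ≤ t ∧ t ≤ 1) (hu : 0 ≤ u ∧ u ≤ 1)
    (ha : a ≠ 0) : ∃ τ : ℝ, 0 ≤ τ ∧ τ ≤ 1 ∧ t + τ * (a + u - t) = (if 0 < a then 1 else 0) ∧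
      ∀ τ', 0 ≤ τ' → τ' ≤ τ → 0 ≤ t + τ' * (a + u - t) ∧ t + τ' * (a + u - t) ≤ 1 := by
  obtain ⟨ht0, ht1⟩ := ht
  obtain ⟨hu0, hu1⟩ := hu
  rcases lt_or_gt_of_ne ha with ha | ha
  · have ha' : (a : ℝ) ≤ -1 := by exact_mod_cast Int.le_sub_one_of_lt ha
    rw [if_neg ha.not_gt]
    rcases eq_or_ne t 0 with rfl | h0
    · exact ⟨0, le_rfl, zero_le_one, by simp, fun τ' h1 h2 => by simp [le_antisymm h2 h1]⟩
    · have htp : 0 < t := lt_of_le_of_ne ht0 h0.symm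
      have hd : 0 < t - u - a := by linarith
      refine ⟨t / (t - u - a), by positivity, (div_le_one hd).2 (by linarith), ?_,
        fun τ' h1 h2 => ?_⟩
      · field_simp; ring
      · rw [le_div_iff₀ hd] at h2
        exact ⟨by nlinarith, by nlinarith⟩
  · have ha' : (1 : ℝ) ≤ a := by exact_mod_cast ha
    rw [if_pos ha]
    rcases eq_or_ne t 1 with rfl | h0
    · exact ⟨0, le_rfl, zero_le_one, by simp, fun τ' h1 h2 => by simp [le_antisymm h2 h1]⟩
    · have htp : 0 < 1 - t := sub_pos.2 (lt_of_le_of_ne ht1 h0)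
      have hd : 0 < a + u - t := by linarith
      refine ⟨(1 - t) / (a + u - t), by positivity, (div_le_one hd).2 (by linarith), ?_,
        fun τ' h1 h2 => ?_⟩
      · field_simp; ring
      · rw [le_div_iff₀ hd] at h2
        exact ⟨by nlinarith, by nlinarith⟩

/-- A function which does not change along the steps `χ e` inside the region is constant on it. -/
theorem eq_of_region {F : Finset A} {h : M → ℚ}
    (hstep : ∀ e ∈ F, ∀ x, Region χ L s (F.erase e) (x + χ e) → h (x + χ e) = h x) (N : ℕ) :
    ∀ (x : M) (a : A → ℤ), ∑ e, (a e).natAbs ≤ N → (∀ e ∉ F, a e = 0) →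
      Region χ L s F x → Region χ L s F (x + ∑ e, a e • χ e) → h x = h (x + ∑ e, a e • χ e) := by
  induction N with
  | zero =>
    intro x a hN _ _ _
    have : a = 0 := by
      ext e
      simpa using (Finset.sum_eq_zero_iff.1 (Nat.le_zero.1 hN)) e (Finset.mem_univ _)
    simp [this]
  | succ N ih =>
    rintro x a hN haF ⟨t, ht, htF, htL⟩ ⟨u, hu, huF, huL⟩
    by_cases ha0 : a = 0
    · simp [ha0]
    obtain ⟨e₀, he₀⟩ := Function.ne_iff.1 ha0
    have hex : ∀ e, ∃ τ : ℝ, a e ≠ 0 → 0 ≤ τ ∧ τ ≤ 1 ∧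
        t e + τ * (a e + u e - t e) = (if 0 < a e then 1 else 0) ∧
        ∀ τ', 0 ≤ τ' → τ' ≤ τ →
          0 ≤ t e + τ' * (a e + u e - t e) ∧ t e + τ' * (a e + u e - t e) ≤ 1 := by
      intro e
      by_cases hae : a e = 0
      · exact ⟨0, fun h => absurd hae h⟩
      · obtain ⟨τ, hτ⟩ := exists_exit_time (ht e) (hu e) hae
        exact ⟨τ, fun _ => hτ⟩
    choose T hT using hex
    -- Move along the segment from x + ∑ t χ to the target plus ∑ u χ, and stop at the first time
    -- when a coordinate with a e ≠ 0 reaches the end of [0, 1]. There v is still a vector of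
    -- coefficients in [0, 1], and v e is 0 or 1. The cone is convex, so v is a witness for x.
    obtain ⟨e, he, hmin⟩ := Finset.exists_min_image (Finset.univ.filter fun e => a e ≠ 0) T
      ⟨e₀, by simpa using he₀⟩
    simp only [Finset.mem_filter, Finset.mem_univ, true_and] at he hmin
    obtain ⟨hτ0, hτ1, hτe, -⟩ := hT e he
    set v : A → ℝ := fun e' => t e' + T e * (a e' + u e' - t e') with hv
    have heF : e ∈ F := by
      by_contra h
      exact he (haF e h)
    have hv01 : ∀ e', 0 ≤ v e' ∧ v e' ≤ 1 := by
      intro e'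
      by_cases hae : a e' = 0
      · have h1 := ht e'
        have h2 := hu e'
        simp only [hv, hae, Int.cast_zero, zero_add]
        constructor <;> nlinarith
      · exact (hT e' hae).2.2.2 _ hτ0 (hmin e' hae)
    have hvF : ∀ e' ∉ F, v e' = 0 := fun e' he' => by
      simp [hv, htF e' he', huF e' he', haF e' he']
    have hvL : ∀ i, 0 < s i * ((L i x : ℝ) + ∑ e, v e * (L i (χ e) : ℝ)) := by
      intro i
      have h1 := htL i
      have h2 := huL i
      have h3 : ((L i x : ℝ) + ∑ e, v e * (L i (χ e) : ℝ))
          = (1 - T e) * ((L i x : ℝ) + ∑ e, t e * (L i (χ e) : ℝ)) + T e *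
            ((L i (x + ∑ e, a e • χ e) : ℝ) + ∑ e, u e * (L i (χ e) : ℝ)) := by
        simp only [hv, map_add, map_sum, map_zsmul, zsmul_eq_mul, Int.cast_add, Int.cast_sum,
          Int.cast_mul, Int.cast_id, mul_add, Finset.mul_sum, add_mul, sub_mul, mul_sub,
          Finset.sum_add_distrib, Finset.sum_sub_distrib, one_mul, mul_assoc]
        ring
      rw [h3]
      rcases hτ0.eq_or_lt with h0 | h0
      · simpa [← h0] using h1
      · have h4 : 0 ≤ (1 - T e) * (s i * ((L i x : ℝ) + ∑ e, t e * (L i (χ e) : ℝ))) :=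
          mul_nonneg (by linarith) h1.le
        have h5 := mul_pos h0 h2
        linarith
    rcases lt_or_gt_of_ne he with hneg | hpos
    -- Here v does not use e, so x lies in the region of `F.erase e` and the step from x - χ e to x
    -- is allowed. The witness v with its e-coordinate raised to 1 serves for x - χ e.
    · have hve : v e = 0 := by simpa [hneg.not_gt] using hτe
      have hx : x - χ e + χ e = x := sub_add_cancel _ _
      have hs := hstep e heF (x - χ e) (by
        rw [hx]
        refine ⟨v, hv01, fun e' he' => ?_, hvL⟩
        by_cases h : e' = e
        · rw [h, hve]
        · exact hvF _ fun h' => he' (Finset.mem_erase.2 ⟨h, h'⟩))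
      rw [hx] at hs
      have hy : x + ∑ e, a e • χ e = x - χ e + ∑ e', (a + Pi.single e 1 : A → ℤ) e' • χ e' := by
        simp [add_smul, Finset.sum_add_distrib, Pi.single_apply, ite_smul]
      rw [hs, hy]
      refine ih _ _ ?_ (fun e' he' => ?_) ⟨v + Pi.single e 1, fun e' => ?_, fun e' he' => ?_, ?_⟩
        (hy ▸ ⟨u, hu, huF, huL⟩)
      · have h1 : ∑ e', ((a + Pi.single e 1 : A → ℤ) e').natAbs < ∑ e, (a e).natAbs := by
          refine Finset.sum_lt_sum (fun e' _ => ?_) ⟨e, Finset.mem_univ _, ?_⟩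
          · by_cases h : e' = e
            · subst h; simp; omega
            · simp [h]
          · simp; omega
        omega
      · have : e' ≠ e := fun h => he' (h ▸ heF)
        simp [haF e' he', this]
      · by_cases h : e' = e
        · subst h; simp [hve]
        · simpa [h] using hv01 e'
      · have : e' ≠ e := fun h => he' (h ▸ heF)
        simp [hvF e' he', this]
      · intro i
        refine (hvL i).trans_eq ?_
        simp [add_mul, Finset.sum_add_distrib, Pi.single_apply, ite_mul]
    -- Here the full unit of χ e can be moved from the witness into the point, so x + χ e lies in
    -- the region of `F.erase e`.
    · have hve : v e = 1 := by simpa [hpos] using hτe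
      have hreg : Region χ L s (F.erase e) (x + χ e) := by
        refine ⟨v - Pi.single e 1, fun e' => ?_, fun e' he' => ?_, fun i => ?_⟩
        · by_cases h : e' = e
          · subst h; simp [hve]
          · simpa [h] using hv01 e'
        · by_cases h : e' = e
          · subst h; simp [hve]
          · simpa [h] using hvF _ fun h' => he' (Finset.mem_erase.2 ⟨h, h'⟩)
        · refine (hvL i).trans_eq ?_
          simp [sub_mul, Finset.sum_sub_distrib, Pi.single_apply, ite_mul]
      rw [← hstep e heF x hreg]
      have hy : x + ∑ e, a e • χ e = x + χ e + ∑ e', (a - Pi.single e 1 : A → ℤ) e' • χ e' := by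
        simp [sub_smul, Finset.sum_sub_distrib, Pi.single_apply, ite_smul]
      rw [hy]
      obtain ⟨r, hr, hrF, hrL⟩ := hreg
      refine ih _ _ ?_ (fun e' he' => ?_)
        ⟨r, hr, fun e' he' => hrF e' fun h => he' (Finset.mem_of_mem_erase h), hrL⟩
        (hy ▸ ⟨u, hu, huF, huL⟩)
      · have h1 : ∑ e', ((a - Pi.single e 1 : A → ℤ) e').natAbs < ∑ e, (a e).natAbs := by
          refine Finset.sum_lt_sum (fun e' _ => ?_) ⟨e, Finset.mem_univ _, ?_⟩
          · by_cases h : e' = e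
            · subst h; simp; omega
            · simp [h]
          · simp; omega
        omega
      · have : e' ≠ e := fun h => he' (h ▸ heF)
        simp [haF e' he', this]

/-! ### Extrapolating the count of flows from deep inside the cone -/

theorem eventually_pos [Finite ι] {w : M} (hw : ∀ i, 0 < s i * (L i w : ℝ)) (x : M) :
    ∀ᶠ k : ℕ in atTop, ∀ i, 0 < s i * (L i (x + k • w) : ℝ) := by
  rw [eventually_all]
  intro i
  have h1 : Tendsto (fun k : ℕ => s i * (L i x : ℝ) + (k : ℝ) * (s i * (L i w : ℝ))) atTop atTop :=
    tendsto_atTop_add_const_left _ _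
      (tendsto_natCast_atTop_atTop.atTop_mul_const (hw i))
  filter_upwards [h1.eventually_gt_atTop 0] with k hk
  refine hk.trans_eq ?_
  simp
  ring

/-- Adding edges of F does not change `L i`. A flow supported in F forces `L i x = 0`, whereas
membership in the region forces it to be nonzero. -/
theorem flowCount_eq_zero {F : Finset A} {x : M} {i : ι} (hi : ∀ e ∈ F, L i (χ e) = 0)
    (hx : Region χ L s F x) : flowCount χ F x = 0 := by
  obtain ⟨t, -, htF, htL⟩ := hx
  rw [flowCount, show {c : A → ℕ | (∀ e ∉ F, c e = 0) ∧ ∑ e, c e • χ e = x} = ∅ from ?_,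
    Set.ncard_empty]
  rw [Set.eq_empty_iff_forall_notMem]
  rintro c ⟨hc, rfl⟩
  have h := htL i
  rw [map_sum, Finset.sum_eq_zero, Finset.sum_eq_zero] at h
  · simp at h
  · intro e _
    by_cases he : e ∈ F
    · simp [hi e he]
    · simp [htF e he]
  · intro e _
    by_cases he : e ∈ F
    · simp [hi e he]
    · simp [hc e he]

theorem exists_combination {F : Finset A} {x : M} (hx : x ∈ AddSubgroup.closure (χ '' F)) :
    ∃ a : A → ℤ, (∀ e ∉ F, a e = 0) ∧ x = ∑ e, a e • χ e := by
  induction hx using AddSubgroup.closure_induction with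
  | mem x hx =>
    obtain ⟨e, he, rfl⟩ := hx
    refine ⟨Pi.single e 1, fun e' he' => ?_, ?_⟩
    · have : e' ≠ e := fun h => he' (h ▸ he)
      simp [this]
    · simp [Pi.single_apply, ite_smul]
  | zero => exact ⟨0, by simp, by simp⟩
  | add x y _ _ hx hy =>
    obtain ⟨a, ha, rfl⟩ := hx
    obtain ⟨b, hb, rfl⟩ := hy
    exact ⟨a + b, fun e he => by simp [ha e he, hb e he],
      by simp [add_smul, Finset.sum_add_distrib]⟩
  | neg x _ hx =>
    obtain ⟨a, ha, rfl⟩ := hx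
    exact ⟨-a, fun e he => by simp [ha e he], by simp⟩

variable [Finite ι] {w : M}

/-- If the vectors of F generate the lattice, the difference in any direction, in particular w, is
composed of differences in the directions χ e. Those are counts with one edge fewer, known by
induction. If they do not generate, the count vanishes far along the ray. -/
theorem eventuallyPoly_flowCount (hdeg : ∀ e, deg (χ e) = 1)
    (hw : ∀ i, 0 < s i * (L i w : ℝ))
    (hgen : ∀ F : Finset A, AddSubgroup.closure (χ '' F) = ⊤ ∨ ∃ i, ∀ e ∈ F, L i (χ e) = 0)
    (F : Finset A) : ∀ x : M, EventuallyPoly fun k => flowCount χ F (x + k • w) := by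
  induction F using Finset.strongInduction with
  | H F ih =>
  intro x
  rcases hgen F with hF | ⟨i, hi⟩
  -- The base point x must vary in this claim, since composing two differences shifts it.
  · have key : ∀ v : M, ∀ x : M, EventuallyPoly fun k : ℕ =>
        (flowCount χ F (x + v + k • w) : ℚ) - flowCount χ F (x + k • w) := by
      intro v
      have hv : v ∈ AddSubgroup.closure (χ '' F) := hF ▸ AddSubgroup.mem_top v
      induction hv using AddSubgroup.closure_induction with
      | mem v hv =>
        obtain ⟨e, he, rfl⟩ := hv
        intro x
        refine (ih _ (Finset.erase_ssubset he) (x + χ e)).congr (Eventually.of_forall fun k => ?_)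
        rw [add_right_comm x, flowCount_add hdeg he]
        push_cast
        ring
      | zero => exact fun x => ⟨0, by simp⟩
      | add u v _ _ hu hv =>
        intro x
        refine ((hu x).add (hv (x + u))).congr (Eventually.of_forall fun k => ?_)
        rw [add_assoc x u v]
        ring
      | neg v _ hv =>
        intro x
        refine (hv (x + -v)).neg.congr (Eventually.of_forall fun k => ?_)
        rw [neg_add_cancel_right]
        ring
    refine EventuallyPoly.of_sub ((key w x).congr (Eventually.of_forall fun k => ?_))
    rw [add_smul, one_smul, add_assoc x w, add_comm w]
  · refine ⟨0, ?_⟩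
    filter_upwards [eventually_pos hw x] with k hk
    simp [flowCount_eq_zero hi (region_of_pos F hk)]

variable (χ w) in
/-- The extrapolation of the count of flows along the ray in the direction `w`. -/
noncomputable def flowPoly (F : Finset A) (x : M) : ℚ :=
  extrapolate fun k => flowCount χ F (x + k • w)

/-- Extrapolation is additive, so it preserves the deletion recursion, with no condition on x. -/
theorem flowPoly_add (hdeg : ∀ e, deg (χ e) = 1)
    (hw : ∀ i, 0 < s i * (L i w : ℝ))
    (hgen : ∀ F : Finset A, AddSubgroup.closure (χ '' F) = ⊤ ∨ ∃ i, ∀ e ∈ F, L i (χ e) = 0)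
    {F : Finset A} {e : A} (he : e ∈ F) (x : M) :
    flowPoly χ w F (x + χ e) = flowPoly χ w (F.erase e) (x + χ e) + flowPoly χ w F x := by
  have hE := eventuallyPoly_flowCount hdeg hw hgen
  rw [flowPoly, flowPoly, flowPoly, ← extrapolate_add (hE _ _) (hE _ _)]
  congr 1
  ext k
  rw [add_right_comm x, flowCount_add hdeg he]
  push_cast
  rfl

theorem flowPoly_eq_zero (hw : ∀ i, 0 < s i * (L i w : ℝ))
    {F : Finset A} {i : ι} (hi : ∀ e ∈ F, L i (χ e) = 0) (x : M) : flowPoly χ w F x = 0 := by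
  have h : ∀ᶠ k : ℕ in atTop, (flowCount χ F (x + k • w) : ℚ) = (0 : Polynomial ℚ).eval (k : ℚ) := by
    filter_upwards [eventually_pos hw x] with k hk
    simp [flowCount_eq_zero hi (region_of_pos F hk)]
  exact (extrapolate_eq h).trans Polynomial.eval_zero

/-- On the region, the count of flows agrees with its extrapolation from deep inside the cone. -/
theorem flowCount_eq_flowPoly (hdeg : ∀ e, deg (χ e) = 1)
    (hw : ∀ i, 0 < s i * (L i w : ℝ))
    (hgen : ∀ F : Finset A, AddSubgroup.closure (χ '' F) = ⊤ ∨ ∃ i, ∀ e ∈ F, L i (χ e) = 0)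
    (F : Finset A) : ∀ x : M, Region χ L s F x → (flowCount χ F x : ℚ) = flowPoly χ w F x := by
  induction F using Finset.strongInduction with
  | H F ih =>
  intro x hx
  rcases hgen F with hF | ⟨i, hi⟩
  · obtain ⟨p, hp⟩ := eventuallyPoly_flowCount hdeg hw hgen F x
    obtain ⟨k, hk, hpos⟩ := (hp.and (eventually_pos hw x)).exists
    -- Starting the ray at x + k w shifts the polynomial p by k, so its value at 0 becomes p(k),
    -- which is also the true count there.
    have hk' : flowPoly χ w F (x + k • w) = p.eval (k : ℚ) := by
      have : ∀ᶠ j : ℕ in atTop, (flowCount χ F (x + k • w + j • w) : ℚ)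
          = (p.comp (Polynomial.X + Polynomial.C (k : ℚ))).eval (j : ℚ) := by
        obtain ⟨K, hK⟩ := eventually_atTop.1 hp
        refine eventually_atTop.2 ⟨K, fun j hj => ?_⟩
        rw [add_assoc, ← add_smul]
        refine (hK (k + j) (by omega)).trans ?_
        simp [add_comm]
      rw [flowPoly, extrapolate_eq this]
      simp
    obtain ⟨a, haF, ha⟩ := exists_combination (F := F) (x := k • w) (hF ▸ AddSubgroup.mem_top _)
    -- The error, count minus extrapolation, satisfies the recursion of both. In the region of
    -- `F.erase e` the error for `F.erase e` is zero by induction, so the error for F is unchanged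
    -- by the step χ e. It vanishes at x + k w, hence at x.
    have := eq_of_region (F := F) (L := L) (s := s) (χ := χ)
      (h := fun y => (flowCount χ F y : ℚ) - flowPoly χ w F y) (fun e he y hy => by
        have h1 := ih _ (Finset.erase_ssubset he) _ hy
        rw [flowPoly_add hdeg hw hgen he, flowCount_add hdeg he]
        push_cast
        linarith) _ x a le_rfl haF hx (ha ▸ region_of_pos F hpos)
    rw [← ha, hk', ← hk, sub_self] at this
    exact sub_eq_zero.1 this
  · rw [flowCount_eq_zero hi hx, flowPoly_eq_zero hw hi, Nat.cast_zero]

end Flow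

end Hurwitz

namespace Hurwitz

set_option linter.unusedSectionVars false

/-! ### Polynomial functions on a lattice -/

section PolyFun

variable {V : Type*} [Fintype V] [DecidableEq V]

/-- The function `f` is given by a polynomial of degree less than `k`. -/
def IsPolyFun (k : ℕ) (f : (V → ℤ) → ℚ) : Prop :=
  ∃ P : MvPolynomial V ℚ, (∀ s ∈ P.support, s.degree < k) ∧
    ∀ x, f x = MvPolynomial.eval (fun v => (x v : ℚ)) P

namespace IsPolyFun

theorem mono {k l : ℕ} {f : (V → ℤ) → ℚ} (hf : IsPolyFun k f) (h : k ≤ l) : IsPolyFun l f := by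
  obtain ⟨P, hP, hf⟩ := hf
  exact ⟨P, fun s hs => (hP s hs).trans_le h, hf⟩

/-- The degree bound in `IsPolyFun` is strict, so k = 0 singles out the zero function, in accordance
with its degree being -∞. -/
theorem zero (k : ℕ) : IsPolyFun k (fun _ : V → ℤ => 0) := ⟨0, by simp, by simp⟩

theorem const (c : ℚ) : IsPolyFun 1 (fun _ : V → ℤ => c) := by
  refine ⟨MvPolynomial.C c, fun s hs => ?_, by simp⟩
  rw [MvPolynomial.C_apply] at hs
  have := Finset.mem_singleton.1 (MvPolynomial.support_monomial_subset hs)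
  simp [this]

theorem coord (v : V) : IsPolyFun 2 (fun x : V → ℤ => (x v : ℚ)) := by
  refine ⟨MvPolynomial.X v, fun s hs => ?_, by simp⟩
  have := Finset.mem_singleton.1 (MvPolynomial.support_monomial_subset hs)
  simp [this]

theorem add {k : ℕ} {f g : (V → ℤ) → ℚ} (hf : IsPolyFun k f) (hg : IsPolyFun k g) :
    IsPolyFun k (fun x => f x + g x) := by
  obtain ⟨P, hP, hf⟩ := hf
  obtain ⟨Q, hQ, hg⟩ := hg
  refine ⟨P + Q, fun s hs => ?_, fun x => by simp [hf, hg]⟩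
  rcases Finset.mem_union.1 (MvPolynomial.support_add hs) with h | h
  · exact hP s h
  · exact hQ s h

theorem neg {k : ℕ} {f : (V → ℤ) → ℚ} (hf : IsPolyFun k f) : IsPolyFun k (fun x => - f x) := by
  obtain ⟨P, hP, hf⟩ := hf
  exact ⟨-P, fun s hs => hP s (by simpa using hs), fun x => by simp [hf]⟩

theorem sub {k : ℕ} {f g : (V → ℤ) → ℚ} (hf : IsPolyFun k f) (hg : IsPolyFun k g) :
    IsPolyFun k (fun x => f x - g x) := by
  simpa [sub_eq_add_neg] using hf.add hg.neg

theorem sum {k : ℕ} {ι : Type*} (S : Finset ι) {f : ι → (V → ℤ) → ℚ}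
    (hf : ∀ i ∈ S, IsPolyFun k (f i)) : IsPolyFun k (fun x => ∑ i ∈ S, f i x) := by
  classical
  induction S using Finset.induction_on with
  | empty => simpa using zero k
  | insert i S hi ih =>
    simp only [Finset.sum_insert hi]
    exact (hf i (Finset.mem_insert_self _ _)).add
      (ih fun j hj => hf j (Finset.mem_insert_of_mem hj))

theorem mul {k l : ℕ} {f g : (V → ℤ) → ℚ} (hf : IsPolyFun (k + 1) f) (hg : IsPolyFun (l + 1) g) :
    IsPolyFun (k + l + 1) (fun x => f x * g x) := by
  obtain ⟨P, hP, hf⟩ := hf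
  obtain ⟨Q, hQ, hg⟩ := hg
  refine ⟨P * Q, fun s hs => ?_, fun x => by simp [hf, hg]⟩
  obtain ⟨a, ha, b, hb, rfl⟩ := Finset.mem_add.1 (MvPolynomial.support_mul _ _ hs)
  have h1 := hP a ha
  have h2 := hQ b hb
  rw [map_add]
  omega

theorem const_mul {k : ℕ} {f : (V → ℤ) → ℚ} (c : ℚ) (hf : IsPolyFun k f) :
    IsPolyFun k (fun x => c * f x) := by
  obtain ⟨P, hP, hf⟩ := hf
  refine ⟨c • P, fun s hs => hP s (MvPolynomial.support_smul hs), fun x => ?_⟩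
  simp only [hf, MvPolynomial.smul_eval]

theorem pow {f : (V → ℤ) → ℚ} (hf : IsPolyFun 2 f) (n : ℕ) :
    IsPolyFun (n + 1) (fun x => f x ^ n) := by
  induction n with
  | zero => simpa using const 1
  | succ n ih =>
    simp only [pow_succ]
    exact ih.mul hf

theorem prod_pow {ι : Type*} (S : Finset ι) (n : ι → ℕ) {f : ι → (V → ℤ) → ℚ}
    (hf : ∀ i ∈ S, IsPolyFun (n i + 1) (f i)) :
    IsPolyFun (∑ i ∈ S, n i + 1) (fun x => ∏ i ∈ S, f i x) := by
  classical
  induction S using Finset.induction_on with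
  | empty => simpa using const 1
  | insert i S hi ih =>
    simp only [Finset.prod_insert hi, Finset.sum_insert hi]
    exact (hf i (Finset.mem_insert_self _ _)).mul
      (ih fun j hj => hf j (Finset.mem_insert_of_mem hj))

/-- Substituting polynomials of degree at most 1 into a monomial does not raise its degree. -/
theorem comp {k : ℕ} {f : (V → ℤ) → ℚ} (hf : IsPolyFun k f) {ℓ : (V → ℤ) → (V → ℤ)}
    (hℓ : ∀ v, IsPolyFun 2 fun x => (ℓ x v : ℚ)) : IsPolyFun k (fun x => f (ℓ x)) := by
  obtain ⟨P, hP, hf⟩ := hf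
  have : (fun x => f (ℓ x))
      = fun x => ∑ s ∈ P.support, P.coeff s * ∏ v, (ℓ x v : ℚ) ^ s v := by
    ext x
    rw [hf, MvPolynomial.eval_eq']
  rw [this]
  refine sum _ fun s hs => const_mul _ ?_
  refine (prod_pow Finset.univ s fun v _ => (hℓ v).pow (s v)).mono ?_
  rw [← Finsupp.degree_eq_sum]
  exact hP s hs

theorem comp_add {k : ℕ} {f : (V → ℤ) → ℚ} (hf : IsPolyFun k f) (a : V → ℤ) :
    IsPolyFun k (fun x => f (x + a)) :=
  hf.comp fun v => by
    simpa using (coord v).add ((const (a v : ℚ)).mono one_le_two)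

/-- Faulhaber's formula is applied to the factor in `x u` of each monomial. Subtracting the value at
`x u = 0` normalises the result without changing its difference in direction u. -/
theorem exists_antidifference {k : ℕ} {f : (V → ℤ) → ℚ} (hf : IsPolyFun k f) (u : V) :
    ∃ g, IsPolyFun (k + 1) g ∧ (∀ x, g (x + Pi.single u 1) - g x = f x) ∧
      ∀ x, x u = 0 → g x = 0 := by
  obtain ⟨P, hP, hf⟩ := hf
  choose q hq hq' using exists_antidifference_pow
  have key : ∃ g, IsPolyFun (k + 1) g ∧ ∀ x, g (x + Pi.single u 1) - g x = f x := by
    refine ⟨fun x => ∑ s ∈ P.support, P.coeff s *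
      ((q (s u)).eval (x u : ℚ) * ∏ v ∈ Finset.univ.erase u, (x v : ℚ) ^ s v), ?_, fun x => ?_⟩
    · refine sum _ fun s hs => const_mul _ ?_
      have h1 : IsPolyFun (s u + 1 + 1) fun x : V → ℤ => (q (s u)).eval (x u : ℚ) := by
        simp only [Polynomial.eval_eq_sum_range]
        refine sum _ fun i hi => const_mul _ (((coord u).pow i).mono ?_)
        have := hq (s u)
        rw [Finset.mem_range] at hi
        omega
      have h2 := prod_pow (Finset.univ.erase u) s fun v _ => (coord (V := V) v).pow (s v)
      refine (h1.mul h2).mono ?_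
      have h3 := Finset.add_sum_erase Finset.univ s (Finset.mem_univ u)
      rw [← Finsupp.degree_eq_sum] at h3
      have := hP s hs
      omega
    · rw [hf, MvPolynomial.eval_eq', ← Finset.sum_sub_distrib]
      refine Finset.sum_congr rfl fun s _ => ?_
      rw [← Finset.mul_prod_erase Finset.univ _ (Finset.mem_univ u), ← hq', ← mul_sub]
      have : ∏ v ∈ Finset.univ.erase u, (((x + Pi.single u 1 : V → ℤ) v : ℤ) : ℚ) ^ s v
          = ∏ v ∈ Finset.univ.erase u, (x v : ℚ) ^ s v :=
        Finset.prod_congr rfl fun v hv => by simp [Finset.ne_of_mem_erase hv]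
      rw [this, ← sub_mul]
      simp
  obtain ⟨g, hg, hg'⟩ := key
  refine ⟨fun x => g x - g (Function.update x u 0), hg.sub (hg.comp fun v => ?_), fun x => ?_,
    fun x hx => ?_⟩
  · by_cases h : v = u
    · subst h
      simpa using zero 2
    · simpa [h] using coord v
  · have : Function.update (x + Pi.single u 1) u 0 = Function.update x u 0 := by
      ext v
      by_cases h : v = u
      · subst h; simp
      · simp [h]
    simp only [this, ← hg']
    ring
  · have : Function.update x u 0 = x := by rw [← hx, Function.update_eq_self]
    simp only [this, sub_self]

/-- A function whose differences in all coordinate directions are polynomial is polynomial. -/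
theorem of_differences {k : ℕ} {f : (V → ℤ) → ℚ}
    (h : ∀ u, IsPolyFun k fun x => f (x + Pi.single u 1) - f x) : IsPolyFun (k + 1) f := by
  -- The coordinates outside S are frozen at 0 and released one at a time; each release adds the
  -- normalised antidifference of the corresponding difference of f.
  have key : ∀ S : Finset V, IsPolyFun (k + 1) fun x => f fun v => if v ∈ S then x v else 0 := by
    intro S
    induction S using Finset.induction_on with
    | empty => simpa using (const (V := V) (f fun _ => 0)).mono (Nat.le_add_left 1 k)
    | insert u S hu ih =>
      obtain ⟨g, hg, hg', hg0⟩ := (h u).exists_antidifference u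
      have h1 : ∀ y : V → ℤ, f y = f (Function.update y u 0) + g y := by
        intro y
        have h2 : ∀ (n : ℤ) (z : V → ℤ), z u = n → f z = f (Function.update z u 0) + g z := by
          intro n
          induction n using Int.induction_on with
          | zero =>
            intro z hz
            have : Function.update z u 0 = z := by rw [← hz, Function.update_eq_self]
            rw [this, hg0 z hz, add_zero]
          | succ n ih =>
            intro z hz
            have h3 := ih (z - Pi.single u 1) (by simp [hz])
            have h4 := hg' (z - Pi.single u 1)
            have h5 : Function.update (z - Pi.single u 1) u 0 = Function.update z u 0 := by
              ext v
              by_cases h : v = u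
              · subst h; simp
              · simp [h]
            rw [sub_add_cancel] at h4
            rw [h5] at h3
            linarith
          | pred n ih =>
            intro z hz
            have h3 := ih (z + Pi.single u 1) (by simp [hz])
            have h4 := hg' z
            have h5 : Function.update (z + Pi.single u 1) u 0 = Function.update z u 0 := by
              ext v
              by_cases h : v = u
              · subst h; simp
              · simp [h]
            rw [h5] at h3
            linarith
        exact h2 _ y rfl
      have h2 : (fun x : V → ℤ => f fun v => if v ∈ insert u S then x v else 0)
          = fun x => (f fun v => if v ∈ S then x v else 0)
            + g fun v => if v ∈ insert u S then x v else 0 := by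
        ext x
        rw [h1]
        congr 2
        ext v
        by_cases h : v = u
        · subst h; simp [hu]
        · simp [h]
      rw [h2]
      refine ih.add (hg.comp fun v => ?_)
      by_cases h : v ∈ insert u S
      · simpa [h] using coord v
      · simpa [h] using zero 2
  simpa using key Finset.univ

end IsPolyFun

end PolyFun

end Hurwitz

namespace Hurwitz

set_option linter.unusedSectionVars false

/-! ### Flows on bipartite graphs -/

section Bipartite

variable {A I J : Type*} [Fintype A] [DecidableEq A] [Fintype I] [DecidableEq I] [Fintype J]
  [DecidableEq J]

/-- The sum of the coordinates in `S` belonging to `I` minus the sum of those belonging to `J`. -/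
def balance (S : Finset (I ⊕ J)) : (I ⊕ J → ℤ) →+ ℤ where
  toFun x := ∑ v ∈ S, (if v.isLeft then x v else - x v)
  map_zero' := by simp
  map_add' x y := by
    rw [← Finset.sum_add_distrib]
    refine Finset.sum_congr rfl fun v _ => ?_
    split_ifs <;> simp [add_comm]

variable (I J) in
/-- The lattice of balanced integer vectors. -/
def balanced : AddSubgroup (I ⊕ J → ℤ) := (balance Finset.univ).ker

/-- The vector of the edge from `i` to `j`. -/
def edgeVector (i : I) (j : J) : I ⊕ J → ℤ := Pi.single (.inl i) 1 + Pi.single (.inr j) 1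

theorem balance_edgeVector (S : Finset (I ⊕ J)) (i : I) (j : J) :
    balance S (edgeVector i j) = (if .inl i ∈ S then 1 else 0) - (if .inr j ∈ S then 1 else 0) := by
  have h (v : I ⊕ J) : (if v.isLeft then edgeVector i j v else - edgeVector i j v)
      = (if v = .inl i then 1 else 0) - (if v = .inr j then 1 else 0) := by
    rcases v with v | v <;> simp [edgeVector, Pi.single_apply]
  show ∑ v ∈ S, _ = _
  simp only [h, Finset.sum_sub_distrib, Finset.sum_ite_eq']

theorem edgeVector_mem_balanced (i : I) (j : J) : edgeVector i j ∈ balanced I J := by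
  rw [balanced, AddMonoidHom.mem_ker, balance_edgeVector]
  simp

variable (w : A → I) (β : A → J)

/-- The vector of an edge, in the lattice of balanced vectors. -/
def edgeVec (e : A) : balanced I J := ⟨edgeVector (w e) (β e), edgeVector_mem_balanced _ _⟩

/-- The edges in `F` connect all vertices. -/
def Connects (F : Finset A) : Prop :=
  ∀ S : Finset (I ⊕ J), (∀ e ∈ F, .inl (w e) ∈ S ↔ .inr (β e) ∈ S) → S = ∅ ∨ S = Finset.univ

/-- A balanced vector attached to each vertex, with respect to the base point `i₀`. -/
def vertexVec (i₀ : I) : I ⊕ J → balanced I J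
  | .inl i => ⟨Pi.single (.inl i) 1 - Pi.single (.inl i₀) 1, by
      rw [balanced, AddMonoidHom.mem_ker, map_sub, sub_eq_zero]
      show ∑ v, _ = ∑ v, _
      simp [Pi.single_apply]⟩
  | .inr j => ⟨edgeVector i₀ j, edgeVector_mem_balanced _ _⟩

/-- The projection to the lattice of balanced vectors which changes the coordinate at `i₀` only. -/
def toBalanced (i₀ : I) : (I ⊕ J → ℤ) →+ balanced I J where
  toFun x := ∑ v, x v • vertexVec i₀ v
  map_zero' := by simp
  map_add' x y := by simp [add_smul, Finset.sum_add_distrib]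

theorem toBalanced_single (i₀ : I) (v : I ⊕ J) :
    toBalanced i₀ (Pi.single v 1) = vertexVec i₀ v := by
  show ∑ u, (Pi.single v 1 : I ⊕ J → ℤ) u • vertexVec i₀ u = _
  rw [Finset.sum_eq_single v (fun u _ h => by simp [h]) (by simp)]
  simp

theorem balance_univ (x : I ⊕ J → ℤ) :
    balance Finset.univ x = ∑ i, x (.inl i) - ∑ j, x (.inr j) := by
  show ∑ v, _ = _
  simp [sub_eq_add_neg]

theorem toBalanced_apply (i₀ : I) (x : balanced I J) : toBalanced i₀ (x : I ⊕ J → ℤ) = x := by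
  have hx : balance Finset.univ x.1 = 0 := x.2
  rw [balance_univ, sub_eq_zero] at hx
  ext v
  have : ((toBalanced i₀ (x : I ⊕ J → ℤ) : balanced I J) : I ⊕ J → ℤ) v
      = ∑ u, x.1 u * (vertexVec i₀ u).1 v := by
    show ((∑ u, x.1 u • vertexVec i₀ u : balanced I J) : I ⊕ J → ℤ) v = _
    simp
  rw [this, Fintype.sum_sum_type]
  rcases v with v | v
  · simp [vertexVec, edgeVector, Pi.single_apply, mul_sub, Finset.sum_sub_distrib, hx]
  · simp [vertexVec, edgeVector, Pi.single_apply]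

/-- The vectors of the two ends of an edge sum to the vector of that edge, so the vertices whose
vector lies in the subgroup form a union of components of F. The base point belongs to it, its
vector being zero, hence so does every vertex. -/
theorem closure_edgeVec {F : Finset A} (i₀ : I) (hF : Connects w β F) :
    AddSubgroup.closure (edgeVec w β '' F) = ⊤ := by
  classical
  have h := hF (Finset.univ.filter fun v => vertexVec i₀ v ∈ AddSubgroup.closure (edgeVec w β '' F))
    fun e he => by
      have h1 : vertexVec i₀ (.inl (w e)) + vertexVec i₀ (.inr (β e)) = edgeVec w β e := by
        ext v
        simp [vertexVec, edgeVec, edgeVector]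
        ring
      have h2 : edgeVec w β e ∈ AddSubgroup.closure (edgeVec w β '' F) :=
        AddSubgroup.subset_closure ⟨e, he, rfl⟩
      rw [← h1] at h2
      simp only [Finset.mem_filter, Finset.mem_univ, true_and]
      exact ⟨fun h => (AddSubgroup.add_mem_cancel_left _ h).1 h2,
        fun h => (AddSubgroup.add_mem_cancel_right _ h).1 h2⟩
  have h0 : vertexVec (J := J) i₀ (.inl i₀) = 0 := by
    ext v
    simp [vertexVec]
  rcases h with h | h
  · have : (.inl i₀ : I ⊕ J) ∈ (∅ : Finset (I ⊕ J)) := by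
      rw [← h]
      simp [h0, zero_mem]
    simp at this
  · rw [eq_top_iff]
    intro x _
    rw [← toBalanced_apply i₀ x]
    refine sum_mem fun v _ => zsmul_mem ?_ _
    have : v ∈ (Finset.univ : Finset (I ⊕ J)) := Finset.mem_univ v
    rw [← h] at this
    exact (Finset.mem_filter.1 this).2

/-- On a connected graph only constant functions have zero coboundary; rank-nullity for the
coboundary gives the bound. -/
theorem card_le_of_connects {F : Finset A} (i₀ : I) (hF : Connects w β F) :
    Fintype.card (I ⊕ J) ≤ F.card + 1 := by
  let T : (I ⊕ J → ℚ) →ₗ[ℚ] (F → ℚ) :=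
    LinearMap.pi fun e => LinearMap.proj (.inl (w e)) - LinearMap.proj (.inr (β e))
  have h1 := T.finrank_range_add_finrank_ker
  have h2 : Module.finrank ℚ (LinearMap.range T) ≤ F.card := by
    simpa using (LinearMap.range T).finrank_le
  have h3 : LinearMap.ker T ≤ Submodule.span ℚ {fun _ => 1} := by
    intro f hf
    have h := hF (Finset.univ.filter fun v => f v = f (.inl i₀)) fun e he => by
      have : f (.inl (w e)) - f (.inr (β e)) = 0 := congrFun (LinearMap.mem_ker.1 hf) ⟨e, he⟩
      simp [sub_eq_zero.1 this]
    rcases h with h | h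
    · have : (.inl i₀ : I ⊕ J) ∈ (∅ : Finset (I ⊕ J)) := by
        rw [← h]
        simp
      simp at this
    · refine Submodule.mem_span_singleton.2 ⟨f (.inl i₀), funext fun v => ?_⟩
      have : v ∈ (Finset.univ : Finset (I ⊕ J)) := Finset.mem_univ v
      rw [← h] at this
      simpa using (Finset.mem_filter.1 this).2.symm
  have h4 : Module.finrank ℚ (LinearMap.ker T) ≤ 1 :=
    (Submodule.finrank_mono h3).trans ((finrank_span_le_card _).trans (by simp))
  rw [Module.finrank_fintype_fun_eq_card] at h1
  omega

/-- The proper nonempty sets of vertices. -/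
abbrev Cut (I J : Type*) [Fintype I] [Fintype J] : Type _ :=
  {S : Finset (I ⊕ J) // S ≠ ∅ ∧ S ≠ Finset.univ}

/-- The balance of the vertices in a cut. -/
def cutForm (S : Cut I J) : balanced I J →+ ℤ := (balance S.1).comp (balanced I J).subtype

/-- If F is not connected, a proper union of its components is a cut, and each edge of F lies on one
side of it. -/
theorem closure_eq_top_or_exists_cut (i₀ : I) (F : Finset A) :
    AddSubgroup.closure (edgeVec w β '' F) = ⊤ ∨
      ∃ S : Cut I J, ∀ e ∈ F, cutForm S (edgeVec w β e) = 0 := by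
  by_cases hF : Connects w β F
  · exact Or.inl (closure_edgeVec w β i₀ hF)
  · rw [Connects] at hF
    push Not at hF
    obtain ⟨S, hS, h1, h2⟩ := hF
    refine Or.inr ⟨⟨S, h1.ne_empty, h2⟩, fun e he => ?_⟩
    show balance S (edgeVector _ _) = 0
    rw [balance_edgeVector, sub_eq_zero]
    simp [hS e he]

-- Deleting an edge lowers both |F| and the degree bound by one, which drives the induction through
-- the differences of the function. For connected F one has |F| + 1 ≥ |I ⊕ J|, so k ≥ 1 and there is
-- a degree to lower; for disconnected F the function is zero. Composing with `toBalanced` extends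
-- it to all integer vectors, so that differences in every coordinate direction make sense.
variable {w β} in
theorem isPolyFun_flowPoly (i₀ : I) {s : Cut I J → ℝ} {x₀ : balanced I J}
    (hdeg : ∃ deg : balanced I J →+ ℤ, ∀ e, deg (edgeVec w β e) = 1)
    (hx₀ : ∀ S, 0 < s S * (cutForm S x₀ : ℝ)) (F : Finset A) : ∀ k : ℕ,
      F.card + 2 ≤ k + Fintype.card (I ⊕ J) →
        IsPolyFun k fun x => flowPoly (edgeVec w β) x₀ F (toBalanced i₀ x) := by
  obtain ⟨deg, hdeg⟩ := hdeg
  have hgen := closure_eq_top_or_exists_cut w β i₀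
  induction F using Finset.strongInduction with
  | H F ih =>
  intro k hk
  by_cases hF : Connects w β F
  · have hcard := card_le_of_connects w β i₀ hF
    obtain ⟨k, rfl⟩ : ∃ l, k = l + 1 := ⟨k - 1, by omega⟩
    refine IsPolyFun.of_differences fun u => ?_
    simp only [map_add, toBalanced_single]
    have key : ∀ d : balanced I J, IsPolyFun k fun x =>
        flowPoly (edgeVec w β) x₀ F (toBalanced i₀ x + d)
          - flowPoly (edgeVec w β) x₀ F (toBalanced i₀ x) := by
      intro d
      have hd : d ∈ AddSubgroup.closure (edgeVec w β '' F) :=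
        closure_edgeVec w β i₀ hF ▸ AddSubgroup.mem_top d
      induction hd using AddSubgroup.closure_induction with
      | mem d hd =>
        obtain ⟨e, he, rfl⟩ := hd
        have h1 := (ih _ (Finset.erase_ssubset he) k (by
          have := Finset.card_pos.2 ⟨e, he⟩
          rw [Finset.card_erase_of_mem he]; omega)).comp_add (edgeVec w β e : I ⊕ J → ℤ)
        simpa [map_add, toBalanced_apply, flowPoly_add hdeg hx₀ hgen he] using h1
      | zero => simpa using IsPolyFun.zero k
      | add c d _ _ hc hd =>
        have h1 := hc.add (hd.comp_add (c : I ⊕ J → ℤ))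
        simp only [map_add, toBalanced_apply] at h1
        simp only [← add_assoc]
        simpa using h1
      | neg d _ hd =>
        have h1 := (hd.comp_add ((-d : balanced I J) : I ⊕ J → ℤ)).neg
        simp only [map_add, toBalanced_apply] at h1
        simpa using h1
    exact key _
  · rw [Connects] at hF
    push Not at hF
    obtain ⟨S, hS, h1, h2⟩ := hF
    have h0 : ∀ x, flowPoly (edgeVec w β) x₀ F x = 0 :=
      flowPoly_eq_zero hx₀ (i := ⟨S, h1.ne_empty, h2⟩) fun e he => by
        show balance S (edgeVector _ _) = 0
        rw [balance_edgeVector, sub_eq_zero]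
        simp [hS e he]
    simpa [h0] using IsPolyFun.zero k

theorem exists_degree : ∃ deg : balanced I J →+ ℤ, ∀ e, deg (edgeVec w β e) = 1 := by
  refine ⟨(balance (Finset.univ.filter fun v => v.isLeft)).comp (balanced I J).subtype, fun e => ?_⟩
  show balance _ (edgeVector _ _) = 1
  simp [balance_edgeVector]

/-- The number of nonnegative integer flows with given supplies and demands, which are supported
in `F` and positive on `T`. -/
noncomputable def netCount (F T : Finset A) (x : I ⊕ J → ℤ) : ℕ :=
  {c : A → ℕ | (∀ e ∉ F, c e = 0) ∧ (∀ e ∈ T, 0 < c e) ∧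
    ∑ e, c e • edgeVector (w e) (β e) = x}.ncard

theorem finite_netFlows (x : I ⊕ J → ℤ) :
    {c : A → ℕ | ∑ e, c e • edgeVector (w e) (β e) = x}.Finite := by
  refine finite_flows (deg := balance (Finset.univ.filter fun v => v.isLeft)) (fun e => ?_) x
  simp [balance_edgeVector]

/-- In each chamber of the arrangement of cuts, the number of flows is given by a polynomial. -/
theorem exists_polynomial_netCount (i₀ : I) (s : Finset (I ⊕ J) → ℝ) (T : Finset A) :
    ∀ F : Finset A, T ⊆ F → ∃ P : MvPolynomial (I ⊕ J) ℚ,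
      (∀ d ∈ P.support, d.degree + Fintype.card (I ⊕ J) < F.card + 2) ∧
      ∀ x : I ⊕ J → ℤ, x ∈ balanced I J →
        (∀ S : Finset (I ⊕ J), S ≠ ∅ → S ≠ Finset.univ → 0 < s S * (balance S x : ℝ)) →
          (netCount w β F T x : ℚ) = MvPolynomial.eval (fun v => (x v : ℚ)) P := by
  induction T using Finset.induction_on with
  | empty =>
    intro F _
    -- Any lattice point of the chamber may serve as the direction of extrapolation. If there is
    -- none, the claim is vacuous and the zero polynomial will do.
    by_cases hex : ∃ x₀ : balanced I J, ∀ S : Cut I J, 0 < s S * (cutForm S x₀ : ℝ)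
    · obtain ⟨x₀, hx₀⟩ := hex
      obtain ⟨P, hP, hP'⟩ := isPolyFun_flowPoly i₀ (exists_degree w β) hx₀ F
        (F.card + 2 - Fintype.card (I ⊕ J)) (by omega)
      refine ⟨P, fun d hd => by have := hP d hd; omega, fun x hx hpos => ?_⟩
      obtain ⟨deg, hdeg⟩ := exists_degree w β
      rw [← hP']
      simp only
      rw [show toBalanced i₀ x = ⟨x, hx⟩ from toBalanced_apply i₀ ⟨x, hx⟩]
      rw [← flowCount_eq_flowPoly hdeg hx₀ (closure_eq_top_or_exists_cut w β i₀) F ⟨x, hx⟩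
        (region_of_pos F fun S => hpos S.1 S.2.1 S.2.2)]
      rw [Nat.cast_inj, netCount, flowCount]
      congr 1
      ext c
      simp [Subtype.ext_iff, edgeVec]
    · refine ⟨0, by simp, fun x hx hpos => absurd ⟨⟨x, hx⟩, fun S => hpos S.1 S.2.1 S.2.2⟩ hex⟩
  | insert e T he ih =>
    intro F hF
    have heF := hF (Finset.mem_insert_self e T)
    have hTF := (Finset.subset_insert e T).trans hF
    obtain ⟨P, hP, hP'⟩ := ih F hTF
    obtain ⟨Q, hQ, hQ'⟩ := ih (F.erase e) (Finset.subset_erase.2 ⟨hTF, he⟩)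
    refine ⟨P - Q, fun d hd => ?_, fun x hx hpos => ?_⟩
    · rcases Finset.mem_union.1 (MvPolynomial.support_sub _ _ _ hd) with h | h
      · exact hP d h
      · have := hQ d h
        rw [Finset.card_erase_of_mem heF] at this
        omega
    -- Flows positive on T either are positive on e or vanish there; in the latter case they are
    -- supported in `F.erase e`, whose polynomial has smaller degree bound.
    · have hsplit : netCount w β F T x
          = netCount w β F (insert e T) x + netCount w β (F.erase e) T x := by
        rw [netCount, netCount, netCount, ← Set.ncard_union_eq ?_ ?_ ?_]
        · congr 1
          ext c
          simp only [Set.mem_union, Set.mem_ofPred_eq, Finset.mem_insert, Finset.mem_erase,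
            forall_eq_or_imp, not_and']
          constructor
          · rintro ⟨h1, h2, h3⟩
            rcases Nat.eq_zero_or_pos (c e) with h | h
            · refine Or.inr ⟨fun e' he' => ?_, h2, h3⟩
              by_cases h' : e' ∈ F
              · rw [not_not.1 (he' h'), h]
              · exact h1 _ h'
            · exact Or.inl ⟨h1, ⟨h, h2⟩, h3⟩
          · rintro (⟨h1, h2, h3⟩ | ⟨h1, h2, h3⟩)
            · exact ⟨h1, h2.2, h3⟩
            · exact ⟨fun e' he' => h1 e' fun h => absurd h he', h2, h3⟩
        · rw [Set.disjoint_left]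
          rintro c ⟨-, h1, -⟩ ⟨h2, -⟩
          have := h1 e (Finset.mem_insert_self _ _)
          rw [h2 e (by simp)] at this
          exact this.false
        · exact (finite_netFlows w β x).subset fun c hc => hc.2.2
        · exact (finite_netFlows w β x).subset fun c hc => hc.2.2
      rw [map_sub, ← hP' x hx hpos, ← hQ' x hx hpos, hsplit]
      push_cast
      ring

end Bipartite

end Hurwitz

namespace Hurwitz

set_option linter.unusedSectionVars false

/-! ### Orbits of permutations -/

section Orbits

variable {X Y : Type*}

/-- The fibres of `f` are the orbits of `σ`, and `f` is surjective. -/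
structure ClassifiesOrbits (σ : Equiv.Perm X) (f : X → Y) : Prop where
  map_eq : ∀ x, f (σ x) = f x
  imp : ∀ p : X → Prop, (∀ x, p (σ x) ↔ p x) → ∀ x y, f x = f y → p x → p y
  surjective : Function.Surjective f

theorem apply_iff_of_mem_closure {S : Set (Equiv.Perm X)} {p : X → Prop}
    (h : ∀ σ ∈ S, ∀ x, p (σ x) ↔ p x) {τ : Equiv.Perm X} (hτ : τ ∈ Subgroup.closure S) :
    ∀ x, p (τ x) ↔ p x := by
  induction hτ using Subgroup.closure_induction with
  | mem σ hσ => exact h σ hσ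
  | one => exact fun x => Iff.rfl
  | mul σ τ _ _ hσ hτ => exact fun x => (hσ (τ x)).trans (hτ x)
  | inv σ _ hσ =>
    intro x
    rw [← hσ (σ⁻¹ x)]
    simp

theorem apply_iff_of_sameCycle {σ : Equiv.Perm X} {p : X → Prop}
    (h : ∀ x, p (σ x) ↔ p x) {x y : X} (hxy : σ.SameCycle x y) : p x ↔ p y := by
  obtain ⟨k, rfl⟩ := hxy
  have hk : σ ^ k ∈ Subgroup.closure {σ} :=
    Subgroup.zpow_mem _ (Subgroup.subset_closure (Set.mem_singleton σ)) k
  exact (apply_iff_of_mem_closure (p := p) (by simpa using h) hk x).symm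

theorem apply_eq_of_sameCycle {σ : Equiv.Perm X} {f : X → Y}
    (h : ∀ x, f (σ x) = f x) {x y : X} (hxy : σ.SameCycle x y) : f x = f y :=
  ((apply_iff_of_sameCycle (p := fun z => f x = f z) (fun z => by rw [h]) hxy).1 rfl)

theorem ClassifiesOrbits.eq_iff {σ : Equiv.Perm X} {f : X → Y} (h : ClassifiesOrbits σ f) (x y : X) :
    f x = f y ↔ σ.SameCycle x y :=
  ⟨fun hxy => h.imp (fun z => σ.SameCycle x z) (fun _ => Equiv.Perm.sameCycle_apply_right) x y hxy
    (Equiv.Perm.SameCycle.refl _ _), apply_eq_of_sameCycle h.map_eq⟩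

theorem card_orbit_eq_minimalPeriod [Finite X] (σ : Equiv.Perm X) (x : X) :
    Nat.card {y : X // (Quotient.mk (Equiv.Perm.SameCycle.setoid σ) y) = Quotient.mk _ x}
      = Function.minimalPeriod σ x := by
  classical
  have := Fintype.ofFinite X
  have h := MulAction.minimalPeriod_eq_card (a := σ) (b := x)
  rw [← Nat.card_eq_fintype_card] at h
  refine Eq.trans (Nat.card_congr (Equiv.subtypeEquivRight fun y => ?_)) h.symm
  rw [Quotient.eq]
  show σ.SameCycle y x ↔ _
  rw [Equiv.Perm.sameCycle_comm, MulAction.mem_orbit_iff]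
  constructor
  · rintro ⟨k, rfl⟩
    exact ⟨⟨σ ^ k, k, rfl⟩, rfl⟩
  · rintro ⟨⟨_, k, rfl⟩, rfl⟩
    exact ⟨k, rfl⟩

theorem card_eq_card_orbits_mul [Finite X] (σ : Equiv.Perm X) (c : ℕ)
    (P : Quotient (Equiv.Perm.SameCycle.setoid σ) → Prop)
    (h : ∀ x, P (Quotient.mk _ x) → Function.minimalPeriod σ x = c) :
    Nat.card {x : X // P (Quotient.mk _ x)} = Nat.card {v // P v} * c := by
  have := Quotient.finite (Equiv.Perm.SameCycle.setoid σ)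
  have e : {x : X // P (Quotient.mk _ x)} ≃
      Σ v : {v // P v}, {x : X // (Quotient.mk (Equiv.Perm.SameCycle.setoid σ) x) = v.1} :=
    { toFun := fun x => ⟨⟨_, x.2⟩, x.1, rfl⟩
      invFun := fun y => ⟨y.2.1, by rw [y.2.2]; exact y.1.2⟩
      left_inv := fun x => rfl
      right_inv := by
        rintro ⟨⟨v, hv⟩, x, hx⟩
        change _ = v at hx
        subst hx
        rfl }
  have := Fintype.ofFinite {v // P v}
  rw [Nat.card_congr e, Nat.card_sigma, Finset.sum_congr rfl (g := fun _ => c), Finset.sum_const,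
    Finset.card_univ, Nat.card_eq_fintype_card, smul_eq_mul]
  rintro ⟨v, hv⟩ _
  induction v using Quotient.inductionOn with
  | h x => rw [card_orbit_eq_minimalPeriod, h x hv]

theorem minimalPeriod_eq_two {σ : Equiv.Perm X} {x : X} (h1 : σ x ≠ x) (h2 : σ (σ x) = x) :
    Function.minimalPeriod σ x = 2 := by
  have h3 : Function.IsPeriodicPt σ 2 x := h2
  rcases (Nat.dvd_prime Nat.prime_two).1 h3.minimalPeriod_dvd with h | h
  · exact absurd (Function.minimalPeriod_eq_one_iff_isFixedPt.1 h) h1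
  · exact h

theorem minimalPeriod_eq_four {σ : Equiv.Perm X} {x : X} (h2 : σ (σ x) ≠ x)
    (h4 : σ (σ (σ (σ x))) = x) : Function.minimalPeriod σ x = 4 := by
  have h3 : Function.IsPeriodicPt σ 4 x := h4
  have h5 : ¬ Function.minimalPeriod σ x ∣ 2 := fun h =>
    h2 (Function.isPeriodicPt_iff_minimalPeriod_dvd.2 h)
  have h6 := h3.minimalPeriod_dvd
  have h7 := Nat.le_of_dvd (by norm_num) h6
  interval_cases Function.minimalPeriod σ x <;> omega

theorem eq_of_finRotate {n : ℕ} {f : Fin n → Y} (h : ∀ k, f (finRotate n k) = f k) (k l : Fin n) :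
    f k = f l := by
  cases n with
  | zero => exact k.elim0
  | succ n =>
    have h0 : ∀ k, f k = f 0 := by
      intro k
      induction k using Fin.induction with
      | zero => rfl
      | succ i ih => rw [← ih, ← h i.castSucc, finRotate_apply, Fin.coeSucc_eq_succ]
    rw [h0 k, h0 l]

end Orbits

/-! ### Galaxies in terms of darts -/

section Darts

variable {D : Type*} {g m n : ℕ}

/-- The dart-level description of a galaxy: `vl` is the label of the tail of a dart and `fl` the
label of the face on its left. -/
structure IsDartGalaxy (rot opp : Equiv.Perm D) (vl : D → Fin (branchCount g m n))
    (fl : D → Fin m ⊕ Fin n) (μ : Fin m → ℕ) (ν : Fin n → ℕ) : Prop where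
  opp_opp : ∀ x, opp (opp x) = x
  connected : ∀ p : D → Prop, (∀ x, p (rot x) ↔ p x) → (∀ x, p (opp x) ↔ p x) → ∀ x y, p x → p y
  vl_rot : ∀ x, vl (rot x) = vl x
  faces : ClassifiesOrbits (rot⁻¹ * opp) fl
  bicoloured : ∀ x, (fl (opp x)).isLeft = !(fl x).isLeft
  white_card : ∀ i, Nat.card {x // fl x = .inl i} = μ i * branchCount g m n
  black_card : ∀ j, Nat.card {x // fl x = .inr j} = ν j * branchCount g m n
  cyclic : ∀ x, (fl x).isLeft → vl ((rot⁻¹ * opp) x) = finRotate _ (vl x)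
  rot_four : ∀ x, rot (rot (rot (rot x))) = x
  card_four : ∀ k, Nat.card {x // vl x = k ∧ rot (rot x) ≠ x} = 4

namespace IsDartGalaxy

variable {rot opp : Equiv.Perm D} {vl : D → Fin (branchCount g m n)}
  {fl : D → Fin m ⊕ Fin n} {μ : Fin m → ℕ} {ν : Fin n → ℕ}

theorem opp_ne (h : IsDartGalaxy rot opp vl fl μ ν) (x : D) : opp x ≠ x := fun hx => by
  have := h.bicoloured x
  rw [hx] at this
  revert this
  cases (fl x).isLeft <;> simp

/-- The face walk leads from `opp (rot x)` to x, so x has the same face on its left as the reversal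
of `rot x`. -/
theorem isLeft_rot (h : IsDartGalaxy rot opp vl fl μ ν) (x : D) :
    (fl (rot x)).isLeft = !(fl x).isLeft := by
  have h1 := h.faces.map_eq (opp (rot x))
  have h2 := h.bicoloured (rot x)
  have h3 : (rot⁻¹ * opp) (opp (rot x)) = x := by simp [h.opp_opp]
  rw [h3] at h1
  rw [h1, h2, Bool.not_not]

theorem rot_ne (h : IsDartGalaxy rot opp vl fl μ ν) (x : D) : rot x ≠ x := fun hx => by
  have := h.isLeft_rot x
  rw [hx] at this
  revert this
  cases (fl x).isLeft <;> simp

theorem minimalPeriod_rot (h : IsDartGalaxy rot opp vl fl μ ν) (x : D) :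
    (rot (rot x) = x ∧ Function.minimalPeriod rot x = 2) ∨
      (rot (rot x) ≠ x ∧ Function.minimalPeriod rot x = 4) := by
  by_cases h2 : rot (rot x) = x
  · exact Or.inl ⟨h2, minimalPeriod_eq_two (h.rot_ne x) h2⟩
  · exact Or.inr ⟨h2, minimalPeriod_eq_four h2 (h.rot_four x)⟩

variable [Finite D]

theorem card_white (h : IsDartGalaxy rot opp vl fl μ ν) :
    Nat.card {x : D // (fl x).isLeft = true} = branchCount g m n * ∑ i, μ i := by
  have e2 : (Σ i : Fin m, {x : D // fl x = .inl i}) ≃ {x : D // (fl x).isLeft = true} :=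
    { toFun := fun p => ⟨p.2.1, by rw [p.2.2]; rfl⟩
      invFun := fun x => ⟨(fl x.1).getLeft x.2, x.1, by simp⟩
      left_inv := by
        rintro ⟨i, x, hx⟩
        refine Sigma.subtype_ext ?_ rfl
        simp [hx]
      right_inv := fun x => rfl }
  rw [← Nat.card_congr e2, Nat.card_sigma, Finset.mul_sum]
  exact Finset.sum_congr rfl fun i _ => (h.white_card i).trans (mul_comm _ _)

theorem card_not (h : IsDartGalaxy rot opp vl fl μ ν) :
    Nat.card {x : D // ¬ (fl x).isLeft = true} = branchCount g m n * ∑ i, μ i := by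
  rw [← h.card_white]
  exact (Nat.card_congr (opp.subtypeEquiv fun x => by rw [h.bicoloured]; simp)).symm

theorem card_darts (h : IsDartGalaxy rot opp vl fl μ ν) :
    Nat.card D = 2 * (branchCount g m n * ∑ i, μ i) := by
  classical
  rw [← Nat.card_congr (Equiv.sumCompl fun x : D => (fl x).isLeft = true),
    Nat.card_sum, h.card_white, h.card_not, two_mul]

/-- The face walk permutes the white darts and advances their labels cyclically. Hence all b labels
occur equally often among the b ∑ μ_i white darts. -/
theorem card_white_label (h : IsDartGalaxy rot opp vl fl μ ν) (k : Fin (branchCount g m n)) :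
    Nat.card {x : D // (fl x).isLeft = true ∧ vl x = k} = ∑ i, μ i := by
  have h1 : ∀ k, Nat.card {x : D // (fl x).isLeft = true ∧ vl x = finRotate _ k}
      = Nat.card {x : D // (fl x).isLeft = true ∧ vl x = k} := fun k => by
    refine (Nat.card_congr ((rot⁻¹ * opp).subtypeEquiv fun x => ?_)).symm
    rw [h.faces.map_eq]
    refine and_congr_right fun hx => ?_
    rw [h.cyclic x hx, (finRotate _).injective.eq_iff]
  have h2 := eq_of_finRotate
    (f := fun k => Nat.card {x : D // (fl x).isLeft = true ∧ vl x = k}) h1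
  have e : (Σ k, {x : D // (fl x).isLeft = true ∧ vl x = k}) ≃ {x : D // (fl x).isLeft = true} :=
    { toFun := fun p => ⟨p.2.1, p.2.2.1⟩
      invFun := fun x => ⟨vl x.1, x.1, x.2, rfl⟩
      left_inv := by
        rintro ⟨_, x, hx, rfl⟩
        rfl
      right_inv := fun x => rfl }
  have h3 := Nat.card_congr e
  rw [Nat.card_sigma, h.card_white, Finset.sum_congr rfl fun l _ => h2 l k, Finset.sum_const,
    Finset.card_univ, Fintype.card_fin, smul_eq_mul] at h3
  exact Nat.eq_of_mul_eq_mul_left (Fin.pos k) h3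

/-- Reversal turns the black darts leaving label k into the white darts leaving the preceding label,
so black darts contribute as many as white ones. -/
theorem card_label (h : IsDartGalaxy rot opp vl fl μ ν) (k : Fin (branchCount g m n)) :
    Nat.card {x : D // vl x = k} = 2 * ∑ i, μ i := by
  classical
  have e1 : {x : {x : D // vl x = k} // (fl x.1).isLeft = true} ≃
      {x : D // (fl x).isLeft = true ∧ vl x = k} :=
    (Equiv.subtypeSubtypeEquivSubtypeInter _ (fun x : D => (fl x).isLeft = true)).trans (Equiv.subtypeEquivRight fun x => and_comm)
  have e2 : {x : {x : D // vl x = k} // ¬ (fl x.1).isLeft = true} ≃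
      {x : D // (fl x).isLeft = true ∧ vl x = (finRotate _).symm k} :=
    (Equiv.subtypeSubtypeEquivSubtypeInter _ (fun x : D => ¬ (fl x).isLeft = true)).trans
      (opp.subtypeEquiv fun x => by
        by_cases hx : (fl x).isLeft = true
        · simp [h.bicoloured, hx]
        · have hx' : (fl (opp x)).isLeft = true := by simp [h.bicoloured, hx]
          have h1 := h.cyclic _ hx'
          have h2 := h.vl_rot (rot⁻¹ x)
          rw [Equiv.Perm.mul_apply, h.opp_opp] at h1
          rw [h1, ← Equiv.Perm.mul_apply, mul_inv_cancel, Equiv.Perm.one_apply] at h2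
          rw [h2, Equiv.eq_symm_apply]
          simp [hx, hx'])
  rw [← Nat.card_congr (Equiv.sumCompl fun x : {x : D // vl x = k} => (fl x.1).isLeft = true),
    Nat.card_sum, Nat.card_congr e1, Nat.card_congr e2, h.card_white_label, h.card_white_label,
    two_mul]

theorem card_label_two (h : IsDartGalaxy rot opp vl fl μ ν) (k : Fin (branchCount g m n)) :
    Nat.card {x : D // vl x = k ∧ rot (rot x) = x} + 4 = 2 * ∑ i, μ i := by
  classical
  rw [← h.card_label k, ← h.card_four k,
    ← Nat.card_congr (Equiv.sumCompl fun x : {x : D // vl x = k} => rot (rot x.1) = x.1),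
    Nat.card_sum]
  congr 1
  · exact Nat.card_congr (Equiv.subtypeSubtypeEquivSubtypeInter _ (fun x => rot (rot x) = x)).symm
  · exact Nat.card_congr (Equiv.subtypeSubtypeEquivSubtypeInter _ (fun x => rot (rot x) ≠ x)).symm

/-- The underlying graph. -/
def combMap (h : IsDartGalaxy rot opp vl fl μ ν) : CombMap D where
  rot := rot
  opp := opp
  opp_opp := h.opp_opp
  opp_ne := h.opp_ne
  connected x y := by
    refine h.connected (fun y => ∃ p ∈ Subgroup.closure ({rot, opp} : Set (Equiv.Perm D)), p x = y)
      ?_ ?_ x y ⟨1, one_mem _, rfl⟩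
    all_goals
      intro y
      refine ⟨?_, ?_⟩
    · rintro ⟨p, hp, hpx⟩
      exact ⟨rot⁻¹ * p, mul_mem (inv_mem (Subgroup.subset_closure (by simp))) hp, by simp [hpx]⟩
    · rintro ⟨p, hp, hpx⟩
      exact ⟨rot * p, mul_mem (Subgroup.subset_closure (by simp)) hp, by simp [hpx]⟩
    · rintro ⟨p, hp, hpx⟩
      exact ⟨opp⁻¹ * p, mul_mem (inv_mem (Subgroup.subset_closure (by simp))) hp, by simp [hpx]⟩
    · rintro ⟨p, hp, hpx⟩
      exact ⟨opp * p, mul_mem (Subgroup.subset_closure (by simp)) hp, by simp [hpx]⟩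

theorem valence_tail (M : CombMap D) (x : D) :
    M.valence (M.tail x) = Function.minimalPeriod M.rot x :=
  card_orbit_eq_minimalPeriod M.rot x

/-- The labels of the vertices. -/
def vertexLabel (h : IsDartGalaxy rot opp vl fl μ ν) :
    h.combMap.Vertex → Fin (branchCount g m n) :=
  Quotient.lift vl fun _ _ hxy => apply_eq_of_sameCycle h.vl_rot hxy

/-- The labels of the faces. -/
noncomputable def faceLabel (h : IsDartGalaxy rot opp vl fl μ ν) :
    h.combMap.Face ≃ Fin m ⊕ Fin n :=
  Equiv.ofBijective (Quotient.lift fl fun _ _ hxy => apply_eq_of_sameCycle h.faces.map_eq hxy) <| by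
    constructor
    · intro x y
      induction x using Quotient.inductionOn with | h x => ?_
      induction y using Quotient.inductionOn with | h y => ?_
      exact fun hxy => Quotient.sound ((h.faces.eq_iff x y).1 hxy)
    · intro f
      obtain ⟨x, hx⟩ := h.faces.surjective f
      exact ⟨Quotient.mk _ x, hx⟩

theorem left_eq_faceLabel_symm (h : IsDartGalaxy rot opp vl fl μ ν) (x : D) (f : Fin m ⊕ Fin n) :
    h.combMap.left x = h.faceLabel.symm f ↔ fl x = f := by
  rw [Equiv.eq_symm_apply]
  rfl

theorem valence_eq_four (h : IsDartGalaxy rot opp vl fl μ ν) (x : D) :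
    h.combMap.valence (h.combMap.tail x) = 4 ↔ rot (rot x) ≠ x := by
  rw [valence_tail]
  show Function.minimalPeriod rot x = 4 ↔ _
  rcases h.minimalPeriod_rot x with ⟨h1, h2⟩ | ⟨h1, h2⟩ <;> simp [h1, h2]

theorem valence_eq_two (h : IsDartGalaxy rot opp vl fl μ ν) (x : D) :
    h.combMap.valence (h.combMap.tail x) = 2 ↔ rot (rot x) = x := by
  rw [valence_tail]
  show Function.minimalPeriod rot x = 2 ↔ _
  rcases h.minimalPeriod_rot x with ⟨h1, h2⟩ | ⟨h1, h2⟩ <;> simp [h1, h2]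

theorem card_vertices_four (h : IsDartGalaxy rot opp vl fl μ ν) (k : Fin (branchCount g m n)) :
    Nat.card {v // h.vertexLabel v = k ∧ h.combMap.valence v = 4} = 1 := by
  have h1 := card_eq_card_orbits_mul rot 4
    (fun v => h.vertexLabel v = k ∧ h.combMap.valence v = 4)
    fun x hx => (valence_tail h.combMap x).symm.trans hx.2
  have h2 : Nat.card {x : D // h.vertexLabel (h.combMap.tail x) = k ∧
      h.combMap.valence (h.combMap.tail x) = 4} = 4 := by
    refine Eq.trans ?_ (h.card_four k)
    exact Nat.card_congr (Equiv.subtypeEquivRight fun x => and_congr_right' (h.valence_eq_four x))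
  have h3 := h2.symm.trans h1
  change 4 = Nat.card {v // h.vertexLabel v = k ∧ h.combMap.valence v = 4} * 4 at h3
  omega

theorem card_vertices_two (h : IsDartGalaxy rot opp vl fl μ ν) (k : Fin (branchCount g m n)) :
    Nat.card {v // h.vertexLabel v = k ∧ h.combMap.valence v = 2} + 2 = ∑ i, μ i := by
  have h1 := card_eq_card_orbits_mul rot 2
    (fun v => h.vertexLabel v = k ∧ h.combMap.valence v = 2)
    fun x hx => (valence_tail h.combMap x).symm.trans hx.2
  have h2 : Nat.card {x : D // h.vertexLabel (h.combMap.tail x) = k ∧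
      h.combMap.valence (h.combMap.tail x) = 2} + 4 = 2 * ∑ i, μ i := by
    rw [← h.card_label_two k]
    congr 1
    exact Nat.card_congr (Equiv.subtypeEquivRight fun x => and_congr_right' (h.valence_eq_two x))
  have h3 := (congrArg (· + 4) h1).symm.trans h2
  change Nat.card {v // h.vertexLabel v = k ∧ h.combMap.valence v = 2} * 2 + 4 = _ at h3
  omega

theorem valence_two_or_four (h : IsDartGalaxy rot opp vl fl μ ν) (v : h.combMap.Vertex) :
    h.combMap.valence v = 2 ∨ h.combMap.valence v = 4 := by
  induction v using Quotient.inductionOn with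
  | h x =>
    by_cases hx : rot (rot x) = x
    · exact Or.inl ((h.valence_eq_two x).2 hx)
    · exact Or.inr ((h.valence_eq_four x).2 hx)

theorem card_vertex (h : IsDartGalaxy rot opp vl fl μ ν) :
    (Nat.card h.combMap.Vertex : ℤ) = branchCount g m n * (∑ i, μ i - 1 : ℤ) := by
  classical
  have hfin : Finite h.combMap.Vertex := Quotient.finite _
  rw [← Nat.card_congr (Equiv.sigmaFiberEquiv h.vertexLabel), Nat.card_sigma]
  push_cast
  have h1 : ∀ k, (Nat.card {v // h.vertexLabel v = k} : ℤ) = ∑ i, (μ i : ℤ) - 1 := by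
    intro k
    have h2 := h.card_vertices_two k
    have h4 := h.card_vertices_four k
    have h3 : Nat.card {v // h.vertexLabel v = k}
        = Nat.card {v // h.vertexLabel v = k ∧ h.combMap.valence v = 2}
          + Nat.card {v // h.vertexLabel v = k ∧ h.combMap.valence v = 4} := by
      rw [← Nat.card_congr (Equiv.sumCompl
        fun v : {v // h.vertexLabel v = k} => h.combMap.valence v.1 = 2), Nat.card_sum]
      congr 1
      · exact Nat.card_congr (Equiv.subtypeSubtypeEquivSubtypeInter _
          (fun v => h.combMap.valence v = 2))
      · refine Nat.card_congr ((Equiv.subtypeSubtypeEquivSubtypeInter _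
          (fun v => ¬ h.combMap.valence v = 2)).trans (Equiv.subtypeEquivRight fun v => ?_))
        refine and_congr_right' ⟨fun h' => (h.valence_two_or_four v).resolve_left h', fun h' => ?_⟩
        rw [h']
        norm_num
    have h5 : (∑ i, (μ i : ℤ)) = ((∑ i, μ i : ℕ) : ℤ) := by push_cast; rfl
    rw [h5, ← h2, h3, h4]
    push_cast
    ring
  rw [Finset.sum_congr rfl fun k _ => h1 k]
  simp [mul_sub]

theorem card_edge (h : IsDartGalaxy rot opp vl fl μ ν) :
    Nat.card h.combMap.Edge = branchCount g m n * ∑ i, μ i := by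
  have h1 := card_eq_card_orbits_mul opp 2 (fun _ => True)
    fun x _ => minimalPeriod_eq_two (h.opp_ne x) (h.opp_opp x)
  rw [Nat.card_congr (Equiv.subtypeUnivEquiv fun _ => trivial),
    Nat.card_congr (Equiv.subtypeUnivEquiv fun _ => trivial), h.card_darts] at h1
  change _ = Nat.card h.combMap.Edge * 2 at h1
  omega

/-- The galaxy with a given dart-level description. -/
noncomputable def galaxy (h : IsDartGalaxy rot opp vl fl μ ν) (hm : 0 < m) (hn : 0 < n) :
    HurwitzGalaxy D g μ ν where
  toCombMap := h.combMap
  -- Here V - E + F = b(d - 1) - bd + m + n = m + n - b = 2 - 2g. The genus thus follows from the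
  -- remaining conditions and is not required in `IsDartGalaxy`.
  euler := by
    rw [h.card_vertex, h.card_edge, Nat.card_congr h.faceLabel, Nat.card_sum]
    have : (branchCount g m n : ℤ) = 2 * g + m + n - 2 := by
      rw [branchCount, Nat.cast_sub (by omega)]
      push_cast
      ring
    simp only [Nat.card_eq_fintype_card, Fintype.card_fin]
    push_cast
    rw [this]
    ring
  faceLabel := h.faceLabel
  bicoloured := h.bicoloured
  white_length i := by
    rw [← h.white_card]
    exact Nat.card_congr (Equiv.subtypeEquivRight fun x => h.left_eq_faceLabel_symm x _)
  black_length j := by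
    rw [← h.black_card]
    exact Nat.card_congr (Equiv.subtypeEquivRight fun x => h.left_eq_faceLabel_symm x _)
  vertexLabel := h.vertexLabel
  cyclic := h.cyclic
  valence_eq := h.valence_two_or_four
  card_two := h.card_vertices_two
  card_four := h.card_vertices_four

end IsDartGalaxy

namespace HurwitzGalaxy

variable {μ : Fin m → ℕ} {ν : Fin n → ℕ} (G : HurwitzGalaxy D g μ ν)

/-- The label of the tail of a dart. -/
def dartLabel (x : D) : Fin (branchCount g m n) := G.vertexLabel (G.tail x)

/-- The label of the face on the left of a dart. -/
def leftLabel (x : D) : Fin m ⊕ Fin n := G.faceLabel (G.left x)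

theorem ext_darts {G H : HurwitzGalaxy D g μ ν} (h1 : ∀ x, G.rot x = H.rot x)
    (h2 : ∀ x, G.opp x = H.opp x) (h3 : ∀ x, G.dartLabel x = H.dartLabel x)
    (h4 : ∀ x, G.leftLabel x = H.leftLabel x) : G = H := by
  obtain ⟨M, _, f, _, _, _, l, _, _, _, _⟩ := G
  obtain ⟨M', _, f', _, _, _, l', _, _, _, _⟩ := H
  obtain rfl : M = M' := CombMap.ext (Equiv.ext h1) (Equiv.ext h2)
  obtain rfl : l = l' := funext fun v => Quotient.inductionOn v h3
  obtain rfl : f = f' := Equiv.ext fun v => Quotient.inductionOn v h4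
  rfl

theorem tail_eq_tail_iff (x y : D) : G.tail x = G.tail y ↔ G.rot.SameCycle x y := Quotient.eq

theorem left_eq_left_iff (x y : D) : G.left x = G.left y ↔ G.next.SameCycle x y := Quotient.eq

theorem tail_rot (x : D) : G.tail (G.rot x) = G.tail x :=
  (G.tail_eq_tail_iff _ _).2 (Equiv.Perm.sameCycle_apply_left.2 (Equiv.Perm.SameCycle.refl _ _))

theorem left_next (x : D) : G.left (G.next x) = G.left x :=
  (G.left_eq_left_iff _ _).2 (Equiv.Perm.sameCycle_apply_left.2 (Equiv.Perm.SameCycle.refl _ _))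

variable [Finite D]

theorem valence_tail_eq_four (x : D) : G.valence (G.tail x) = 4 ↔ G.rot (G.rot x) ≠ x := by
  have h := IsDartGalaxy.valence_tail G.toCombMap x
  rw [h]
  have h2 := G.valence_eq (G.tail x)
  rw [h] at h2
  have h3 : G.rot (G.rot x) = x ↔ Function.minimalPeriod G.rot x ∣ 2 :=
    Function.isPeriodicPt_iff_minimalPeriod_dvd (f := G.rot) (n := 2) (x := x)
  rw [Ne, h3]
  rcases h2 with h2 | h2 <;> rw [h2] <;> norm_num

theorem isDartGalaxy : IsDartGalaxy G.rot G.opp G.dartLabel G.leftLabel μ ν where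
  opp_opp := G.opp_opp
  connected p h1 h2 x y hx := by
    obtain ⟨q, hq, rfl⟩ := G.connected x y
    refine (apply_iff_of_mem_closure (p := p) ?_ hq x).2 hx
    rintro σ (rfl | rfl)
    · exact h1
    · exact h2
  vl_rot x := congrArg G.vertexLabel (G.tail_rot x)
  faces :=
    { map_eq := fun x => congrArg G.faceLabel (G.left_next x)
      imp := fun p hp x y hxy =>
        (apply_iff_of_sameCycle hp ((G.left_eq_left_iff x y).1 (G.faceLabel.injective hxy))).1
      surjective := fun f => by
        obtain ⟨x, hx⟩ := Quotient.exists_rep (G.faceLabel.symm f)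
        exact ⟨x, by rw [leftLabel, ← Equiv.eq_symm_apply]; exact hx⟩ }
  bicoloured := G.bicoloured
  white_card i := by
    rw [← G.white_length i]
    exact Nat.card_congr (Equiv.subtypeEquivRight fun x => (Equiv.eq_symm_apply _).symm)
  black_card j := by
    rw [← G.black_length j]
    exact Nat.card_congr (Equiv.subtypeEquivRight fun x => (Equiv.eq_symm_apply _).symm)
  cyclic := G.cyclic
  rot_four x := by
    have h2 := G.valence_eq (G.tail x)
    rw [IsDartGalaxy.valence_tail G.toCombMap x] at h2
    refine (Function.isPeriodicPt_iff_minimalPeriod_dvd (f := G.rot) (n := 4) (x := x)).2 ?_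
    rcases h2 with h2 | h2
    · rw [h2]
      norm_num
    · rw [h2]
  card_four k := by
    have h1 := card_eq_card_orbits_mul G.rot 4
      (fun v => G.vertexLabel v = k ∧ G.valence v = 4)
      fun x hx => (IsDartGalaxy.valence_tail G.toCombMap x).symm.trans hx.2
    have h2 : Nat.card {v // G.vertexLabel v = k ∧ G.valence v = 4} = 1 := G.card_four k
    have h3 := h1.trans (congrArg (· * 4) h2)
    refine Eq.trans ?_ h3
    exact Nat.card_congr (Equiv.subtypeEquivRight fun x =>
      and_congr_right' (G.valence_tail_eq_four x).symm)

theorem tail_eq_of_dartLabel_eq {x y : D} (hx : G.rot (G.rot x) ≠ x) (hy : G.rot (G.rot y) ≠ y)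
    (h : G.dartLabel x = G.dartLabel y) : G.tail x = G.tail y := by
  have h1 := (Nat.card_eq_one_iff_unique.1 (G.card_four (G.dartLabel x))).1
  have h2 := h1.elim ⟨G.tail x, rfl, (G.valence_tail_eq_four x).2 hx⟩
    ⟨G.tail y, h.symm, (G.valence_tail_eq_four y).2 hy⟩
  exact congrArg Subtype.val h2

/-- Each label is carried by a single 4-valent vertex, so distinct 4-valent vertices are recognised
by distinct labels. -/
theorem isBiPruned_iff : G.IsBiPruned ↔ ∀ f, ∃ x y, G.leftLabel x = f ∧ G.leftLabel y = f ∧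
    G.rot (G.rot x) ≠ x ∧ G.rot (G.rot y) ≠ y ∧ G.dartLabel x ≠ G.dartLabel y := by
  have hfin : Finite G.Vertex := Quotient.finite _
  rw [IsBiPruned, ← G.faceLabel.symm.forall_congr_right]
  refine forall_congr' fun f => ?_
  rw [IsLoopFace, not_le, Finite.one_lt_card_iff_nontrivial, nontrivial_iff]
  constructor
  · rintro ⟨⟨_, hv, x, rfl, hxf⟩, ⟨_, hw, y, rfl, hyf⟩, hne⟩
    rw [valence_tail_eq_four] at hv hw
    refine ⟨x, y, ?_, ?_, hv, hw, fun h => hne ?_⟩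
    · rw [leftLabel, hxf, Equiv.apply_symm_apply]
    · rw [leftLabel, hyf, Equiv.apply_symm_apply]
    · exact Subtype.ext (G.tail_eq_of_dartLabel_eq hv hw h)
  · rintro ⟨x, y, hxf, hyf, hx, hy, hne⟩
    refine ⟨⟨_, (G.valence_tail_eq_four x).2 hx, x, rfl, (Equiv.eq_symm_apply _).2 hxf⟩,
      ⟨_, (G.valence_tail_eq_four y).2 hy, y, rfl, (Equiv.eq_symm_apply _).2 hyf⟩, fun h => hne ?_⟩
    exact congrArg G.vertexLabel (congrArg Subtype.val h)

end HurwitzGalaxy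

end Darts

end Hurwitz

namespace Hurwitz

set_option linter.unusedSectionVars false

/-! ### Labelled galaxies -/

section Labelled

variable {D D' : Type*} {g m n : ℕ} {μ : Fin m → ℕ} {ν : Fin n → ℕ}

theorem ClassifiesOrbits.conj {X X' Y : Type*} {σ : Equiv.Perm X} {f : X → Y}
    (h : ClassifiesOrbits σ f) (e : X ≃ X') : ClassifiesOrbits (e.permCongr σ) (f ∘ e.symm) where
  map_eq x := by simp [Equiv.permCongr_apply, h.map_eq]
  imp p hp x y hxy hx := by
    have := h.imp (fun x => p (e x)) (fun x => by simpa using hp (e x)) (e.symm x) (e.symm y) hxy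
      (by simpa using hx)
    simpa using this
  surjective := h.surjective.comp e.symm.surjective

theorem IsDartGalaxy.conj {rot opp : Equiv.Perm D} {vl : D → Fin (branchCount g m n)}
    {fl : D → Fin m ⊕ Fin n} (h : IsDartGalaxy rot opp vl fl μ ν) (e : D ≃ D') :
    IsDartGalaxy (e.permCongr rot) (e.permCongr opp) (vl ∘ e.symm) (fl ∘ e.symm) μ ν where
  opp_opp x := by simp [h.opp_opp]
  connected p h1 h2 x y hx := by
    have := h.connected (fun x => p (e x)) (fun x => by simpa using h1 (e x))
      (fun x => by simpa using h2 (e x)) (e.symm x) (e.symm y) (by simpa using hx)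
    simpa using this
  vl_rot x := by simp [h.vl_rot]
  faces := by
    have : (e.permCongr rot)⁻¹ * e.permCongr opp = e.permCongr (rot⁻¹ * opp) := by
      ext x
      show e (rot⁻¹ (e.symm (e (opp (e.symm x))))) = _
      simp
    rw [this]
    exact h.faces.conj e
  bicoloured x := by simp [h.bicoloured]
  white_card i := by
    rw [← h.white_card i]
    exact Nat.card_congr (e.symm.subtypeEquiv fun x => Iff.rfl)
  black_card j := by
    rw [← h.black_card j]
    exact Nat.card_congr (e.symm.subtypeEquiv fun x => Iff.rfl)
  cyclic x hx := by
    have := h.cyclic (e.symm x) hx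
    refine Eq.trans ?_ this
    show vl (e.symm (e (rot⁻¹ (e.symm (e (opp (e.symm x))))))) = _
    simp
  rot_four x := by simp [h.rot_four]
  card_four k := by
    rw [← h.card_four k]
    exact Nat.card_congr (e.symm.subtypeEquiv fun x => by simp [← Equiv.eq_symm_apply])

variable [Finite D]

theorem HurwitzGalaxy.exists_relabel (hm : 0 < m) (hn : 0 < n) (G : HurwitzGalaxy D g μ ν)
    (p : Equiv.Perm D) : ∃ (H : HurwitzGalaxy D g μ ν) (f : G.Iso H), f.toEquiv = p :=
  ⟨(G.isDartGalaxy.conj p).galaxy hm hn,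
    { toEquiv := p
      map_rot := fun x => by
        show _ = p (G.rot (p.symm (p x)))
        simp
      map_opp := fun x => by
        show _ = p (G.opp (p.symm (p x)))
        simp
      map_vertexLabel := fun x => by
        show G.dartLabel (p.symm (p x)) = _
        simp
        rfl
      map_faceLabel := fun x => by
        show G.leftLabel (p.symm (p x)) = _
        simp
        rfl }, rfl⟩

namespace HurwitzGalaxy

theorem Iso.isBiPruned {G H : HurwitzGalaxy D g μ ν} (f : G.Iso H) (h : G.IsBiPruned) :
    H.IsBiPruned := by
  rw [isBiPruned_iff] at h ⊢
  intro i
  obtain ⟨x, y, hx, hy, hx', hy', hne⟩ := h i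
  have h1 := f.map_vertexLabel
  have h2 := f.map_faceLabel
  refine ⟨f.toEquiv x, f.toEquiv y, (h2 x).trans hx, (h2 y).trans hy, ?_, ?_, ?_⟩
  · simpa [← f.map_rot] using hx'
  · simpa [← f.map_rot] using hy'
  · exact fun h => hne ((h1 x).symm.trans (h.trans (h1 y)))

/-- The whole structure of the target is transported along the bijection of darts. -/
theorem eq_of_iso {G H H' : HurwitzGalaxy D g μ ν} (f : G.Iso H) (f' : G.Iso H')
    (h : f.toEquiv = f'.toEquiv) : H = H' := by
  refine ext_darts ?_ ?_ ?_ ?_ <;> rw [f.toEquiv.forall_congr_right.symm] <;> intro x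
  · rw [← f.map_rot, h, f'.map_rot]
  · rw [← f.map_opp, h, f'.map_opp]
  · exact (f.map_vertexLabel x).trans ((f'.map_vertexLabel x).symm.trans (by rw [h]; rfl))
  · exact (f.map_faceLabel x).trans ((f'.map_faceLabel x).symm.trans (by rw [h]; rfl))

theorem finite_iso (G H : HurwitzGalaxy D g μ ν) : Finite (G.Iso H) :=
  Finite.of_injective Iso.toEquiv fun e f h => by
    ext x
    rw [h]

theorem card_iso_eq {G H : HurwitzGalaxy D g μ ν} (f : G.Iso H) :
    Nat.card (G.Iso H) = Nat.card G.Aut :=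
  Nat.card_congr
    { toFun := fun a => a.trans f.symm
      invFun := fun a => a.trans f
      left_inv := fun a => by ext x; simp [Iso.trans, Iso.symm]
      right_inv := fun a => by ext x; simp [Iso.trans, Iso.symm] }

end HurwitzGalaxy

-- This is the orbit-stabiliser formula for the symmetric group acting on galaxies by renaming
-- darts: each permutation p determines a unique H for which p is an isomorphism from G to H, and
-- each H in the class is reached |Aut G| times.
open HurwitzGalaxy in
theorem card_isoClass_mul_card_aut (hm : 0 < m) (hn : 0 < n)
    (G : {G : HurwitzGalaxy (Fin (2 * (branchCount g m n * ∑ i, μ i))) g μ ν // G.IsBiPruned}) :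
    Nat.card {H // Quotient.mk (biPrunedSetoid g μ ν) H = Quotient.mk _ G} * Nat.card G.1.Aut
      = (2 * (branchCount g m n * ∑ i, μ i)).factorial := by
  have hiso (H : {H // Quotient.mk (biPrunedSetoid g μ ν) H = Quotient.mk _ G}) :
      Nonempty (G.1.Iso H.1.1) := (Quotient.exact H.2).elim fun f => ⟨f.symm⟩
  have hb : Function.Bijective (fun s : Σ H : {H // Quotient.mk (biPrunedSetoid g μ ν) H
      = Quotient.mk _ G}, G.1.Iso H.1.1 => s.2.toEquiv) := by
    constructor
    · rintro ⟨⟨⟨H, h1⟩, h2⟩, f⟩ ⟨⟨⟨H', h1'⟩, h2'⟩, f'⟩ h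
      obtain rfl := eq_of_iso f f' h
      obtain rfl : f = f' := by
        ext x
        exact congrArg Fin.val (DFunLike.congr_fun h x)
      rfl
    · intro p
      obtain ⟨H, f, rfl⟩ := G.1.exists_relabel hm hn p
      exact ⟨⟨⟨⟨H, f.isBiPruned G.2⟩, Quotient.sound ⟨f.symm⟩⟩, f⟩, rfl⟩
  have h := Nat.card_congr (Equiv.ofBijective _ hb)
  have := fun H : {H // Quotient.mk (biPrunedSetoid g μ ν) H = Quotient.mk _ G} =>
    finite_iso G.1 H.1.1
  have := Fintype.ofFinite {H // Quotient.mk (biPrunedSetoid g μ ν) H = Quotient.mk _ G}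
  rw [Nat.card_sigma, Finset.sum_congr rfl fun H _ => (hiso H).elim fun f => card_iso_eq f,
    Finset.sum_const, Finset.card_univ, smul_eq_mul, ← Nat.card_eq_fintype_card,
    Nat.card_eq_fintype_card (α := Equiv.Perm _), Fintype.card_perm, Fintype.card_fin] at h
  exact h

theorem factorial_mul_biPrunedHurwitz (hm : 0 < m) (hn : 0 < n) :
    ((2 * (branchCount g m n * ∑ i, μ i)).factorial : ℚ) * biPrunedHurwitz g μ ν
      = Nat.card {G : HurwitzGalaxy (Fin (2 * (branchCount g m n * ∑ i, μ i))) g μ ν //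
          G.IsBiPruned} := by
  have : Finite (Quotient (biPrunedSetoid g μ ν)) := Quotient.finite _
  have := Fintype.ofFinite (Quotient (biPrunedSetoid g μ ν))
  rw [biPrunedHurwitz, finsum_eq_sum_of_fintype, Finset.mul_sum,
    ← Nat.card_congr (Equiv.sigmaFiberEquiv (Quotient.mk (biPrunedSetoid g μ ν))),
    Nat.card_sigma, Nat.cast_sum]
  refine Finset.sum_congr rfl fun c _ => ?_
  induction c using Quotient.inductionOn with
  | h G =>
    have h := card_isoClass_mul_card_aut hm hn G
    have h0 : (Nat.card G.1.Aut : ℚ) ≠ 0 := by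
      have := HurwitzGalaxy.finite_iso G.1 G.1
      have : Nonempty G.1.Aut := ⟨.refl _⟩
      exact_mod_cast Nat.card_pos.ne'
    rw [← h]
    show _ * (1 / (Nat.card G.1.Aut : ℚ)) = _
    push_cast
    field_simp

end Labelled

end Hurwitz

namespace Hurwitz

set_option linter.unusedSectionVars false

/-! ### Suspensions of permutations -/

section Suspension

variable {A X Y : Type*} {ℓ : A → ℕ}

theorem sigma_fin_ext {x y : Σ a, Fin (ℓ a)} (h1 : x.1 = y.1) (h2 : (x.2 : ℕ) = y.2) : x = y := by
  obtain ⟨a, i⟩ := x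
  obtain ⟨b, j⟩ := y
  obtain rfl : a = b := h1
  exact congrArg (Sigma.mk a) (Fin.ext h2)

/-- The point at the bottom of the tower over `a`. -/
def towerBase (hℓ : ∀ a, 0 < ℓ a) (a : A) : Σ a, Fin (ℓ a) := ⟨a, 0, hℓ a⟩

/-- The point at the top of the tower over `a`. -/
def towerTop (hℓ : ∀ a, 0 < ℓ a) (a : A) : Σ a, Fin (ℓ a) := ⟨a, ℓ a - 1, Nat.sub_lt (hℓ a) one_pos⟩

/-- One step up in the tower over `a`, or from its top to the bottom of the tower over `π a`. -/
def suspFun (π : Equiv.Perm A) (hℓ : ∀ a, 0 < ℓ a) (x : Σ a, Fin (ℓ a)) : Σ a, Fin (ℓ a) :=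
  if h : x.2 + 1 < ℓ x.1 then ⟨x.1, x.2 + 1, h⟩ else towerBase hℓ (π x.1)

/-- One step down in the tower over `a`, or from its bottom to the top of the tower over `π⁻¹ a`. -/
def suspInv (π : Equiv.Perm A) (hℓ : ∀ a, 0 < ℓ a) (x : Σ a, Fin (ℓ a)) : Σ a, Fin (ℓ a) :=
  if (x.2 : ℕ) = 0 then towerTop hℓ (π.symm x.1)
    else ⟨x.1, x.2 - 1, (Nat.sub_le _ _).trans_lt x.2.2⟩

variable {π : Equiv.Perm A} {hℓ : ∀ a, 0 < ℓ a}

theorem suspFun_of_lt {x : Σ a, Fin (ℓ a)} (h : (x.2 : ℕ) + 1 < ℓ x.1) :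
    suspFun π hℓ x = ⟨x.1, x.2 + 1, h⟩ := dif_pos h

theorem suspFun_of_not_lt {x : Σ a, Fin (ℓ a)} (h : ¬ (x.2 : ℕ) + 1 < ℓ x.1) :
    suspFun π hℓ x = towerBase hℓ (π x.1) := dif_neg h

variable (π hℓ) in
/-- The suspension of the permutation `π` with heights `ℓ`. -/
def susp : Equiv.Perm (Σ a, Fin (ℓ a)) where
  toFun := suspFun π hℓ
  invFun := suspInv π hℓ
  left_inv x := by
    by_cases h : (x.2 : ℕ) + 1 < ℓ x.1
    · rw [suspFun_of_lt h]
      simp [suspInv]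
    · rw [suspFun_of_not_lt h]
      have h1 : suspInv π hℓ (towerBase hℓ (π x.1)) = towerTop hℓ (π.symm (π x.1)) := if_pos rfl
      rw [h1, Equiv.symm_apply_apply]
      refine sigma_fin_ext rfl ?_
      have := x.2.2
      show ℓ x.1 - 1 = x.2
      omega
  right_inv x := by
    have hx := x.2.2
    by_cases h : (x.2 : ℕ) = 0
    · have h1 : suspInv π hℓ x = towerTop hℓ (π.symm x.1) := if_pos h
      rw [h1, suspFun_of_not_lt]
      · refine sigma_fin_ext ?_ h.symm
        show π (π.symm x.1) = x.1
        simp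
      · show ¬ ℓ (π.symm x.1) - 1 + 1 < ℓ (π.symm x.1)
        omega
    · have h1 : suspInv π hℓ x = ⟨x.1, x.2 - 1, (Nat.sub_le _ _).trans_lt x.2.2⟩ := if_neg h
      rw [h1, suspFun_of_lt]
      · refine sigma_fin_ext rfl ?_
        show (x.2 : ℕ) - 1 + 1 = x.2
        omega
      · show (x.2 : ℕ) - 1 + 1 < ℓ x.1
        omega

theorem susp_of_lt {x : Σ a, Fin (ℓ a)} (h : (x.2 : ℕ) + 1 < ℓ x.1) :
    susp π hℓ x = ⟨x.1, x.2 + 1, h⟩ := dif_pos h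

theorem susp_of_not_lt {x : Σ a, Fin (ℓ a)} (h : ¬ (x.2 : ℕ) + 1 < ℓ x.1) :
    susp π hℓ x = towerBase hℓ (π x.1) := dif_neg h

theorem susp_towerTop (a : A) : susp π hℓ (towerTop hℓ a) = towerBase hℓ (π a) :=
  susp_of_not_lt (by
    show ¬ ℓ a - 1 + 1 < ℓ a
    omega)

/-- To prove a statement for all points of all towers, one goes up from the bottom. -/
theorem tower_induction (hℓ : ∀ a, 0 < ℓ a) {p : (Σ a, Fin (ℓ a)) → Prop}
    (base : ∀ a, p (towerBase hℓ a))
    (step : ∀ x (h : (x.2 : ℕ) + 1 < ℓ x.1), p x → p ⟨x.1, x.2 + 1, h⟩) (x) : p x := by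
  obtain ⟨a, j, hj⟩ := x
  induction j with
  | zero => exact base a
  | succ j ih => exact step ⟨a, j, by omega⟩ hj (ih _)

/-- An invariant predicate is constant on each tower, and its restriction to the bases is invariant
under π. -/
theorem ClassifiesOrbits.susp {f : A → Y} (h : ClassifiesOrbits π f) (hℓ : ∀ a, 0 < ℓ a) :
    ClassifiesOrbits (susp π hℓ) (fun x => f x.1) where
  map_eq x := by
    by_cases hx : (x.2 : ℕ) + 1 < ℓ x.1
    · rw [susp_of_lt hx]
    · rw [susp_of_not_lt hx]
      exact h.map_eq x.1
  imp p hp x y hxy hx := by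
    have h1 : ∀ x, p x ↔ p (towerBase hℓ x.1) :=
      tower_induction hℓ (fun a => Iff.rfl) fun x hx h => by
        rw [← susp_of_lt (π := π) (hℓ := hℓ) hx, hp, h, susp_of_lt hx]
    rw [h1] at hx ⊢
    refine h.imp (fun a => p (towerBase hℓ a)) (fun a => ?_) x.1 y.1 hxy hx
    rw [← susp_towerTop, hp, h1 (towerTop hℓ a)]
    rfl
  surjective y := by
    obtain ⟨a, rfl⟩ := h.surjective y
    exact ⟨towerBase hℓ a, rfl⟩

theorem card_tower_fiber [Fintype A] (p : A → Prop) [DecidablePred p] :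
    Nat.card {x : Σ a, Fin (ℓ a) // p x.1} = ∑ a with p a, ℓ a := by
  have e : {x : Σ a, Fin (ℓ a) // p x.1} ≃ Σ a : {a // p a}, Fin (ℓ a) :=
    { toFun := fun x => ⟨⟨x.1.1, x.2⟩, x.1.2⟩
      invFun := fun y => ⟨⟨y.1.1, y.2⟩, y.1.2⟩
      left_inv := fun x => rfl
      right_inv := fun y => rfl }
  rw [Nat.card_congr e, Nat.card_sigma]
  simp only [Nat.card_eq_fintype_card, Fintype.card_fin]
  rw [Finset.sum_subtype (p := p) (Finset.univ.filter p) (by simp)]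

/-- The first return map of `σ` to the range of `φ` exhibits the orbits of `σ` which meet this range
as a suspension. -/
theorem exists_susp [Finite X] (σ : Equiv.Perm X) {φ : A → X} [Finite A]
    (hφ : Function.Injective φ) :
    ∃ (π : Equiv.Perm A) (ℓ : A → ℕ) (hℓ : ∀ a, 0 < ℓ a) (ψ : (Σ a, Fin (ℓ a)) → X),
      Function.Injective ψ ∧ (∀ a, ψ (towerBase hℓ a) = φ a) ∧
      (∀ x, ψ (susp π hℓ x) = σ (ψ x)) ∧ ∀ a x, σ.SameCycle (φ a) x → x ∈ Set.range ψ := by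
  classical
  have hex : ∀ a, ∃ l, 0 < l ∧ ∃ a', (σ ^ l) (φ a) = φ a' := fun a => by
    obtain ⟨l, hl, h⟩ := (isOfFinOrder_iff_pow_eq_one.1 (isOfFinOrder_of_finite σ))
    exact ⟨l, hl, a, by rw [h]; rfl⟩
  choose f hf using fun a => (Nat.find_spec (hex a)).2
  -- The height of a tower is the first return time to the range of φ, which is finite since σ has
  -- finite order.
  set ℓ : A → ℕ := fun a => Nat.find (hex a) with hℓdef
  have hℓ : ∀ a, 0 < ℓ a := fun a => (Nat.find_spec (hex a)).1
  have hmin : ∀ a l, l < ℓ a → ∀ a', (σ ^ l) (φ a) = φ a' → l = 0 := by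
    intro a l hl a' h
    by_contra h0
    exact Nat.find_min (hex a) hl ⟨Nat.pos_of_ne_zero h0, a', h⟩
  -- Cancelling the common power of σ would produce a return to the range of φ before the first
  -- return, unless i = j. This gives injectivity both of ψ and of the return map.
  have hinj : ∀ a a' (i j : ℕ), i ≤ j → j - i < ℓ a' → (σ ^ i) (φ a) = (σ ^ j) (φ a') →
      a = a' ∧ i = j := by
    intro a a' i j hij hj h
    have h1 : φ a = (σ ^ (j - i)) (φ a') := by
      apply (σ ^ i).injective
      rw [h, ← Equiv.Perm.mul_apply, ← pow_add, Nat.add_sub_cancel' hij]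
    have h2 := hmin a' _ hj a h1.symm
    rw [h2] at h1
    exact ⟨hφ h1, by omega⟩
  have hfinj : Function.Injective f := by
    intro a a' h
    have h1 : (σ ^ ℓ a) (φ a) = (σ ^ ℓ a') (φ a') := by
      rw [hf a, hf a', h]
    have h2 := hℓ a
    have h3 := hℓ a'
    rcases le_total (ℓ a) (ℓ a') with hle | hle
    · exact (hinj a a' _ _ hle (by omega) h1).1
    · exact (hinj a' a _ _ hle (by omega) h1.symm).1.symm
  let π : Equiv.Perm A := Equiv.ofBijective f (Finite.injective_iff_bijective.1 hfinj)
  have hψ : ∀ x : Σ a, Fin (ℓ a),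
      (σ ^ ((susp π hℓ x).2 : ℕ)) (φ (susp π hℓ x).1) = σ ((σ ^ (x.2 : ℕ)) (φ x.1)) := by
    intro x
    have hs : σ ((σ ^ (x.2 : ℕ)) (φ x.1)) = (σ ^ ((x.2 : ℕ) + 1)) (φ x.1) := by
      rw [pow_succ', Equiv.Perm.mul_apply]
    rw [hs]
    by_cases h : (x.2 : ℕ) + 1 < ℓ x.1
    · rw [susp_of_lt h]
    · have : (x.2 : ℕ) + 1 = ℓ x.1 := by
        have := x.2.2
        omega
      rw [susp_of_not_lt h, this]
      exact (hf x.1).symm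
  refine ⟨π, ℓ, hℓ, fun x => (σ ^ (x.2 : ℕ)) (φ x.1), ?_, fun a => rfl, hψ, ?_⟩
  · rintro ⟨a, i⟩ ⟨a', j⟩ h
    have h2 := i.2
    have h3 := j.2
    rcases le_total (i : ℕ) j with hij | hij
    · obtain ⟨h1, h2⟩ := hinj a a' i j hij (by omega) h
      exact sigma_fin_ext h1 h2
    · obtain ⟨h1, h2⟩ := hinj a' a j i hij (by omega) h.symm
      exact sigma_fin_ext h1.symm h2.symm
  · intro a x hx
    obtain ⟨k, rfl⟩ := hx.exists_nat_pow_eq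
    induction k with
    | zero => exact ⟨towerBase hℓ a, rfl⟩
    | succ k ih =>
      obtain ⟨y, hy⟩ := ih ⟨k, by simp⟩
      refine ⟨susp π hℓ y, ?_⟩
      show (σ ^ ((susp π hℓ y).2 : ℕ)) (φ (susp π hℓ y).1) = _
      rw [hψ, pow_succ', Equiv.Perm.mul_apply, ← hy]

end Suspension

end Hurwitz

namespace Hurwitz

set_option linter.unusedSectionVars false

/-! ### Galaxies from permutations and edge lengths -/

section Double

variable {W : Type*}

/-- The reversal of darts, where the darts with a white face on their left are those with second
component `true`. -/
def doubleOpp (W : Type*) : Equiv.Perm (W × Bool) := (Equiv.refl W).prodCongr Equiv.boolNot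

/-- The rotation for which the white faces are walked along by `σ` and the black ones by `ρ⁻¹`. -/
def doubleRot (σ ρ : Equiv.Perm W) : Equiv.Perm (W × Bool) where
  toFun
    | (w, true) => (σ.symm w, false)
    | (w, false) => (ρ w, true)
  invFun
    | (w, true) => (ρ.symm w, false)
    | (w, false) => (σ w, true)
  left_inv := by rintro ⟨w, _ | _⟩ <;> simp
  right_inv := by rintro ⟨w, _ | _⟩ <;> simp

/-- The face walk preserves colours: it is σ on the white darts and ρ⁻¹ on the black ones. -/
theorem ClassifiesOrbits.double {I J : Type*} {σ ρ : Equiv.Perm W} {f : W → I} {h : W → J}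
    (hf : ClassifiesOrbits σ f) (hh : ClassifiesOrbits ρ h) :
    ClassifiesOrbits ((doubleRot σ ρ)⁻¹ * doubleOpp W)
      (fun x => if x.2 then Sum.inl (f x.1) else Sum.inr (h x.1)) where
  map_eq := by
    rintro ⟨w, _ | _⟩
    · show Sum.inr (h (ρ.symm w)) = Sum.inr (h w)
      rw [← hh.map_eq, Equiv.apply_symm_apply]
    · show Sum.inl (f (σ w)) = Sum.inl (f w)
      rw [hf.map_eq]
  imp p hp := by
    have h1 : ∀ w, p (σ w, true) ↔ p (w, true) := fun w => hp (w, true)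
    have h2 : ∀ w, p (ρ w, false) ↔ p (w, false) := fun w => by
      have h3 : p (ρ.symm (ρ w), false) ↔ p (ρ w, false) := hp (ρ w, false)
      rw [Equiv.symm_apply_apply] at h3
      exact h3.symm
    rintro ⟨w, _ | _⟩ ⟨w', _ | _⟩ hxy hx
    · exact hh.imp (fun w => p (w, false)) h2 w w' (by simpa using hxy) hx
    · simp at hxy
    · simp at hxy
    · exact hf.imp (fun w => p (w, true)) h1 w w' (by simpa using hxy) hx
  surjective := by
    rintro (i | j)
    · obtain ⟨w, rfl⟩ := hf.surjective i
      exact ⟨(w, true), rfl⟩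
    · obtain ⟨w, rfl⟩ := hh.surjective j
      exact ⟨(w, false), rfl⟩

end Double

/-! ### Skeletons, edge lengths and towers over the white corners -/

section Data

variable {b m n : ℕ}

/-- The permutation which exchanges the two white corners at each 4-valent vertex. -/
def cornerSwap (b : ℕ) : Equiv.Perm (Fin b × Bool) := (Equiv.refl _).prodCongr Equiv.boolNot

/-- The data of a bi-pruned galaxy without its edge lengths: the permutation `π` maps each white
corner at a 4-valent vertex to the next one along the boundary of the white face. -/
structure IsSkeleton (π : Equiv.Perm (Fin b × Bool)) (wl : Fin b × Bool → Fin m)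
    (bl : Fin b × Bool → Fin n) : Prop where
  white : ClassifiesOrbits π wl
  black : ClassifiesOrbits (cornerSwap b * π) bl
  connected : ∀ p : Fin m ⊕ Fin n → Prop, (∀ a, p (.inl (wl a)) ↔ p (.inr (bl a))) →
    ∀ u v, p u → p v
  white_pruned : ∀ i, ∃ a a', wl a = i ∧ wl a' = i ∧ a.1 ≠ a'.1
  black_pruned : ∀ j, ∃ a a', bl a = j ∧ bl a' = j ∧ (π a).1 ≠ (π a').1

/-- The possible edge lengths of a skeleton. -/
structure IsLength (π : Equiv.Perm (Fin b × Bool)) (wl : Fin b × Bool → Fin m)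
    (bl : Fin b × Bool → Fin n) (μ : Fin m → ℕ) (ν : Fin n → ℕ) (ℓ : Fin b × Bool → ℕ) :
    Prop where
  pos : ∀ a, 0 < ℓ a
  label : ∀ a, (finRotate b ^ ℓ a) a.1 = (π a).1
  white : ∀ i, ∑ a with wl a = i, ℓ a = μ i * b
  black : ∀ j, ∑ a with bl a = j, ℓ a = ν j * b

/-- The label of the vertex at a point of a tower. -/
def towerLabel {ℓ : Fin b × Bool → ℕ} (x : Σ a, Fin (ℓ a)) : Fin b :=
  (finRotate b ^ (x.2 : ℕ)) x.1.1

/-- The labels of the faces on the left of the darts. -/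
def towerFace {ℓ : Fin b × Bool → ℕ} (wl : Fin b × Bool → Fin m) (bl : Fin b × Bool → Fin n)
    (x : (Σ a, Fin (ℓ a)) × Bool) : Fin m ⊕ Fin n :=
  if x.2 then .inl (wl x.1.1) else .inr (bl x.1.1)

/-- The rotation by half a turn around the vertices. -/
def towerSwap {ℓ : Fin b × Bool → ℕ} (hℓ : ∀ a, 0 < ℓ a) (x : Σ a, Fin (ℓ a)) : Σ a, Fin (ℓ a) :=
  if (x.2 : ℕ) = 0 then towerBase hℓ (cornerSwap b x.1) else x

variable {π : Equiv.Perm (Fin b × Bool)} {wl : Fin b × Bool → Fin m} {bl : Fin b × Bool → Fin n}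
  {ℓ : Fin b × Bool → ℕ} {hℓ : ∀ a, 0 < ℓ a}

theorem towerSwap_towerBase (a : Fin b × Bool) :
    towerSwap hℓ (towerBase hℓ a) = towerBase hℓ (cornerSwap b a) := if_pos rfl

theorem towerSwap_of_ne {x : Σ a, Fin (ℓ a)} (h : (x.2 : ℕ) ≠ 0) : towerSwap hℓ x = x := if_neg h

theorem cornerSwap_ne (a : Fin b × Bool) : cornerSwap b a ≠ a := by
  obtain ⟨k, s⟩ := a
  cases s <;> simp [cornerSwap]

theorem eq_towerBase {x : Σ a, Fin (ℓ a)} (h : (x.2 : ℕ) = 0) : x = towerBase hℓ x.1 :=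
  sigma_fin_ext rfl h

theorem towerBase_injective : Function.Injective (towerBase hℓ) := fun _ _ h =>
  congrArg Sigma.fst h

theorem towerSwap_towerSwap (x : Σ a, Fin (ℓ a)) : towerSwap hℓ (towerSwap hℓ x) = x := by
  by_cases h : (x.2 : ℕ) = 0
  · rw [eq_towerBase (hℓ := hℓ) h, towerSwap_towerBase, towerSwap_towerBase]
    obtain ⟨⟨k, s⟩, j⟩ := x
    cases s <;> rfl
  · rw [towerSwap_of_ne h, towerSwap_of_ne h]

theorem towerSwap_ne_iff (x : Σ a, Fin (ℓ a)) : towerSwap hℓ x ≠ x ↔ (x.2 : ℕ) = 0 := by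
  by_cases h : (x.2 : ℕ) = 0
  · rw [eq_towerBase (hℓ := hℓ) h, towerSwap_towerBase]
    simp only [ne_eq, towerBase_injective.eq_iff, cornerSwap_ne, not_false_eq_true, true_iff]
    rfl
  · simp [towerSwap_of_ne h, h]

/-- The two suspensions differ only when stepping from a top to a base, where the exchange of
corners intervenes. Their discrepancy is the half turn around a vertex. -/
theorem susp_cornerSwap_mul (x : Σ a, Fin (ℓ a)) :
    susp (cornerSwap b * π) hℓ x = towerSwap hℓ (susp π hℓ x) := by
  by_cases h : (x.2 : ℕ) + 1 < ℓ x.1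
  · rw [susp_of_lt h, susp_of_lt h, towerSwap_of_ne (by simp)]
  · rw [susp_of_not_lt h, susp_of_not_lt h, towerSwap_towerBase]
    rfl

theorem towerLabel_towerSwap (x : Σ a, Fin (ℓ a)) :
    towerLabel (towerSwap hℓ x) = towerLabel x := by
  by_cases h : (x.2 : ℕ) = 0
  · rw [eq_towerBase (hℓ := hℓ) h, towerSwap_towerBase]
    rfl
  · rw [towerSwap_of_ne h]

/-- Labels increase by construction inside a tower; the congruence on its height is what makes them
fit at the top. -/
theorem towerLabel_susp (hlabel : ∀ a, (finRotate b ^ ℓ a) a.1 = (π a).1) (x : Σ a, Fin (ℓ a)) :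
    towerLabel (susp π hℓ x) = finRotate b (towerLabel x) := by
  have hs : finRotate b (towerLabel x) = (finRotate b ^ ((x.2 : ℕ) + 1)) x.1.1 := by
    rw [pow_succ', Equiv.Perm.mul_apply]
    rfl
  rw [hs]
  by_cases h : (x.2 : ℕ) + 1 < ℓ x.1
  · rw [susp_of_lt h]
    rfl
  · have : (x.2 : ℕ) + 1 = ℓ x.1 := by
      have := x.2.2
      omega
    rw [susp_of_not_lt h, this, hlabel]
    rfl

theorem card_towerFace_inl (i : Fin m) :
    Nat.card {x : (Σ a, Fin (ℓ a)) × Bool // towerFace wl bl x = .inl i}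
      = ∑ a with wl a = i, ℓ a := by
  rw [← card_tower_fiber]
  refine Nat.card_congr
    { toFun := fun x => ⟨x.1.1, ?_⟩
      invFun := fun x => ⟨(x.1, true), ?_⟩
      left_inv := ?_
      right_inv := fun x => rfl }
  · obtain ⟨⟨w, _ | _⟩, h⟩ := x
    · simp [towerFace] at h
    · simpa [towerFace] using h
  · simpa [towerFace] using x.2
  · rintro ⟨⟨w, _ | _⟩, h⟩
    · simp [towerFace] at h
    · rfl

theorem card_towerFace_inr (j : Fin n) :
    Nat.card {x : (Σ a, Fin (ℓ a)) × Bool // towerFace wl bl x = .inr j}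
      = ∑ a with bl a = j, ℓ a := by
  rw [← card_tower_fiber]
  refine Nat.card_congr
    { toFun := fun x => ⟨x.1.1, ?_⟩
      invFun := fun x => ⟨(x.1, false), ?_⟩
      left_inv := ?_
      right_inv := fun x => rfl }
  · obtain ⟨⟨w, _ | _⟩, h⟩ := x
    · simpa [towerFace] using h
    · simp [towerFace] at h
  · simpa [towerFace] using x.2
  · rintro ⟨⟨w, _ | _⟩, h⟩
    · rfl
    · simp [towerFace] at h

end Data

/-! ### The standard galaxy of a skeleton with edge lengths -/

section Standard

variable {g m n : ℕ} {π : Equiv.Perm (Fin (branchCount g m n) × Bool)}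
  {wl : Fin (branchCount g m n) × Bool → Fin m} {bl : Fin (branchCount g m n) × Bool → Fin n}
  {ℓ : Fin (branchCount g m n) × Bool → ℕ} {hℓ : ∀ a, 0 < ℓ a} {μ : Fin m → ℕ} {ν : Fin n → ℕ}

variable (π hℓ) in
/-- The rotation of the standard galaxy. -/
def towerRot : Equiv.Perm ((Σ a, Fin (ℓ a)) × Bool) :=
  doubleRot (susp π hℓ) (susp (cornerSwap _ * π) hℓ)

variable (π hℓ) in
/-- The labels of the tails of the darts of the standard galaxy. -/
def towerDartLabel (x : (Σ a, Fin (ℓ a)) × Bool) : Fin (branchCount g m n) :=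
  if x.2 then towerLabel x.1 else towerLabel (susp π hℓ x.1)

theorem towerRot_towerRot_true (x : Σ a, Fin (ℓ a)) :
    towerRot π hℓ (towerRot π hℓ (x, true)) = (towerSwap hℓ x, true) := by
  show (susp (cornerSwap _ * π) hℓ ((susp π hℓ).symm x), true) = _
  rw [susp_cornerSwap_mul, Equiv.apply_symm_apply]

theorem towerRot_towerRot_false (x : Σ a, Fin (ℓ a)) :
    towerRot π hℓ (towerRot π hℓ (x, false))
      = ((susp π hℓ).symm (towerSwap hℓ (susp π hℓ x)), false) := by
  show ((susp π hℓ).symm (susp (cornerSwap _ * π) hℓ x), false) = _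
  rw [susp_cornerSwap_mul]

theorem towerRot_ne_true (x : Σ a, Fin (ℓ a)) :
    towerRot π hℓ (towerRot π hℓ (x, true)) ≠ (x, true) ↔ (x.2 : ℕ) = 0 := by
  rw [towerRot_towerRot_true, ← towerSwap_ne_iff (hℓ := hℓ)]
  simp

theorem towerRot_ne_false (x : Σ a, Fin (ℓ a)) :
    towerRot π hℓ (towerRot π hℓ (x, false)) ≠ (x, false) ↔ ((susp π hℓ x).2 : ℕ) = 0 := by
  rw [towerRot_towerRot_false, ← towerSwap_ne_iff (hℓ := hℓ)]
  simp [Equiv.symm_apply_eq]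

/-- The darts at the 4-valent vertex k are the two white ones at the bases over (k, false) and (k,
true), and the two black ones whose reversals arrive at these bases. -/
theorem card_towerRot_ne (k : Fin (branchCount g m n)) :
    Nat.card {x : (Σ a, Fin (ℓ a)) × Bool // towerDartLabel π hℓ x = k ∧
      towerRot π hℓ (towerRot π hℓ x) ≠ x} = 4 := by
  have hb : Function.Bijective (fun y : Bool × Bool => (if y.2 then
      ⟨(towerBase hℓ (k, y.1), true), rfl, (towerRot_ne_true _).2 rfl⟩ else
      ⟨((susp π hℓ).symm (towerBase hℓ (k, y.1)), false), by
        show towerLabel (susp π hℓ ((susp π hℓ).symm _)) = k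
        rw [Equiv.apply_symm_apply]
        rfl, (towerRot_ne_false _).2 (by rw [Equiv.apply_symm_apply]; rfl)⟩ :
      {x : (Σ a, Fin (ℓ a)) × Bool // towerDartLabel π hℓ x = k ∧
        towerRot π hℓ (towerRot π hℓ x) ≠ x})) := by
    constructor
    · rintro ⟨s, _ | _⟩ ⟨s', _ | _⟩ h
      all_goals
        revert h
        simp [towerBase_injective.eq_iff]
    · rintro ⟨⟨x, _ | _⟩, hx, hx'⟩
      · rw [towerRot_ne_false] at hx'
        have h1 := eq_towerBase (hℓ := hℓ) hx'
        have h2 : (susp π hℓ x).1.1 = k := by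
          change towerLabel (susp π hℓ x) = k at hx
          rw [h1] at hx
          exact hx
        refine ⟨((susp π hℓ x).1.2, false), Subtype.ext (Prod.ext ?_ rfl)⟩
        show (susp π hℓ).symm (towerBase hℓ (k, (susp π hℓ x).1.2)) = x
        rw [Equiv.symm_apply_eq, ← h2]
        exact h1.symm
      · rw [towerRot_ne_true] at hx'
        have h1 := eq_towerBase (hℓ := hℓ) hx'
        have h2 : x.1.1 = k := by
          change towerLabel x = k at hx
          rw [h1] at hx
          exact hx
        refine ⟨(x.1.2, true), Subtype.ext (Prod.ext ?_ rfl)⟩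
        show towerBase hℓ (k, x.1.2) = x
        rw [← h2]
        exact h1.symm
  rw [← Nat.card_congr (Equiv.ofBijective _ hb)]
  simp

/-- The standard galaxy with a given skeleton and given edge lengths. -/
theorem isDartGalaxy_tower (h : IsSkeleton π wl bl) (hlen : IsLength π wl bl μ ν ℓ) :
    IsDartGalaxy (towerRot π hlen.pos) (doubleOpp _) (towerDartLabel π hlen.pos)
      (towerFace wl bl) μ ν where
  opp_opp := by rintro ⟨w, _ | _⟩ <;> rfl
  connected p hrot hopp := by
    have hfaces := (h.white.susp hlen.pos).double (h.black.susp hlen.pos)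
    have hnext : ∀ x, p (((towerRot π hlen.pos)⁻¹ * doubleOpp (Σ a, Fin (ℓ a)) : Equiv.Perm _) x) ↔ p x := by
      intro x
      rw [← hrot, ← hopp x, Equiv.Perm.mul_apply, ← Equiv.Perm.mul_apply, mul_inv_cancel,
        Equiv.Perm.one_apply]
    -- An invariant set of darts is a union of faces, and reversal identifies the two sides of each
    -- edge, so connectedness reduces to that of the bipartite graph of faces.
    have hiff : ∀ x, (∃ y, towerFace wl bl y = towerFace wl bl x ∧ p y) ↔ p x :=
      fun x => ⟨fun ⟨y, hy, hpy⟩ => hfaces.imp p hnext y x hy hpy, fun hx => ⟨x, rfl, hx⟩⟩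
    intro x y hx
    rw [← hiff] at hx ⊢
    refine h.connected (fun f => ∃ y, towerFace wl bl y = f ∧ p y) (fun a => ?_) _ _ hx
    refine (hiff (towerBase hlen.pos a, true)).trans
      (Iff.trans ?_ (hiff (towerBase hlen.pos a, false)).symm)
    exact (hopp _).symm
  vl_rot := by
    rintro ⟨w, _ | _⟩
    · show towerLabel (susp _ _ w) = towerLabel (susp _ _ w)
      rw [susp_cornerSwap_mul, towerLabel_towerSwap]
    · show towerLabel (susp _ _ ((susp _ _).symm w)) = towerLabel w
      rw [Equiv.apply_symm_apply]
  faces := (h.white.susp hlen.pos).double (h.black.susp hlen.pos)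
  bicoloured := by rintro ⟨w, _ | _⟩ <;> rfl
  white_card i := (card_towerFace_inl i).trans (hlen.white i)
  black_card j := (card_towerFace_inr j).trans (hlen.black j)
  cyclic := by
    rintro ⟨w, _ | _⟩ hw
    · simp [towerFace] at hw
    · exact towerLabel_susp hlen.label w
  rot_four := by
    rintro ⟨w, _ | _⟩
    · rw [towerRot_towerRot_false, towerRot_towerRot_false, Equiv.apply_symm_apply,
        towerSwap_towerSwap, Equiv.symm_apply_apply]
    · rw [towerRot_towerRot_true, towerRot_towerRot_true, towerSwap_towerSwap]
  card_four := card_towerRot_ne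

end Standard

end Hurwitz

namespace Hurwitz

set_option linter.unusedSectionVars false

/-! ### Framed galaxies -/

section Framed

variable {D : Type*} {g m n : ℕ} {μ : Fin m → ℕ} {ν : Fin n → ℕ}

/-- A framing of a galaxy numbers, at each 4-valent vertex, the two darts leaving it which have a
white face on their left. -/
structure IsFraming (G : HurwitzGalaxy D g μ ν) (φ : Fin (branchCount g m n) × Bool → D) :
    Prop where
  injective : Function.Injective φ
  isLeft : ∀ a, (G.leftLabel (φ a)).isLeft
  label : ∀ a, G.dartLabel (φ a) = a.1
  rot_ne : ∀ a, G.rot (G.rot (φ a)) ≠ φ a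

/-- The darts which leave the 4-valent vertex labelled `k` and have a white face on their left. -/
abbrev WhiteCorner (G : HurwitzGalaxy D g μ ν) (k : Fin (branchCount g m n)) : Type _ :=
  {x : D // (G.leftLabel x).isLeft = true ∧ G.dartLabel x = k ∧ G.rot (G.rot x) ≠ x}

variable [Finite D]

/-- Rotation exchanges the white and black corners at the vertex, so two of its four darts are
white. -/
theorem card_whiteCorner (G : HurwitzGalaxy D g μ ν) (k : Fin (branchCount g m n)) :
    Nat.card (WhiteCorner G k) = 2 := by
  classical
  have h := G.isDartGalaxy
  have h4 := h.card_four k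
  rw [← Nat.card_congr (Equiv.sumCompl
    fun x : {x : D // G.dartLabel x = k ∧ G.rot (G.rot x) ≠ x} => (G.leftLabel x.1).isLeft = true),
    Nat.card_sum] at h4
  have e1 : {x : {x : D // G.dartLabel x = k ∧ G.rot (G.rot x) ≠ x} //
      (G.leftLabel x.1).isLeft = true} ≃ WhiteCorner G k :=
    (Equiv.subtypeSubtypeEquivSubtypeInter _ (fun x => (G.leftLabel x).isLeft = true)).trans
      (Equiv.subtypeEquivRight fun x => and_comm)
  have e2 : {x : {x : D // G.dartLabel x = k ∧ G.rot (G.rot x) ≠ x} //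
      ¬ (G.leftLabel x.1).isLeft = true} ≃ WhiteCorner G k :=
    (Equiv.subtypeSubtypeEquivSubtypeInter _ (fun x => ¬ (G.leftLabel x).isLeft = true)).trans
      (G.rot.subtypeEquiv fun x => by
        rw [h.isLeft_rot, h.vl_rot, (G.rot).injective.ne_iff]
        simp [and_comm])
  rw [Nat.card_congr e1, Nat.card_congr e2] at h4
  omega

/-- A framing is the same as a numbering of each pair of white corners. -/
theorem card_framings (G : HurwitzGalaxy D g μ ν) :
    Nat.card {φ : Fin (branchCount g m n) × Bool → D // IsFraming G φ}
      = 2 ^ branchCount g m n := by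
  have hW := card_whiteCorner G
  have hb : Function.Bijective (fun f : ∀ k, Bool ≃ WhiteCorner G k =>
      (⟨fun a => (f a.1 a.2).1,
        { injective := by
            rintro ⟨k, s⟩ ⟨k', s'⟩ h
            have h1 := (f k s).2.2.1
            have h2 := (f k' s').2.2.1
            simp only at h
            rw [h, h2] at h1
            subst h1
            rw [(f k').injective (Subtype.ext h)]
          isLeft := fun a => (f a.1 a.2).2.1
          label := fun a => (f a.1 a.2).2.2.1
          rot_ne := fun a => (f a.1 a.2).2.2.2 }⟩ :
        {φ : Fin (branchCount g m n) × Bool → D // IsFraming G φ})) := by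
    constructor
    · intro f f' h
      ext k s
      exact congrFun (congrArg Subtype.val h) (k, s)
    · rintro ⟨φ, hφ⟩
      have hbij : ∀ k, Function.Bijective fun s : Bool =>
          (⟨φ (k, s), hφ.isLeft _, hφ.label _, hφ.rot_ne _⟩ : WhiteCorner G k) := fun k => by
        rw [Nat.bijective_iff_injective_and_card]
        refine ⟨fun s s' h => ?_, by rw [hW]; simp⟩
        exact congrArg Prod.snd (hφ.injective (congrArg Subtype.val h))
      exact ⟨fun k => Equiv.ofBijective _ (hbij k), rfl⟩
  rw [← Nat.card_congr (Equiv.ofBijective _ hb), Nat.card_pi]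
  have h2 : ∀ k, Nat.card (Bool ≃ WhiteCorner G k) = 2 := fun k => by
    obtain ⟨e⟩ := Finite.card_eq.1 ((Nat.card_eq_fintype_card (α := Bool)).trans (hW k).symm)
    rw [← Nat.card_congr (Equiv.equivCongr (Equiv.refl Bool) e), Nat.card_eq_fintype_card]
    decide
  simp [h2]

theorem IsFraming.exists_eq {G : HurwitzGalaxy D g μ ν} {φ : Fin (branchCount g m n) × Bool → D}
    (hφ : IsFraming G φ) {x : D} (h1 : (G.leftLabel x).isLeft = true)
    (h2 : G.rot (G.rot x) ≠ x) : ∃ s, φ (G.dartLabel x, s) = x := by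
  have hbij : Function.Bijective fun s : Bool => (⟨φ (G.dartLabel x, s), hφ.isLeft _, hφ.label _,
      hφ.rot_ne _⟩ : WhiteCorner G (G.dartLabel x)) := by
    rw [Nat.bijective_iff_injective_and_card]
    refine ⟨fun s s' h => ?_, by rw [card_whiteCorner]; simp⟩
    exact congrArg Prod.snd (hφ.injective (congrArg Subtype.val h))
  obtain ⟨s, hs⟩ := hbij.2 ⟨x, h1, rfl, h2⟩
  exact ⟨s, congrArg Subtype.val hs⟩

/-- The half turn preserves the pair of white corners at the vertex and fixes neither, hence
exchanges them. -/
theorem IsFraming.rot_rot {G : HurwitzGalaxy D g μ ν} {φ : Fin (branchCount g m n) × Bool → D}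
    (hφ : IsFraming G φ) (a : Fin (branchCount g m n) × Bool) :
    G.rot (G.rot (φ a)) = φ (cornerSwap _ a) := by
  have h := G.isDartGalaxy
  obtain ⟨s, hs⟩ := hφ.exists_eq (x := G.rot (G.rot (φ a)))
    (by rw [h.isLeft_rot, h.isLeft_rot, Bool.not_not, hφ.isLeft])
    (fun h' => hφ.rot_ne a (G.rot.injective (G.rot.injective h')))
  rw [h.vl_rot, h.vl_rot, hφ.label] at hs
  rw [← hs]
  congr 1
  obtain ⟨k, t⟩ := a
  have hne : s ≠ t := by
    rintro rfl
    exact hφ.rot_ne _ hs.symm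
  refine Prod.ext rfl ?_
  show s = !t
  revert hne
  cases s <;> cases t <;> simp

/-! ### Coordinates on framed galaxies -/

/-- A skeleton with labelled faces and edge lengths. -/
structure GalaxyData (b m n : ℕ) where
  perm : Equiv.Perm (Fin b × Bool)
  white : Fin b × Bool → Fin m
  black : Fin b × Bool → Fin n
  length : Fin b × Bool → ℕ

/-- The data come from a galaxy of type `(μ, ν)`. -/
structure GalaxyData.IsValid {b : ℕ} (q : GalaxyData b m n) (μ : Fin m → ℕ) (ν : Fin n → ℕ) :
    Prop where
  skeleton : IsSkeleton q.perm q.white q.black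
  lengths : IsLength q.perm q.white q.black μ ν q.length

/-- The framed galaxy `(G, φ)` is identified by `e` with the standard galaxy given by `q`. -/
structure IsCoordinates (G : HurwitzGalaxy D g μ ν) (φ : Fin (branchCount g m n) × Bool → D)
    (q : GalaxyData (branchCount g m n) m n) (hℓ : ∀ a, 0 < q.length a)
    (e : (Σ a, Fin (q.length a)) × Bool ≃ D) : Prop where
  opp : ∀ w s, G.opp (e (w, s)) = e (w, !s)
  next_true : ∀ w, G.next (e (w, true)) = e (susp q.perm hℓ w, true)
  next_false : ∀ w, G.next (e (susp (cornerSwap _ * q.perm) hℓ w, false)) = e (w, false)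
  left_true : ∀ w, G.leftLabel (e (w, true)) = .inl (q.white w.1)
  left_false : ∀ w, G.leftLabel (e (w, false)) = .inr (q.black w.1)
  label : ∀ w, G.dartLabel (e (w, true)) = towerLabel w
  frame : ∀ a, φ a = e (towerBase hℓ a, true)

theorem HurwitzGalaxy.rot_next (G : HurwitzGalaxy D g μ ν) (x : D) : G.rot (G.next x) = G.opp x := by
  show G.rot (G.rot⁻¹ (G.opp x)) = _
  rw [← Equiv.Perm.mul_apply, mul_inv_cancel, Equiv.Perm.one_apply]

theorem HurwitzGalaxy.rot_eq_of_next_eq {G H : HurwitzGalaxy D g μ ν}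
    (h1 : ∀ x, G.opp x = H.opp x) (h2 : ∀ x, G.next x = H.next x) (x : D) : G.rot x = H.rot x := by
  obtain ⟨y, rfl⟩ := G.next.surjective x
  rw [G.rot_next, h2, H.rot_next, h1]

theorem IsCoordinates.unique_galaxy {G G' : HurwitzGalaxy D g μ ν}
    {φ φ' : Fin (branchCount g m n) × Bool → D} {q : GalaxyData (branchCount g m n) m n}
    {hℓ : ∀ a, 0 < q.length a} {e : (Σ a, Fin (q.length a)) × Bool ≃ D}
    (h : IsCoordinates G φ q hℓ e) (h' : IsCoordinates G' φ' q hℓ e) : G = G' ∧ φ = φ' := by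
  have hopp : ∀ x, G.opp x = G'.opp x := by
    rw [← e.forall_congr_right]
    rintro ⟨w, s⟩
    rw [h.opp, h'.opp]
  have hnext : ∀ x, G.next x = G'.next x := by
    rw [← e.forall_congr_right]
    rintro ⟨w, _ | _⟩
    · obtain ⟨w, rfl⟩ := (susp (cornerSwap _ * q.perm) hℓ).surjective w
      rw [h.next_false, h'.next_false]
    · rw [h.next_true, h'.next_true]
  refine ⟨HurwitzGalaxy.ext_darts (HurwitzGalaxy.rot_eq_of_next_eq hopp hnext) hopp ?_ ?_, ?_⟩
  · have key : ∀ {G : HurwitzGalaxy D g μ ν} {φ : Fin (branchCount g m n) × Bool → D},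
        IsCoordinates G φ q hℓ e → ∀ w, G.dartLabel (e (w, false)) = towerLabel (susp q.perm hℓ w) := by
      intro G φ h w
      rw [← h.label, ← h.next_true, ← G.isDartGalaxy.vl_rot (G.next _), G.rot_next,
        h.opp]
      rfl
    rw [← e.forall_congr_right]
    rintro ⟨w, _ | _⟩
    · rw [key h, key h']
    · rw [h.label, h'.label]
  · rw [← e.forall_congr_right]
    rintro ⟨w, _ | _⟩
    · rw [h.left_false, h'.left_false]
    · rw [h.left_true, h'.left_true]
  · ext a
    rw [h.frame, h'.frame]

theorem IsCoordinates.next_pow {G : HurwitzGalaxy D g μ ν}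
    {φ : Fin (branchCount g m n) × Bool → D} {q : GalaxyData (branchCount g m n) m n}
    {hℓ : ∀ a, 0 < q.length a} {e : (Σ a, Fin (q.length a)) × Bool ≃ D}
    (h : IsCoordinates G φ q hℓ e) : ∀ w, e (w, true) = (G.next ^ (w.2 : ℕ)) (φ w.1) := by
  refine tower_induction hℓ (fun a => (h.frame a).symm) fun w hw ih => ?_
  rw [pow_succ', Equiv.Perm.mul_apply, ← ih, h.next_true, susp_of_lt hw]

theorem IsCoordinates.next_length {G : HurwitzGalaxy D g μ ν}
    {φ : Fin (branchCount g m n) × Bool → D} {q : GalaxyData (branchCount g m n) m n}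
    {hℓ : ∀ a, 0 < q.length a} {e : (Σ a, Fin (q.length a)) × Bool ≃ D}
    (h : IsCoordinates G φ q hℓ e) (a : Fin (branchCount g m n) × Bool) :
    (G.next ^ q.length a) (φ a) = φ (q.perm a) := by
  have h1 := h.next_pow (towerTop hℓ a)
  have h2 : (towerTop hℓ a).2 + 1 = q.length a := Nat.sub_add_cancel (hℓ a)
  rw [← h2, pow_succ', Equiv.Perm.mul_apply]
  refine (congrArg G.next h1.symm).trans ?_
  rw [h.next_true, susp_towerTop, h.frame]

/-- In either coordinate system the walk from `φ a` is back at a framed corner after its length. A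
smaller length in q' would put a base strictly inside a tower of q. -/
theorem IsCoordinates.length_le {G : HurwitzGalaxy D g μ ν}
    {φ : Fin (branchCount g m n) × Bool → D} {q q' : GalaxyData (branchCount g m n) m n}
    {hℓ : ∀ a, 0 < q.length a} {e : (Σ a, Fin (q.length a)) × Bool ≃ D}
    (h : IsCoordinates G φ q hℓ e)
    {hℓ' : ∀ a, 0 < q'.length a} {e' : (Σ a, Fin (q'.length a)) × Bool ≃ D}
    (h' : IsCoordinates G φ q' hℓ' e') (a : Fin (branchCount g m n) × Bool) :
    q.length a ≤ q'.length a := by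
  by_contra hlt
  rw [not_le] at hlt
  have h1 := h.next_pow ⟨a, q'.length a, hlt⟩
  have h2 := h1.trans (h'.next_length a)
  rw [h.frame] at h2
  have h3 := congrArg Prod.fst (e.injective h2)
  have h4 : q'.length a = 0 := by
    have h5 := congrArg (fun w : Σ a, Fin (q.length a) => (w.2 : ℕ)) h3
    exact h5
  exact (hℓ' a).ne' h4

/-- The framed galaxy determines the lengths as first return times, then π as the return map and the
labels by reading them off the framed corners. Finally e is determined by walking from those corners
and reversing. -/
theorem IsCoordinates.unique_data {G : HurwitzGalaxy D g μ ν}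
    {φ : Fin (branchCount g m n) × Bool → D} (hφ : Function.Injective φ)
    {q q' : GalaxyData (branchCount g m n) m n}
    {hℓ : ∀ a, 0 < q.length a} {e : (Σ a, Fin (q.length a)) × Bool ≃ D}
    (h : IsCoordinates G φ q hℓ e)
    {hℓ' : ∀ a, 0 < q'.length a} {e' : (Σ a, Fin (q'.length a)) × Bool ≃ D}
    (h' : IsCoordinates G φ q' hℓ' e') : q = q' ∧ HEq e e' := by
  have hlen : q.length = q'.length := funext fun a => (h.length_le h' a).antisymm (h'.length_le h a)
  have hperm : q.perm = q'.perm := Equiv.ext fun a => hφ (by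
    rw [← h.next_length, ← h'.next_length, hlen])
  have hwhite : q.white = q'.white := funext fun a => by
    have h1 := h.left_true (towerBase hℓ a)
    have h2 := h'.left_true (towerBase hℓ' a)
    rw [← h.frame] at h1
    rw [← h'.frame, h1] at h2
    exact Sum.inl.inj h2
  have hblack : q.black = q'.black := funext fun a => by
    have h1 := h.left_false (towerBase hℓ a)
    have h2 := h'.left_false (towerBase hℓ' a)
    have h3 := h.opp (towerBase hℓ a) true
    have h4 := h'.opp (towerBase hℓ' a) true
    rw [← h.frame] at h3
    rw [← h'.frame, h3] at h4
    exact Sum.inr.inj (h1.symm.trans ((congrArg G.leftLabel h4).trans h2))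
  obtain ⟨π, wl, bl, ℓ⟩ := q
  obtain ⟨π', wl', bl', ℓ'⟩ := q'
  obtain rfl : π = π' := hperm
  obtain rfl : wl = wl' := hwhite
  obtain rfl : bl = bl' := hblack
  obtain rfl : ℓ = ℓ' := hlen
  refine ⟨rfl, heq_of_eq (Equiv.ext ?_)⟩
  have htrue : ∀ w, e (w, true) = e' (w, true) := fun w => by rw [h.next_pow, h'.next_pow]
  rintro ⟨w, _ | _⟩
  · have h1 := h.opp w true
    have h2 := h'.opp w true
    rw [htrue] at h1
    exact h1.symm.trans h2
  · exact htrue w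

/-- Each skeleton with edge lengths comes from a galaxy. -/
theorem exists_galaxy_of_data (hm : 0 < m) (hn : 0 < n) {q : GalaxyData (branchCount g m n) m n}
    (hq : q.IsValid μ ν) (e : (Σ a, Fin (q.length a)) × Bool ≃ D) :
    ∃ (G : HurwitzGalaxy D g μ ν) (φ : _), G.IsBiPruned ∧ IsFraming G φ ∧
      IsCoordinates G φ q hq.lengths.pos e := by
  have h := (isDartGalaxy_tower hq.skeleton hq.lengths).conj e
  set G := h.galaxy hm hn with hG
  have hrot : ∀ x, G.rot (e x) = e (towerRot q.perm hq.lengths.pos x) := fun x => by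
    show e (towerRot q.perm hq.lengths.pos (e.symm (e x))) = _
    rw [Equiv.symm_apply_apply]
  have hopp : ∀ x, G.opp (e x) = e (doubleOpp _ x) := fun x => by
    show e (doubleOpp _ (e.symm (e x))) = _
    rw [Equiv.symm_apply_apply]
  have hnext : ∀ x, G.next (e x)
      = e (((towerRot q.perm hq.lengths.pos)⁻¹ * doubleOpp _ : Equiv.Perm _) x) := fun x => by
    apply G.rot.injective
    rw [G.rot_next, hopp, hrot, ← Equiv.Perm.mul_apply, mul_inv_cancel_left]
  have hlabel : ∀ x, G.dartLabel (e x) = towerDartLabel q.perm hq.lengths.pos x := fun x => by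
    show towerDartLabel q.perm hq.lengths.pos (e.symm (e x)) = _
    rw [Equiv.symm_apply_apply]
  have hleft : ∀ x, G.leftLabel (e x) = towerFace q.white q.black x := fun x => by
    show towerFace q.white q.black (e.symm (e x)) = _
    rw [Equiv.symm_apply_apply]
  have hne : ∀ x, G.rot (G.rot (e x)) ≠ e x ↔
      towerRot q.perm hq.lengths.pos (towerRot q.perm hq.lengths.pos x) ≠ x := fun x => by
    rw [hrot, hrot, e.injective.ne_iff]
  refine ⟨G, fun a => e (towerBase hq.lengths.pos a, true), ?_, ?_, ?_⟩
  · rw [HurwitzGalaxy.isBiPruned_iff]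
    rintro (i | j)
    · obtain ⟨a, a', rfl, ha', hne'⟩ := hq.skeleton.white_pruned i
      refine ⟨e (towerBase hq.lengths.pos a, true), e (towerBase hq.lengths.pos a', true),
        hleft _, (hleft _).trans (congrArg Sum.inl ha'), ?_, ?_, ?_⟩
      · rw [hne, towerRot_ne_true]
        rfl
      · rw [hne, towerRot_ne_true]
        rfl
      · rw [hlabel, hlabel]
        exact hne'
    · obtain ⟨a, a', rfl, ha', hne'⟩ := hq.skeleton.black_pruned j
      refine ⟨e (towerTop hq.lengths.pos a, false), e (towerTop hq.lengths.pos a', false),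
        hleft _, (hleft _).trans (congrArg Sum.inr ha'), ?_, ?_, ?_⟩
      · rw [hne, towerRot_ne_false, susp_towerTop]
        rfl
      · rw [hne, towerRot_ne_false, susp_towerTop]
        rfl
      · rw [hlabel, hlabel]
        show towerLabel (susp _ _ _) ≠ towerLabel (susp _ _ _)
        rw [susp_towerTop, susp_towerTop]
        exact hne'
  · exact
      { injective := fun a a' h => towerBase_injective (congrArg Prod.fst (e.injective h))
        isLeft := fun a => by rw [hleft]; rfl
        label := fun a => by rw [hlabel]; rfl
        rot_ne := fun a => by
          rw [hne, towerRot_ne_true]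
          rfl }
  · exact
      { opp := fun w s => hopp (w, s)
        next_true := fun w => hnext (w, true)
        next_false := fun w => by
          rw [hnext]
          show e ((susp (cornerSwap _ * q.perm) _).symm (Equiv.refl _ (susp _ _ w)), false) = _
          rw [Equiv.refl_apply, Equiv.symm_apply_apply]
        left_true := fun w => hleft _
        left_false := fun w => hleft _
        label := fun w => hlabel _
        frame := fun a => rfl }

end Framed

end Hurwitz

namespace Hurwitz

set_option linter.unusedSectionVars false

/-! ### Framed galaxies correspond to skeletons with edge lengths -/

section Count

variable {D : Type*} [Finite D] {g m n : ℕ} {μ : Fin m → ℕ} {ν : Fin n → ℕ}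

/-- The white corners of a framed bi-pruned galaxy meet all its white faces. -/
theorem IsFraming.exists_sameCycle {G : HurwitzGalaxy D g μ ν} (hG : G.IsBiPruned)
    {φ : Fin (branchCount g m n) × Bool → D} (hφ : IsFraming G φ) {x : D}
    (hx : (G.leftLabel x).isLeft = true) : ∃ a, G.next.SameCycle (φ a) x := by
  rw [HurwitzGalaxy.isBiPruned_iff] at hG
  obtain ⟨y, -, hy, -, hy', -⟩ := hG (G.leftLabel x)
  obtain ⟨s, hs⟩ := hφ.exists_eq (by rw [hy, hx]) hy'
  exact ⟨_, (G.isDartGalaxy.faces.eq_iff _ _).1 (by rw [hs, hy])⟩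

/-- Each framed bi-pruned galaxy has coordinates. -/
theorem exists_data_of_galaxy {G : HurwitzGalaxy D g μ ν} (hG : G.IsBiPruned)
    {φ : Fin (branchCount g m n) × Bool → D} (hφ : IsFraming G φ) :
    ∃ (q : GalaxyData (branchCount g m n) m n) (hq : q.IsValid μ ν)
      (e : (Σ a, Fin (q.length a)) × Bool ≃ D), IsCoordinates G φ q hq.lengths.pos e := by
  have hD := G.isDartGalaxy
  obtain ⟨π, ℓ, hℓ, ψ, hψ, hbase, hsusp, hrange⟩ := exists_susp G.next hφ.injective
  have hnl : ∀ x, G.leftLabel (G.next x) = G.leftLabel x := hD.faces.map_eq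
  have hwhite : ∀ w, G.leftLabel (ψ w) = G.leftLabel (φ w.1) :=
    tower_induction hℓ (fun a => by rw [hbase]; rfl) fun w hw ih => by
      rw [← susp_of_lt (π := π) (hℓ := hℓ) hw, hsusp, hnl, ih, susp_of_lt hw]
  have hisLeft : ∀ w, (G.leftLabel (ψ w)).isLeft = true := fun w => by
    rw [hwhite, hφ.isLeft]
  -- Every white dart at a 4-valent vertex is framed, hence is a tower base; all other white darts
  -- leave 2-valent vertices.
  have hswap : ∀ w, G.rot (G.rot (ψ w)) = ψ (towerSwap hℓ w) := by
    intro w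
    by_cases hw : (w.2 : ℕ) = 0
    · rw [eq_towerBase (hℓ := hℓ) hw, towerSwap_towerBase, hbase, hbase, hφ.rot_rot]
    · rw [towerSwap_of_ne hw]
      by_contra hne
      obtain ⟨s, hs⟩ := hφ.exists_eq (hisLeft w) hne
      rw [← hbase] at hs
      exact hw (by rw [← hψ hs]; rfl)
  let f : (Σ a, Fin (ℓ a)) × Bool → D := fun x => if x.2 then ψ x.1 else G.opp (ψ x.1)
  have hf : Function.Bijective f := by
    constructor
    · rintro ⟨w, _ | _⟩ ⟨w', _ | _⟩ h
      · exact Prod.ext (hψ (G.opp.injective h)) rfl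
      · have h1 := congrArg (fun x => (G.leftLabel x).isLeft) h
        simp [f, hD.bicoloured, hisLeft] at h1
      · have h1 := congrArg (fun x => (G.leftLabel x).isLeft) h
        simp [f, hD.bicoloured, hisLeft] at h1
      · exact Prod.ext (hψ h) rfl
    · intro x
      by_cases hx : (G.leftLabel x).isLeft = true
      · obtain ⟨a, ha⟩ := hφ.exists_sameCycle hG hx
        obtain ⟨w, rfl⟩ := hrange a x ha
        exact ⟨(w, true), rfl⟩
      · have hx' : (G.leftLabel (G.opp x)).isLeft = true := by
          rw [hD.bicoloured]
          simpa using hx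
        obtain ⟨a, ha⟩ := hφ.exists_sameCycle hG hx'
        obtain ⟨w, hw⟩ := hrange a _ ha
        refine ⟨(w, false), ?_⟩
        show G.opp (ψ w) = x
        rw [hw, G.opp_opp]
  let e : (Σ a, Fin (ℓ a)) × Bool ≃ D := Equiv.ofBijective f hf
  have het : ∀ w, e (w, true) = ψ w := fun w => rfl
  have hef : ∀ w, e (w, false) = G.opp (ψ w) := fun w => rfl
  have hnf : ∀ w, G.next (e (susp (cornerSwap _ * π) hℓ w, false)) = e (w, false) := fun w => by
    apply G.rot.injective
    rw [G.rot_next, hef, hef, G.opp_opp, susp_cornerSwap_mul, ← hswap, hsusp, G.rot_next]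
  choose wl hwl using fun a => Sum.isLeft_iff.1 (hφ.isLeft a)
  have hblack : ∀ a, (G.leftLabel (G.opp (φ a))).isRight := fun a => by
    rw [← Sum.not_isLeft, hD.bicoloured, hφ.isLeft]
    simp
  choose bl hbl using fun a => Sum.isRight_iff.1 (hblack a)
  have hlt : ∀ w, G.leftLabel (e (w, true)) = .inl (wl w.1) := fun w => by
    rw [het, hwhite, hwl]
  have hlf : ∀ w, G.leftLabel (e (w, false)) = .inr (bl w.1) :=
    tower_induction hℓ (fun a => by rw [hef, hbase, hbl]; rfl) fun w hw ih => by
      rw [← hnf, hnl, susp_of_lt hw] at ih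
      exact ih
  have hface : ∀ x, G.leftLabel (e x) = towerFace wl bl x := by
    rintro ⟨w, _ | _⟩
    · exact hlf w
    · exact hlt w
  have hlabel : ∀ w, G.dartLabel (e (w, true)) = towerLabel w := by
    refine tower_induction hℓ (fun a => by rw [het, hbase, hφ.label]; rfl) fun w hw ih => ?_
    rw [het] at ih ⊢
    rw [← susp_of_lt (π := π) (hℓ := hℓ) hw, hsusp, susp_of_lt hw]
    refine (hD.cyclic _ (hisLeft w)).trans ?_
    rw [ih]
    show _ = (finRotate _ ^ ((w.2 : ℕ) + 1)) w.1.1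
    rw [pow_succ', Equiv.Perm.mul_apply]
    rfl
  have hnext_base : ∀ a, G.next (e (towerTop hℓ a, true)) = e (towerBase hℓ (π a), true) := fun a => by
    rw [het, het, ← hsusp, susp_towerTop]
  have hnext_basef : ∀ a, G.next (e (towerBase hℓ (cornerSwap _ (π a)), false))
      = e (towerTop hℓ a, false) := fun a => by
    rw [← hnf (towerTop hℓ a), susp_towerTop]
    rfl
  have hlen : IsLength π wl bl μ ν ℓ :=
    { pos := hℓ
      label := fun a => by
        have h1 := hlabel (towerBase hℓ (π a))
        rw [← hnext_base] at h1
        have h2 := hD.cyclic (e (towerTop hℓ a, true)) (hisLeft _)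
        have h3 := h2.symm.trans h1
        rw [hlabel] at h3
        have h4 : ℓ a = (ℓ a - 1) + 1 := (Nat.sub_add_cancel (hℓ a)).symm
        rw [h4, pow_succ', Equiv.Perm.mul_apply]
        exact h3
      white := fun i => by
        rw [← card_towerFace_inl (bl := bl), ← hD.white_card i]
        exact Nat.card_congr (e.subtypeEquiv fun x => by rw [hface])
      black := fun j => by
        rw [← card_towerFace_inr (wl := wl), ← hD.black_card j]
        exact Nat.card_congr (e.subtypeEquiv fun x => by rw [hface]) }
  have hskel : IsSkeleton π wl bl :=
    { white :=
        { map_eq := fun a => by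
            have h1 := hlt (towerBase hℓ (π a))
            rw [← hnext_base, hnl, hlt] at h1
            exact (Sum.inl.inj h1).symm
          imp := fun p hp a a' haa' ha => by
            -- A predicate on corners is spread over the towers and made vacuous on black darts,
            -- which turns invariance under π into invariance under the face walk. The black faces
            -- are treated below with the colours exchanged.
            have h1 := hD.faces.imp (fun x => (e.symm x).2 = true → p (e.symm x).1.1) (by
              rw [← e.forall_congr_right]
              rintro ⟨w, _ | _⟩
              · obtain ⟨w, rfl⟩ := (susp (cornerSwap _ * π) hℓ).surjective w
                have := hnf w
                change (G.rot⁻¹ * G.opp) _ = _ at this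
                simp [this]
              · have : (G.rot⁻¹ * G.opp) (e (w, true)) = e (susp π hℓ w, true) := (hsusp w).symm
                rw [this]
                simp only [Equiv.symm_apply_apply, forall_true_left]
                by_cases h : (w.2 : ℕ) + 1 < ℓ w.1
                · rw [susp_of_lt h]
                · rw [susp_of_not_lt h]
                  exact hp w.1) (e (towerBase hℓ a, true)) (e (towerBase hℓ a', true))
              ((hlt _).trans ((congrArg Sum.inl haa').trans (hlt (towerBase hℓ a')).symm)) (by
                intro _
                rw [Equiv.symm_apply_apply]
                exact ha)
            simp only [Equiv.symm_apply_apply, forall_true_left] at h1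
            exact h1
          surjective := fun i => by
            obtain ⟨x, hx⟩ := hD.faces.surjective (.inl i)
            obtain ⟨⟨w, _ | _⟩, rfl⟩ := e.surjective x
            · rw [hlf] at hx
              simp at hx
            · rw [hlt] at hx
              exact ⟨_, Sum.inl.inj hx⟩ }
      black :=
        { map_eq := fun a => by
            have h1 := hlf (towerTop hℓ a)
            rw [← hnext_basef, hnl, hlf] at h1
            exact Sum.inr.inj h1
          imp := fun p hp a a' haa' ha => by
            have h1 := hD.faces.imp (fun x => (e.symm x).2 = false → p (e.symm x).1.1) (by
              rw [← e.forall_congr_right]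
              rintro ⟨w, _ | _⟩
              · obtain ⟨w, rfl⟩ := (susp (cornerSwap _ * π) hℓ).surjective w
                have := hnf w
                change (G.rot⁻¹ * G.opp) _ = _ at this
                rw [this]
                simp only [Equiv.symm_apply_apply, forall_true_left]
                by_cases h : (w.2 : ℕ) + 1 < ℓ w.1
                · rw [susp_of_lt h]
                · rw [susp_of_not_lt h]
                  exact (hp w.1).symm
              · have : (G.rot⁻¹ * G.opp) (e (w, true)) = e (susp π hℓ w, true) := (hsusp w).symm
                simp [this]) (e (towerBase hℓ a, false)) (e (towerBase hℓ a', false))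
              ((hlf _).trans ((congrArg Sum.inr haa').trans (hlf (towerBase hℓ a')).symm)) (by
                intro _
                rw [Equiv.symm_apply_apply]
                exact ha)
            simp only [Equiv.symm_apply_apply, forall_true_left] at h1
            exact h1
          surjective := fun j => by
            obtain ⟨x, hx⟩ := hD.faces.surjective (.inr j)
            obtain ⟨⟨w, _ | _⟩, rfl⟩ := e.surjective x
            · rw [hlf] at hx
              exact ⟨_, Sum.inr.inj hx⟩
            · rw [hlt] at hx
              simp at hx }
      connected := fun p hp u v hu => by
        obtain ⟨x, rfl⟩ := hD.faces.surjective u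
        obtain ⟨y, rfl⟩ := hD.faces.surjective v
        have hopp : ∀ x, p (G.leftLabel (G.opp x)) ↔ p (G.leftLabel x) := by
          rw [← e.forall_congr_right]
          rintro ⟨w, _ | _⟩
          · rw [hlf, hef, G.opp_opp, ← het, hlt, hp]
          · rw [hlt, het, ← hef, hlf, hp]
        refine hD.connected (fun x => p (G.leftLabel x)) ?_ hopp x y hu
        intro x
        obtain ⟨y, rfl⟩ := G.next.surjective x
        rw [G.rot_next, hopp, hnl]
      white_pruned := fun i => by
        obtain ⟨x, y, hx, hy, hx', hy', hne⟩ := G.isBiPruned_iff.1 hG (.inl i)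
        obtain ⟨s, hs⟩ := hφ.exists_eq (by rw [hx]; rfl) hx'
        obtain ⟨t, ht⟩ := hφ.exists_eq (by rw [hy]; rfl) hy'
        refine ⟨(G.dartLabel x, s), (G.dartLabel y, t), Sum.inl.inj ((hwl _).symm.trans ?_),
          Sum.inl.inj ((hwl _).symm.trans ?_), hne⟩
        · rw [hs, hx]
        · rw [ht, hy]
      black_pruned := fun j => by
        -- Rotating a black corner at a 4-valent vertex gives a framed white corner, a tower base.
        -- The dart therefore lies at the top of its tower, and its tail has the label of π of that
        -- tower.
        have key : ∀ x, G.leftLabel x = .inr j → G.rot (G.rot x) ≠ x →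
            ∃ a, bl a = j ∧ (π a).1 = G.dartLabel x := by
          intro x hx hx'
          obtain ⟨⟨w, _ | _⟩, rfl⟩ := e.surjective x
          · have h1 : G.rot (e (w, false)) = ψ (susp (cornerSwap _ * π) hℓ w) := by
              rw [← hnf, G.rot_next, hef, G.opp_opp]
            have hl : G.dartLabel (e (w, false))
                = G.dartLabel (ψ (susp (cornerSwap _ * π) hℓ w)) := by
              rw [← h1, hD.vl_rot]
            obtain ⟨s, hs⟩ := hφ.exists_eq (hisLeft (susp (cornerSwap _ * π) hℓ w)) (by
              rw [← h1]
              exact fun h => hx' (G.rot.injective h))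
            rw [← hbase] at hs
            have hs' := hψ hs
            have hw : ¬ (w.2 : ℕ) + 1 < ℓ w.1 := fun hw => by
              rw [susp_of_lt hw] at hs'
              have := congrArg (fun w : Σ a, Fin (ℓ a) => (w.2 : ℕ)) hs'
              exact absurd this.symm (Nat.succ_ne_zero _)
            rw [hlf] at hx
            refine ⟨w.1, Sum.inr.inj hx, ?_⟩
            rw [hl, susp_of_not_lt hw, hbase, hφ.label]
            rfl
          · rw [hlt] at hx
            simp at hx
        obtain ⟨x, y, hx, hy, hx', hy', hne⟩ := G.isBiPruned_iff.1 hG (.inr j)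
        obtain ⟨a, ha, hax⟩ := key x hx hx'
        obtain ⟨a', ha', hay⟩ := key y hy hy'
        exact ⟨a, a', ha, ha', by rw [hax, hay]; exact hne⟩ }
  refine ⟨⟨π, wl, bl, ℓ⟩, ⟨hskel, hlen⟩, e, ?_⟩
  exact
    { opp := by
        rintro w (_ | _)
        · rw [hef, G.opp_opp]
          rfl
        · rfl
      next_true := fun w => (hsusp w).symm
      next_false := hnf
      left_true := hlt
      left_false := hlf
      label := hlabel
      frame := fun a => (hbase a).symm }

/-- The number of darts of the standard galaxy. -/
theorem GalaxyData.IsValid.card_eq {b : ℕ} {q : GalaxyData b m n} (hq : q.IsValid μ ν) :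
    Nat.card ((Σ a, Fin (q.length a)) × Bool) = 2 * (b * ∑ i, μ i) := by
  have h1 : ∑ a, q.length a = b * ∑ i, μ i := by
    rw [← Finset.sum_fiberwise (s := Finset.univ) (g := q.white), Finset.mul_sum]
    exact Finset.sum_congr rfl fun i _ => (hq.lengths.white i).trans (mul_comm _ _)
  rw [Nat.card_prod, Nat.card_sigma]
  simp only [Nat.card_eq_fintype_card, Fintype.card_fin, Fintype.card_bool]
  rw [h1, mul_comm]

/-- Framed galaxies (G, φ) on D correspond bijectively to pairs (q, e) of valid data and an
identification of the standard dart set with D. Each G has 2^b framings and each q has |D|!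
identifications. -/
theorem card_framed (hm : 0 < m) (hn : 0 < n)
    (hD : Nat.card D = 2 * (branchCount g m n * ∑ i, μ i)) :
    Nat.card {G : HurwitzGalaxy D g μ ν // G.IsBiPruned} * 2 ^ branchCount g m n
      = Nat.card {q : GalaxyData (branchCount g m n) m n // q.IsValid μ ν}
        * (2 * (branchCount g m n * ∑ i, μ i)).factorial := by
  classical
  have := Fintype.ofFinite {G : HurwitzGalaxy D g μ ν // G.IsBiPruned}
  have := Fintype.ofFinite D
  have h1 : Nat.card (Σ G : {G : HurwitzGalaxy D g μ ν // G.IsBiPruned},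
      {φ : Fin (branchCount g m n) × Bool → D // IsFraming G.1 φ})
      = Nat.card {G : HurwitzGalaxy D g μ ν // G.IsBiPruned} * 2 ^ branchCount g m n := by
    rw [Nat.card_sigma, Finset.sum_congr rfl fun G _ => card_framings G.1, Finset.sum_const,
      Finset.card_univ, Nat.card_eq_fintype_card, smul_eq_mul]
  have he : ∀ q : {q : GalaxyData (branchCount g m n) m n // q.IsValid μ ν},
      Nonempty (((Σ a, Fin (q.1.length a)) × Bool ≃ D) ≃ Equiv.Perm D) := fun q => by
    obtain ⟨e⟩ := Finite.card_eq.1 (q.2.card_eq.trans hD.symm)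
    exact ⟨Equiv.equivCongr e (Equiv.refl D)⟩
  have h2 : Nat.card (Σ q : {q : GalaxyData (branchCount g m n) m n // q.IsValid μ ν},
      ((Σ a, Fin (q.1.length a)) × Bool ≃ D))
      = Nat.card {q : GalaxyData (branchCount g m n) m n // q.IsValid μ ν}
        * (2 * (branchCount g m n * ∑ i, μ i)).factorial := by
    rw [Nat.card_congr ((Equiv.sigmaCongrRight fun q => (he q).some).trans
      (Equiv.sigmaEquivProd _ _)), Nat.card_prod, Nat.card_eq_fintype_card (α := Equiv.Perm D),
      Fintype.card_perm, ← Nat.card_eq_fintype_card, hD]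
  rw [← h1, ← h2]
  choose G φ hG hφ hc using
    fun (s : Σ q : {q : GalaxyData (branchCount g m n) m n // q.IsValid μ ν},
      ((Σ a, Fin (q.1.length a)) × Bool ≃ D)) => exists_galaxy_of_data hm hn s.1.2 s.2
  refine (Nat.card_congr (Equiv.ofBijective (fun s => ⟨⟨G s, hG s⟩, ⟨φ s, hφ s⟩⟩) ?_)).symm
  constructor
  · rintro ⟨⟨q, hq⟩, e⟩ ⟨⟨q', hq'⟩, e'⟩ h
    have hGG := congrArg (fun x => x.1.1) h
    have hφφ := congrArg (fun x : (Σ G : {G : HurwitzGalaxy D g μ ν // G.IsBiPruned},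
      {φ : Fin (branchCount g m n) × Bool → D // IsFraming G.1 φ}) => x.2.1) h
    have h1 := hc ⟨⟨q, hq⟩, e⟩
    have h2 := hc ⟨⟨q', hq'⟩, e'⟩
    simp only at hGG hφφ
    rw [← hGG, ← hφφ] at h2
    obtain ⟨rfl, he⟩ := h1.unique_data (hφ _).injective h2
    exact congrArg (Sigma.mk _) (eq_of_heq he)
  · rintro ⟨⟨G', hG'⟩, ⟨φ', hφ'⟩⟩
    obtain ⟨q, hq, e, hqe⟩ := exists_data_of_galaxy hG' hφ'
    refine ⟨⟨⟨q, hq⟩, e⟩, ?_⟩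
    obtain ⟨h3, h4⟩ := (hc ⟨⟨q, hq⟩, e⟩).unique_galaxy hqe
    subst h3
    subst h4
    rfl

/-- The bi-pruned double Hurwitz number is the number of skeletons with edge lengths, divided by the
number of framings. -/
theorem biPrunedHurwitz_mul (hm : 0 < m) (hn : 0 < n) :
    biPrunedHurwitz g μ ν * 2 ^ branchCount g m n
      = Nat.card {q : GalaxyData (branchCount g m n) m n // q.IsValid μ ν} := by
  have h1 := factorial_mul_biPrunedHurwitz (g := g) (μ := μ) (ν := ν) hm hn
  have h2 := card_framed (g := g) (μ := μ) (ν := ν)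
    (D := Fin (2 * (branchCount g m n * ∑ i, μ i))) hm hn (by simp)
  have h3 : ((2 * (branchCount g m n * ∑ i, μ i)).factorial : ℚ) ≠ 0 := by
    exact_mod_cast (Nat.factorial_pos _).ne'
  apply mul_left_cancel₀ h3
  rw [← mul_assoc, h1]
  exact_mod_cast h2.trans (mul_comm _ _)

end Count

end Hurwitz

namespace Hurwitz

set_option linter.unusedSectionVars false

/-! ### Edge lengths and flows -/

section Lengths

theorem val_finRotate_pow {b : ℕ} (l : ℕ) (k : Fin b) :
    ((finRotate b ^ l) k : ℕ) = (k + l) % b := by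
  have := k.neZero
  induction l with
  | zero => exact (Nat.mod_eq_of_lt k.2).symm
  | succ l ih =>
    rw [pow_succ', Equiv.Perm.mul_apply, finRotate_apply, Fin.val_add, ih, Fin.val_one', ← add_assoc]
    simp

theorem ClassifiesOrbits.sum_comp {A Y : Type*} [Fintype A] [DecidableEq Y] {σ : Equiv.Perm A}
    {f : A → Y} (h : ClassifiesOrbits σ f) (y : Y) (v : A → ℕ) :
    ∑ a with f a = y, v (σ a) = ∑ a with f a = y, v a :=
  Finset.sum_equiv σ (fun a => by simp [h.map_eq]) fun _ _ => rfl

variable {b m n : ℕ} {π : Equiv.Perm (Fin b × Bool)} {wl : Fin b × Bool → Fin m}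
  {bl : Fin b × Bool → Fin n}

/-- The edges which pass from the label `b` to the label `1`. -/
def crossing (π : Equiv.Perm (Fin b × Bool)) : Finset (Fin b × Bool) :=
  Finset.univ.filter fun a => (π a).1 ≤ a.1

/-- The edge lengths, divided by `b`, are a flow with prescribed supplies and demands. -/
theorem sum_eq_iff {Y : Type*} [DecidableEq Y] {σ : Equiv.Perm (Fin b × Bool)}
    {f : Fin b × Bool → Y} (h : ClassifiesOrbits σ f) {ℓ c : Fin b × Bool → ℕ}
    (hc : ∀ a, ℓ a + a.1 = b * c a + (σ a).1) (y : Y) (d : ℕ) :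
    ∑ a with f a = y, ℓ a = d * b ↔ ∑ a with f a = y, c a = d := by
  obtain ⟨a₀, -⟩ := h.surjective y
  have hb : 0 < b := Fin.pos a₀.1
  have h1 : ∑ a with f a = y, ℓ a + ∑ a with f a = y, (a.1 : ℕ)
      = b * ∑ a with f a = y, c a + ∑ a with f a = y, ((σ a).1 : ℕ) := by
    rw [← Finset.sum_add_distrib, Finset.mul_sum, ← Finset.sum_add_distrib]
    exact Finset.sum_congr rfl fun a _ => hc a
  -- The labels of initial and terminal corners have equal sums, because σ permutes the corners of
  -- each face.
  rw [h.sum_comp y fun a => (a.1 : ℕ), add_left_inj] at h1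
  rw [h1, mul_comm d, Nat.mul_right_inj hb.ne']

theorem sum_edgeVector_eq_iff (μ : Fin m → ℕ) (ν : Fin n → ℕ) (c : Fin b × Bool → ℕ) :
    ∑ e, c e • edgeVector (wl e) (bl e) = Sum.elim (fun i => (μ i : ℤ)) (fun j => (ν j : ℤ)) ↔
      (∀ i, ∑ a with wl a = i, c a = μ i) ∧ ∀ j, ∑ a with bl a = j, c a = ν j := by
  rw [funext_iff, Sum.forall]
  refine and_congr (forall_congr' fun i => ?_) (forall_congr' fun j => ?_)
  · rw [Sum.elim_inl, ← Nat.cast_inj (R := ℤ)]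
    simp [edgeVector, Pi.single_apply, Finset.sum_filter, eq_comm]
  · rw [Sum.elim_inr, ← Nat.cast_inj (R := ℤ)]
    simp [edgeVector, Pi.single_apply, Finset.sum_filter, eq_comm]

/-- The bijection sends ℓ to c a = (ℓ a + a.1) / b, the number of times the edge passes from the
last label to the first. -/
theorem card_lengths (h : IsSkeleton π wl bl) (μ : Fin m → ℕ) (ν : Fin n → ℕ) :
    Nat.card {ℓ // IsLength π wl bl μ ν ℓ} = netCount wl bl Finset.univ (crossing π)
      (Sum.elim (fun i => (μ i : ℤ)) (fun j => (ν j : ℤ))) := by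
  have hto : ∀ {ℓ : Fin b × Bool → ℕ}, IsLength π wl bl μ ν ℓ →
      ∀ a, ℓ a + a.1 = b * ((ℓ a + a.1) / b) + (π a).1 := fun {ℓ} hℓ a => by
    conv_lhs => rw [← Nat.div_add_mod (ℓ a + a.1) b]
    rw [← hℓ.label, val_finRotate_pow, add_comm (a.1 : ℕ)]
  -- The natural subtraction does not truncate: if the terminal label is larger than the initial
  -- one, c a may be 0, and otherwise a is in `crossing π` and b * c a ≥ b.
  have hof : ∀ {c : Fin b × Bool → ℕ}, (∀ a ∈ crossing π, 0 < c a) →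
      ∀ a, (b * c a + (π a).1 - a.1) + a.1 = b * c a + (π a).1 ∧ 0 < b * c a + (π a).1 - a.1 :=
      fun {c} hc a => by
    have h1 := a.1.2
    have h2 : (a.1 : ℕ) < b * c a + (π a).1 := by
      by_cases ha : (π a).1 ≤ a.1
      · have h3 : b ≤ b * c a := Nat.le_mul_of_pos_right _ (hc a (by simpa [crossing] using ha))
        omega
      · have h3 : a.1 < (π a).1 := not_le.1 ha
        have h4 : (a.1 : ℕ) < (π a).1 := h3
        omega
    omega
  rw [netCount, ← Nat.card_coe_set_eq]
  refine Nat.card_congr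
    { toFun := fun ℓ => ⟨fun a => (ℓ.1 a + a.1) / b, by simp, fun a ha => ?_, ?_⟩
      invFun := fun c => ⟨fun a => b * c.1 a + (π a).1 - a.1, ?_⟩
      left_inv := fun ℓ => ?_
      right_inv := fun c => ?_ }
  · by_contra h0
    have h1 := hto ℓ.2 a
    have h0' : (ℓ.1 a + a.1) / b = 0 := Nat.eq_zero_of_not_pos h0
    rw [h0'] at h1
    have h2 := ℓ.2.pos a
    have h3 : (π a).1 ≤ a.1 := by simpa [crossing] using ha
    have h4 : ((π a).1 : ℕ) ≤ a.1 := h3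
    omega
  · rw [sum_edgeVector_eq_iff]
    -- The same relation serves black faces, since `cornerSwap` does not change the label of a
    -- corner.
    exact ⟨fun i => (sum_eq_iff h.white (hto ℓ.2) i _).1 (ℓ.2.white i),
      fun j => (sum_eq_iff h.black (hto ℓ.2) j _).1 (ℓ.2.black j)⟩
  · have hc := c.2.2.2
    rw [sum_edgeVector_eq_iff] at hc
    have h1 := fun a => (hof c.2.2.1 a).1
    exact
      { pos := fun a => (hof c.2.2.1 a).2
        label := fun a => by
          ext
          rw [val_finRotate_pow, add_comm (a.1 : ℕ), h1, Nat.mul_add_mod,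
            Nat.mod_eq_of_lt (π a).1.2]
        white := fun i => (sum_eq_iff h.white h1 i _).2 (hc.1 i)
        black := fun j => (sum_eq_iff h.black h1 j _).2 (hc.2 j) }
  · ext a
    have := hto ℓ.2 a
    show b * ((ℓ.1 a + a.1) / b) + (π a).1 - a.1 = ℓ.1 a
    omega
  · refine Subtype.ext (funext fun a => ?_)
    show (b * c.1 a + (π a).1 - a.1 + a.1) / b = c.1 a
    rw [(hof c.2.2.1 a).1, Nat.mul_add_div (Fin.pos a.1), Nat.div_eq_of_lt (π a).1.2, add_zero]

/-- The skeletons. -/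
abbrev Skeleton (b m n : ℕ) : Type :=
  {q : Equiv.Perm (Fin b × Bool) × (Fin b × Bool → Fin m) × (Fin b × Bool → Fin n) //
    IsSkeleton q.1 q.2.1 q.2.2}

theorem card_data [Fintype (Skeleton b m n)] (μ : Fin m → ℕ) (ν : Fin n → ℕ)
    (hfin : ∀ q : Skeleton b m n, Finite {ℓ // IsLength q.1.1 q.1.2.1 q.1.2.2 μ ν ℓ}) :
    Nat.card {q : GalaxyData b m n // q.IsValid μ ν} = ∑ q : Skeleton b m n,
      netCount q.1.2.1 q.1.2.2 Finset.univ (crossing q.1.1)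
        (Sum.elim (fun i => (μ i : ℤ)) (fun j => (ν j : ℤ))) := by
  have e : {q : GalaxyData b m n // q.IsValid μ ν} ≃
      Σ q : Skeleton b m n, {ℓ // IsLength q.1.1 q.1.2.1 q.1.2.2 μ ν ℓ} :=
    { toFun := fun q => ⟨⟨(q.1.perm, q.1.white, q.1.black), q.2.skeleton⟩, q.1.length, q.2.lengths⟩
      invFun := fun q => ⟨⟨q.1.1.1, q.1.1.2.1, q.1.1.2.2, q.2.1⟩, q.1.2, q.2.2⟩
      left_inv := fun q => rfl
      right_inv := fun q => rfl }
  rw [Nat.card_congr e, Nat.card_sigma]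
  exact Finset.sum_congr rfl fun q _ => card_lengths q.2 μ ν

theorem finite_lengths (μ : Fin m → ℕ) (ν : Fin n → ℕ) :
    Finite {ℓ // IsLength π wl bl μ ν ℓ} := by
  refine Set.Finite.to_subtype ((Set.Finite.pi' (t := fun a => Set.Iic (μ (wl a) * b))
    fun _ => Set.finite_Iic _).subset fun ℓ hℓ a => ?_)
  rw [Set.mem_Iic, ← hℓ.white]
  exact Finset.single_le_sum (f := ℓ) (fun _ _ => Nat.zero_le _) (by simp)

end Lengths

/-! ### Chambers -/

section Chamber

variable {m n : ℕ}

/-- The balance of the vertices in `S`, as a function on the real vector space. -/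
def realBalance (S : Finset (Fin m ⊕ Fin n)) (p : (Fin m → ℝ) × (Fin n → ℝ)) : ℝ :=
  ∑ i ∈ S.toLeft, p.1 i - ∑ j ∈ S.toRight, p.2 j

theorem realBalance_cast (S : Finset (Fin m ⊕ Fin n)) (μ : Fin m → ℕ) (ν : Fin n → ℕ) :
    (balance S (Sum.elim (fun i => (μ i : ℤ)) (fun j => (ν j : ℤ))) : ℝ)
      = realBalance S ((fun i => (μ i : ℝ)), (fun j => (ν j : ℝ))) := by
  show ((∑ v ∈ S, _ : ℤ) : ℝ) = _
  conv_lhs => rw [← Finset.toLeft_disjSum_toRight (u := S)]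
  rw [Finset.sum_disjSum]
  simp [realBalance, sub_eq_add_neg]

theorem realBalance_ne_zero {S : Finset (Fin m ⊕ Fin n)} (h1 : S ≠ ∅) (h2 : S ≠ Finset.univ)
    {p : (Fin m → ℝ) × (Fin n → ℝ)} (hp : p ∈ resonanceComplement m n) : realBalance S p ≠ 0 := by
  rw [realBalance, sub_ne_zero]
  refine hp.2 S.toLeft S.toRight (fun h => h1 ?_) fun h => h2 ?_
  · rw [← Finset.toLeft_disjSum_toRight (u := S), h.1, h.2]
    rfl
  · rw [← Finset.toLeft_disjSum_toRight (u := S), h.1, h.2]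
    ext v
    rcases v with v | v <;> simp

theorem continuous_realBalance (S : Finset (Fin m ⊕ Fin n)) : Continuous (realBalance S) := by
  unfold realBalance
  fun_prop

/-- In a chamber, the sign of the balance of each cut is constant. -/
theorem realBalance_mul_pos {S : Finset (Fin m ⊕ Fin n)} (h1 : S ≠ ∅) (h2 : S ≠ Finset.univ)
    {p q : (Fin m → ℝ) × (Fin n → ℝ)} (hp : p ∈ resonanceComplement m n)
    (hq : q ∈ connectedComponentIn (resonanceComplement m n) p) :
    0 < realBalance S p * realBalance S q := by
  have hconn := isPreconnected_connectedComponentIn (F := resonanceComplement m n) (x := p)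
  have hpC := mem_connectedComponentIn hp
  have hcont := (continuous_realBalance S).continuousOn 
    (s := connectedComponentIn (resonanceComplement m n) p)
  have h0 : ∀ r ∈ connectedComponentIn (resonanceComplement m n) p, realBalance S r ≠ 0 :=
    fun r hr => realBalance_ne_zero h1 h2 (connectedComponentIn_subset _ _ hr)
  by_contra hneg
  rw [not_lt] at hneg
  rcases mul_nonpos_iff.1 hneg with ⟨h3, h4⟩ | ⟨h3, h4⟩
  · obtain ⟨r, hr, hr0⟩ := hconn.intermediate_value hq hpC hcont ⟨h4, h3⟩
    exact h0 r hr hr0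
  · obtain ⟨r, hr, hr0⟩ := hconn.intermediate_value hpC hq hcont ⟨h3, h4⟩
    exact h0 r hr hr0

end Chamber

end Hurwitz

/-! ### Summation over the skeletons -/

theorem mainTheorem2 (g m n : ℕ) (hm : 0 < m) (hn : 0 < n)
    (C : Set ((Fin m → ℝ) × (Fin n → ℝ))) (hC : Hurwitz.IsChamber C) :
    ∃ P : MvPolynomial (Fin m ⊕ Fin n) ℚ,
      (∀ s ∈ P.support, (s.degree : ℤ) ≤ 4 * (g : ℤ) - 3 + m + n) ∧
      ∀ (μ : Fin m → ℕ) (ν : Fin n → ℕ), (μ, ν) ∈ Hurwitz.partitionPairs m n →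
        ((fun i => (μ i : ℝ)), (fun j => (ν j : ℝ))) ∈ C →
          Hurwitz.biPrunedHurwitz g μ ν
            = MvPolynomial.eval (Sum.elim (fun i => (μ i : ℚ)) (fun j => (ν j : ℚ))) P := by
  classical
  obtain ⟨p, hp, rfl⟩ := hC
  set b := Hurwitz.branchCount g m n with hb
  have := Fintype.ofFinite (Hurwitz.Skeleton b m n)
  -- The base point p of the chamber prescribes the sign of every cut.
  choose P hP hP' using fun q : Hurwitz.Skeleton b m n =>
    Hurwitz.exists_polynomial_netCount q.1.2.1 q.1.2.2 (⟨0, hm⟩ : Fin m)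
      (fun S => Hurwitz.realBalance S p) (Hurwitz.crossing q.1.1) Finset.univ (Finset.subset_univ _)
  refine ⟨((2 : ℚ) ^ b)⁻¹ • ∑ q, P q, fun s hs => ?_, fun μ ν hμν hC => ?_⟩
  · obtain ⟨q, -, hq⟩ := Finset.mem_biUnion.1
      (MvPolynomial.support_sum (MvPolynomial.support_smul hs))
    have h := hP q s hq
    -- With 2b edges and m + n vertices the degree is at most 2b + 1 - (m + n), and b = 2g - 2 + m +
    -- n without truncation.
    simp only [Fintype.card_sum, Fintype.card_fin, Finset.card_univ, Fintype.card_prod,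
      Fintype.card_bool] at h
    rw [hb, Hurwitz.branchCount] at h
    omega
  · have h := Hurwitz.biPrunedHurwitz_mul (g := g) (μ := μ) (ν := ν) hm hn
    rw [Hurwitz.card_data μ ν fun q => Hurwitz.finite_lengths μ ν] at h
    change _ * (2 : ℚ) ^ b = _ at h
    rw [← eq_mul_inv_iff_mul_eq₀ (by positivity), mul_comm] at h
    rw [h, MvPolynomial.smul_eval, map_sum, Nat.cast_sum]
    congr 1
    refine Finset.sum_congr rfl fun q _ => ?_
    rw [hP' q]
    · congr 2
      ext v
      rcases v with v | v <;> simp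
    · show _ = _
      rw [Hurwitz.balance_univ]
      have := hμν.2.2
      simp only at this
      simp only [Sum.elim_inl, Sum.elim_inr]
      rw [sub_eq_zero]
      exact_mod_cast this
    · intro S h1 h2
      rw [Hurwitz.realBalance_cast]
      exact Hurwitz.realBalance_mul_pos h1 h2 hp hC
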